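/- On $\mathbb{R}^n$ use the norm $|z|=\sum_i|z_i|$. A *trapezoid* is a closed convex set $K\subseteq[0,\infty)\times\mathbb{R}$ of positive Lebesgue measure which, with every point $(t,x)$, contains the closed triangle with vertices $(t,x),(0,x-t),(0,x+t)$. Put $K_t=\{x:(t,x)\in K\}$ and $J=\{t\ge 0: K_t\ne\emptyset\}$. *Data.* $L^{1,1}(K_0)$ is the space of pairs $(u_0,v_0)$ of $\mathbb{R}^n$-valued functions on $K_0$ such that $u_0\in L^\infty(K_0)$ (taken continuous on $K_0$) has a weak derivative $Du_0\in L^1(K_0)$, and $v_0\in L^1(K_0)$; its norm is $\|u_0\|_{L^\infty(K_0)}+\|Du_0\|_{L^1(K_0)}+\|v_0\|_{L^1(K_0)}$. *Solution space.* $\mathscr H(K)$ is the space of bounded continuous $u:K\to\mathbb{R}^n$ with weak derivatives $\partial_tu,\partial_xu\in L^1_{\rm loc}(K)$ on the interior of $K$ which belong to $C_b(J;L^1(K_\cdot))$, that is, their extensions by $0$ to $J\times K_0$ are bounded continuous maps $J\to L^1(K_0)$. Its norm is $$\|u\|_{\mathscr H(K)}=\sup_{K}|u|+\sup_{t\in J}\int_{K_t}\bigl(|\partial_xu(t,x)|+|\partial_tu(t,x)|\bigr)\,dx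 .$$ *Equation.* Let $\Gamma_{jk}:\mathbb{R}^n\to\mathbb{R}^n$ ($1\le j,k\le n$) and $P:\mathbb{R}^n\to\mathcal L(\mathbb{R}^n)$ be bounded and globally Lipschitz, and write $$N(u)=\sum_{j,k=1}^n\Gamma_{jk}(u)\bigl(\partial_tu_j\,\partial_tu_k-\partial_xu_j\,\partial_xu_k\bigr)+P(u)f .$$ For $(u_0,v_0)\in L^{1,1}(K_0)$ and $f\in L^1(K;\mathbb{R}^n)$, a *mild solution* on $K$ of $\partial_t^2u-\partial_x^2u=N(u)$, $u(0,\cdot)=u_0$, $\partial_tu(0,\cdot)=v_0$, is a continuous $u:K\to\mathbb{R}^n$ with weak derivatives $\partial_tu,\partial_xu\in L^1_{\rm loc}(K)$ and with $N(u)\in L^1_{\rm loc}(K)$ such that for every $(t,x)\in K$ $$u(t,x)=\tfrac12\bigl(u_0(x+t)+u_0(x-t)\bigr)+\tfrac12\int_{x-t}^{x+t}v_0(y)\,dy+\tfrac12\int_0^t\int_{x-t+\tau}^{x+t-\tau}N(u)(\tau,y)\,dy\,d\tau .$$ **Theorem.** Let $K$ be a trapezoid and let $\Gamma_{jk},P$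 be bounded and globally Lipschitz. Then there is $\eta>0$ such that, with $\mathscr O_\eta$ the set of all $(u_0,v_0,f)\in L^{1,1}(K_0)\times L^1(K;\mathbb{R}^n)$ satisfying $$\|Du_0+v_0\|_{L^1(K_0)}\le\eta,\qquad \|Du_0-v_0\|_{L^1(K_0)}\le\eta,\qquad \|f\|_{L^1(K)}\le\eta ,$$ the following hold. 1. For every $(u_0,v_0,f)\in\mathscr O_\eta$ there is a mild solution $u\in\mathscr H(K)$. 2. There is $R>0$ (the same for all data in $\mathscr O_\eta$) such that for every $(u_0,v_0,f)\in\mathscr O_\eta$ there is a mild solution $u\in\mathscr H(K)$ with $\|N(u)\|_{L^1(K)}\le R$, and it is the only mild solution in $\mathscr H(K)$ with this bound. 3. $\mathscr O_\eta$ is closed in $L^{1,1}(K_0)\times L^1(K;\mathbb{R}^n)$, and the map $\mathscr O_\eta\ni(u_0,v_0,f)\mapsto u\in\mathscr H(K)$, where $u$ is the solution from part 2, is continuous. -/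

import Mathlib

open MeasureTheory Set Filter Topology
open scoped ENNReal NNReal ContDiff

noncomputable section

/-- The space `ℝⁿ` with the `ℓ¹`-norm `|z| = ∑ i, |z i|`. -/
abbrev Vec (n : ℕ) : Type := PiLp 1 (fun _ : Fin n => ℝ)

namespace WaveMap

/-! Points of the half plane are written `(t, x) : ℝ × ℝ`, time first. -/

/-- An (abstract) trapezoid: a closed convex set of positive Lebesgue measure in `[0, ∞) × ℝ` which
with every point `(t, x)` contains the closed triangle with vertices `(t, x)`, `(0, x - t)` and
`(0, x + t)`. -/
structure IsTrapezoid (K : Set (ℝ × ℝ)) : Prop where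
  time_nonneg : ∀ z ∈ K, 0 ≤ z.1
  isClosed : IsClosed K
  convex : Convex ℝ K
  volume_pos : 0 < volume K
  triangle_subset : ∀ z ∈ K,
    convexHull ℝ {z, ((0 : ℝ), z.2 - z.1), ((0 : ℝ), z.2 + z.1)} ⊆ K

/-- The time slice `K_t = {x | (t, x) ∈ K}`. -/
def slice (K : Set (ℝ × ℝ)) (t : ℝ) : Set ℝ := {x | (t, x) ∈ K}

/-- The base `K_0`. -/
abbrev base (K : Set (ℝ × ℝ)) : Set ℝ := slice K 0

/-- The times `t` with `K_t ≠ ∅`. For a trapezoid this is the interval `[0, T₀]` if the height `T₀`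
is finite (and attained), and `[0, ∞)` if the height is infinite. -/
def timeSet (K : Set (ℝ × ℝ)) : Set ℝ := {t | (slice K t).Nonempty}

/-- `g` is the weak derivative of `w` in the interior of `I ⊆ ℝ`. -/
def HasWeakDeriv {n : ℕ} (I : Set ℝ) (w g : ℝ → Vec n) : Prop :=
  ∀ φ : ℝ → ℝ, ContDiff ℝ ∞ φ → HasCompactSupport φ → tsupport φ ⊆ interior I →
    ∫ x in I, deriv φ x • w x = -∫ x in I, φ x • g x

/-- `ut` and `ux` are locally integrable on `K` and are the weak derivatives `∂_t u` and `∂_x u`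
of `u` in the interior of `K`. -/
structure HasWeakPartials {n : ℕ} (K : Set (ℝ × ℝ)) (u ut ux : ℝ × ℝ → Vec n) : Prop where
  locInt_t : LocallyIntegrableOn ut K
  locInt_x : LocallyIntegrableOn ux K
  weak_t : ∀ φ : ℝ × ℝ → ℝ, ContDiff ℝ ∞ φ → HasCompactSupport φ → tsupport φ ⊆ interior K →
    ∫ z in K, fderiv ℝ φ z (1, 0) • u z = -∫ z in K, φ z • ut z
  weak_x : ∀ φ : ℝ × ℝ → ℝ, ContDiff ℝ ∞ φ → HasCompactSupport φ → tsupport φ ⊆ interior K →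
    ∫ z in K, fderiv ℝ φ z (0, 1) • u z = -∫ z in K, φ z • ux z

/-- `v ∈ C_b([0, T₀]; L¹(K_·))`: the extension of `v` by zero to `[0, T₀] × K_0` is a bounded and
continuous function of time with values in `L¹(K_0)`. -/
structure IsCbL1 {n : ℕ} (K : Set (ℝ × ℝ)) (v : ℝ × ℝ → Vec n) : Prop where
  aestronglyMeasurable : AEStronglyMeasurable v (volume.restrict K)
  integrableOn_slice : ∀ t ∈ timeSet K, IntegrableOn (fun x => v (t, x)) (slice K t)
  bounded : ∃ C : ℝ≥0, ∀ t ∈ timeSet K, ∫⁻ x in slice K t, ‖v (t, x)‖ₑ ≤ C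
  continuous : ∀ t ∈ timeSet K,
    Tendsto (fun s => ∫⁻ x in base K, ‖K.indicator v (s, x) - K.indicator v (t, x)‖ₑ)
      (𝓝[timeSet K] t) (𝓝 0)

/-- A function `u` together with representatives of its weak derivatives `∂_t u` and `∂_x u`. -/
structure Triple (n : ℕ) where
  u : ℝ × ℝ → Vec n
  ut : ℝ × ℝ → Vec n
  ux : ℝ × ℝ → Vec n

/-- Membership of `u` in the space `𝓗(K)`. -/
structure MemH {n : ℕ} (K : Set (ℝ × ℝ)) (U : Triple n) : Prop where
  continuousOn : ContinuousOn U.u K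
  bounded : ∃ C : ℝ, ∀ z ∈ K, ‖U.u z‖ ≤ C
  weakPartials : HasWeakPartials K U.u U.ut U.ux
  ut_mem : IsCbL1 K U.ut
  ux_mem : IsCbL1 K U.ux

/-- The distance `‖u - u'‖_{𝓗(K)}`, that is
`sup_K |u - u'| + sup_t ∫_{K_t} (|∂_x (u - u')| + |∂_t (u - u')|) dx`. -/
def distH {n : ℕ} (K : Set (ℝ × ℝ)) (U U' : Triple n) : ℝ≥0∞ :=
  (⨆ z ∈ K, ‖U.u z - U'.u z‖ₑ) +
    ⨆ t ∈ timeSet K, ∫⁻ x in slice K t,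
      (‖U.ux (t, x) - U'.ux (t, x)‖ₑ + ‖U.ut (t, x) - U'.ut (t, x)‖ₑ)

/-- Initial position `u₀`, a representative `Du₀` of its weak derivative, initial velocity `v₀`
and forcing `f`. -/
structure Data (n : ℕ) where
  u₀ : ℝ → Vec n
  Du₀ : ℝ → Vec n
  v₀ : ℝ → Vec n
  f : ℝ × ℝ → Vec n

/-- `(u₀, v₀) ∈ (L^∞ ∩ Ẇ^{1,1})(K_0) × L¹(K_0)` and `f ∈ L¹(K)`; as usual `u₀` is the continuous
representative. -/
structure Data.Admissible {n : ℕ} (K : Set (ℝ × ℝ)) (d : Data n) : Prop where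
  continuousOn : ContinuousOn d.u₀ (base K)
  memLp_u₀ : MemLp d.u₀ ∞ (volume.restrict (base K))
  integrable_Du₀ : IntegrableOn d.Du₀ (base K)
  weakDeriv : HasWeakDeriv (base K) d.u₀ d.Du₀
  integrable_v₀ : IntegrableOn d.v₀ (base K)
  integrable_f : IntegrableOn d.f K

/-- The distance in `(L^∞ ∩ Ẇ^{1,1})(K_0) × L¹(K_0) × L¹(K)`. -/
def Data.dist {n : ℕ} (K : Set (ℝ × ℝ)) (d d' : Data n) : ℝ≥0∞ :=
  eLpNorm (d.u₀ - d'.u₀) ∞ (volume.restrict (base K)) +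
    eLpNorm (d.Du₀ - d'.Du₀) 1 (volume.restrict (base K)) +
    eLpNorm (d.v₀ - d'.v₀) 1 (volume.restrict (base K)) +
    eLpNorm (d.f - d'.f) 1 (volume.restrict K)

/-- The set `𝒪_η` of small data. -/
def smallData {n : ℕ} (K : Set (ℝ × ℝ)) (η : ℝ) : Set (Data n) :=
  {d | d.Admissible K ∧
    eLpNorm (d.Du₀ + d.v₀) 1 (volume.restrict (base K)) ≤ ENNReal.ofReal η ∧
    eLpNorm (d.Du₀ - d.v₀) 1 (volume.restrict (base K)) ≤ ENNReal.ofReal η ∧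
    eLpNorm d.f 1 (volume.restrict K) ≤ ENNReal.ofReal η}

/-- The right-hand side
`∑_{j,k} Γ_{jk}(u) (∂_t u_j ∂_t u_k - ∂_x u_j ∂_x u_k) + P(u) f`. -/
def rhs {n : ℕ} (Γ : Fin n → Fin n → Vec n → Vec n) (P : Vec n → Vec n →L[ℝ] Vec n)
    (f : ℝ × ℝ → Vec n) (U : Triple n) (z : ℝ × ℝ) : Vec n :=
  (∑ j, ∑ k, (U.ut z j * U.ut z k - U.ux z j * U.ux z k) • Γ j k (U.u z)) + P (U.u z) (f z)

/-- `ℝⁿ`-valued mild solutions of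
`∂_t² u - ∂_x² u = ∑_{j,k} Γ_{jk}(u) (∂_t u_j ∂_t u_k - ∂_x u_j ∂_x u_k) + P(u) f`,
`u(0, ·) = u₀`, `∂_t u(0, ·) = v₀` on `K`. -/
structure IsMildSolution {n : ℕ} (K : Set (ℝ × ℝ)) (Γ : Fin n → Fin n → Vec n → Vec n)
    (P : Vec n → Vec n →L[ℝ] Vec n) (d : Data n) (U : Triple n) : Prop where
  continuousOn : ContinuousOn U.u K
  weakPartials : HasWeakPartials K U.u U.ut U.ux
  locInt_rhs : LocallyIntegrableOn (rhs Γ P d.f U) K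
  eq_mild : ∀ t x : ℝ, (t, x) ∈ K →
    U.u (t, x) = (1 / 2 : ℝ) • (d.u₀ (x + t) + d.u₀ (x - t))
      + (1 / 2 : ℝ) • (∫ y in (x - t)..(x + t), d.v₀ y)
      + (1 / 2 : ℝ) • (∫ τ in (0 : ℝ)..t, ∫ y in (x - t + τ)..(x + t - τ), rhs Γ P d.f U (τ, y))

/-- `u ∈ 𝓗(K)` is a mild solution whose right-hand side has `L¹(K)`-norm at most `R`. -/
structure IsSmallSolution {n : ℕ} (K : Set (ℝ × ℝ)) (Γ : Fin n → Fin n → Vec n → Vec n)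
    (P : Vec n → Vec n →L[ℝ] Vec n) (R : ℝ) (d : Data n) (U : Triple n) : Prop where
  memH : MemH K U
  mild : IsMildSolution K Γ P d U
  rhs_le : eLpNorm (rhs Γ P d.f U) 1 (volume.restrict K) ≤ ENNReal.ofReal R

end WaveMap

end

open MeasureTheory Set Filter Topology
open scoped ENNReal NNReal ContDiff

noncomputable section

/-! In characteristic directions the quadratic terms form a null form. With `a` and `b` the
derivatives with respect to `x - t` and `x + t`, one has `∂_x u = a + b`, `∂_t u = b - a` and `∂_t
u_j ∂_t u_k - ∂_x u_j ∂_x u_k = -2 (a_j b_k + b_j a_k)`: no product of two derivatives in the same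
direction occurs.

If `u` solves the linear equation with source `F ∈ L¹`, then `a` is transported along one family of
characteristics, up to the integral of `F` along them. Hence `|a(t,x)| ≤ α(x - t)` and `|b(t,x)| ≤
β(x + t)`, where `α` and `β` (`charBound`) are functions of one variable whose `L¹` norms are
bounded by the data and `½‖F‖`. Functions of the two characteristic variables can be multiplied: `∫∫
α(x-t) β(x+t) = ½ ‖α‖ ‖β‖` (`lintegral_mul_characteristics`). Therefore the right-hand side belongs
to `L¹(K)` (`lintegral_rhs_le`) and depends on `F` in a locally Lipschitz way
(`lintegral_rhs_sub_le`).

The unknown of the fixed point problem is thus `F` itself, in a ball of radius `R` of `L¹`: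
d'Alembert's formula turns `F` into `u`, and `F` is sent to `N(u)`. For small `η` and `R` this is a
contraction (`exists_profile_solves`), and d'Alembert's formula puts the resulting `u` into `𝓗(K)`
(`Profile.Regular.memH`).

Conversely, every mild solution with integrable `N(u)` is the d'Alembert function with source `F =
N(u)`; uniqueness of weak derivatives shows that `F` solves the fixed point equation almost
everywhere (`IsMildSolution.exists_profile`). Comparing two fixed points gives a Lipschitz estimate
in the data (`IsSmallSolution.distH_le`), from which uniqueness and continuous dependence follow
together. -/

namespace WaveMap

/-! ### Fubini on triangles, integration by parts and the du Bois-Reymond lemma. -/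

section

variable {E : Type*} [NormedAddCommGroup E] [NormedSpace ℝ E]

/-- Fubini's theorem on a triangle. -/
theorem intervalIntegral_triangle_swap {f : ℝ → ℝ → E} {a b : ℝ} (hab : a ≤ b)
    (hf : Integrable (Function.uncurry f) (volume.prod volume)) :
    ∫ t in a..b, ∫ s in a..t, f t s = ∫ s in a..b, ∫ t in s..b, f t s := by
  have key : ∀ t ∈ Set.uIcc a b, ∫ s in a..t, f t s =
      ∫ s in a..b, ({p : ℝ × ℝ | p.2 ≤ p.1}.indicator (Function.uncurry f)) (t, s) := by
    intro t ht
    rw [uIcc_of_le hab] at ht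
    rw [intervalIntegral.integral_of_le ht.1, intervalIntegral.integral_of_le hab,
      ← integral_indicator measurableSet_Ioc, ← integral_indicator measurableSet_Ioc]
    congr 1
    ext s
    by_cases h : s ≤ t
    · by_cases h' : a < s
      · simp [indicator, h, h', h.trans ht.2]
      · simp [indicator, h']
    · simp [indicator, h]
  have key' : ∀ s ∈ Set.uIcc a b, ∫ t in s..b, f t s =
      ∫ t in a..b, ({p : ℝ × ℝ | p.2 ≤ p.1}.indicator (Function.uncurry f)) (t, s) := by
    intro s hs
    rw [uIcc_of_le hab] at hs
    rw [intervalIntegral.integral_of_le hs.2, intervalIntegral.integral_of_le hab,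
      ← integral_Icc_eq_integral_Ioc, ← integral_Icc_eq_integral_Ioc,
      ← integral_indicator measurableSet_Icc, ← integral_indicator measurableSet_Icc]
    congr 1
    ext t
    by_cases h : s ≤ t
    · by_cases h' : t ≤ b
      · simp [indicator, h, h', hs.1.trans h]
      · simp [indicator, h']
    · simp [indicator, h]
  rw [intervalIntegral.integral_congr key, intervalIntegral.integral_congr key']
  refine intervalIntegral_intervalIntegral_swap (F := fun t s =>
    ({p : ℝ × ℝ | p.2 ≤ p.1}.indicator (Function.uncurry f)) (t, s)) ?_
  exact ((hf.indicator (measurableSet_le measurable_snd measurable_fst)).mono_measure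
    Measure.restrict_le_self)

variable [CompleteSpace E]

/-- Integration by parts against a test function for a primitive of a locally integrable
function. -/
theorem integral_deriv_smul_primitive {w g : ℝ → E} (hg : LocallyIntegrable g)
    (hw : ∀ x y, w y - w x = ∫ s in x..y, g s) {φ : ℝ → ℝ} (hφ : ContDiff ℝ 1 φ)
    (hc : HasCompactSupport φ) :
    ∫ x, deriv φ x • w x = -∫ x, φ x • g x := by
  obtain ⟨r, hr⟩ := hc.isCompact.isBounded.subset_closedBall 0
  -- The inequality `r < q` must be strict: `q` belongs to `Ioc (-q) q`, and `φ` has to vanish at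
  -- both end points for the boundary terms to drop out.
  obtain ⟨q, hq0, hrq⟩ : ∃ q, 0 < q ∧ r < q := ⟨max 1 (r + 1), by positivity, by simp⟩
  have hout : ∀ x, x ∉ Ioc (-q) q → x ∉ tsupport φ := fun x hx h => by
    have := hr h
    rw [Metric.mem_closedBall, dist_zero_right, Real.norm_eq_abs, abs_le] at this
    exact hx ⟨by linarith, by linarith⟩
  have hφ0 : ∀ x, x ∉ Ioc (-q) q → φ x = 0 := fun x hx => image_eq_zero_of_notMem_tsupport (hout x hx)
  have hdφ0 : ∀ x, x ∉ Ioc (-q) q → deriv φ x = 0 := fun x hx => by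
    by_contra h
    exact hout x hx (support_deriv_subset h)
  have hqq : -q ≤ q := by linarith
  have hφq : φ q = 0 := by
    refine image_eq_zero_of_notMem_tsupport fun h => ?_
    have := hr h
    rw [Metric.mem_closedBall, dist_zero_right, Real.norm_eq_abs, abs_le] at this
    linarith
  have hφq' : φ (-q) = 0 := hφ0 _ (by simp)
  have hdc : Continuous (deriv φ) := hφ.continuous_deriv le_rfl
  have hftc : ∀ s, ∫ t in s..q, deriv φ t = - φ s := fun s => by
    rw [intervalIntegral.integral_deriv_eq_sub (fun x _ => (hφ.differentiable one_ne_zero) x)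
      (hdc.intervalIntegrable _ _), hφq, zero_sub]
  have h1 : ∫ x, deriv φ x • w x = ∫ x in (-q)..q, deriv φ x • w x := by
    rw [intervalIntegral.integral_of_le hqq, setIntegral_eq_integral_of_forall_compl_eq_zero]
    intro x hx; rw [hdφ0 x hx, zero_smul]
  have h2 : ∫ x, φ x • g x = ∫ x in (-q)..q, φ x • g x := by
    rw [intervalIntegral.integral_of_le hqq, setIntegral_eq_integral_of_forall_compl_eq_zero]
    intro x hx; rw [hφ0 x hx, zero_smul]
  have hgi : ∀ x y, IntervalIntegrable g volume x y := fun x y =>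
    (hg.integrableOn_isCompact isCompact_uIcc).intervalIntegrable
  have hw' : ∀ x, w x = w (-q) + ∫ s in (-q)..x, g s := fun x => by rw [← hw]; abel
  have hwc : Continuous fun x => ∫ s in (-q)..x, g s :=
    intervalIntegral.continuous_primitive hgi _
  rw [h1, h2]
  have h3 : ∫ x in (-q)..q, deriv φ x • w x
      = (∫ x in (-q)..q, deriv φ x • w (-q)) + ∫ x in (-q)..q, ∫ s in (-q)..x, deriv φ x • g s := by
    rw [← intervalIntegral.integral_add]
    · refine intervalIntegral.integral_congr fun x _ => ?_
      simp only [intervalIntegral.integral_smul]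
      rw [← smul_add, ← hw']
    · exact (hdc.smul continuous_const).intervalIntegrable _ _
    · simp only [intervalIntegral.integral_smul]
      exact (hdc.smul hwc).intervalIntegrable _ _
  have h4 : ∫ x in (-q)..q, ∫ s in (-q)..x, deriv φ x • g s
      = ∫ x in (-q)..q, ∫ s in (-q)..x, (deriv φ x) • (Ioc (-q) q).indicator g s := by
    refine intervalIntegral.integral_congr fun x hx => ?_
    rw [uIcc_of_le hqq] at hx
    simp only [intervalIntegral.integral_of_le hx.1]
    refine setIntegral_congr_fun measurableSet_Ioc fun s hs => ?_
    simp only [indicator_of_mem (show s ∈ Ioc (-q) q from ⟨hs.1, hs.2.trans hx.2⟩)]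
  have hint : Integrable (Function.uncurry fun x s => (deriv φ x) • (Ioc (-q) q).indicator g s)
      (volume.prod volume) := by
    refine Integrable.smul_prod (f := deriv φ) (hdc.integrable_of_hasCompactSupport hc.deriv) ?_
    rw [integrable_indicator_iff measurableSet_Ioc]
    exact (hgi (-q) q).1
  rw [h3, h4, intervalIntegral_triangle_swap hqq hint, intervalIntegral.integral_smul_const, hftc,
    hφq', neg_zero, zero_smul, zero_add, ← intervalIntegral.integral_neg,
    intervalIntegral.integral_of_le hqq, intervalIntegral.integral_of_le hqq]
  refine setIntegral_congr_fun measurableSet_Ioc fun s hs => ?_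
  simp only [indicator_of_mem hs, intervalIntegral.integral_smul_const, hftc, neg_smul]

/-- The lemma of du Bois-Reymond. -/
theorem ae_eq_const_of_integral_deriv_smul_eq_zero {U : Set ℝ} (hU : IsOpen U)
    (hconv : OrdConnected U) {w : ℝ → E} (hw : LocallyIntegrableOn w U)
    (h : ∀ φ : ℝ → ℝ, ContDiff ℝ ∞ φ → HasCompactSupport φ → tsupport φ ⊆ U →
      ∫ x, deriv φ x • w x = 0) :
    ∃ c, ∀ᵐ x, x ∈ U → w x = c := by
  rcases U.eq_empty_or_nonempty with rfl | ⟨x₀, hx₀⟩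
  · exact ⟨0, by simp⟩
  have hsm : ∀ φ : ℝ → ℝ, ContDiff ℝ ∞ φ → HasCompactSupport φ → tsupport φ ⊆ U →
      Integrable fun x => φ x • w x := fun φ h1 h2 h3 => by
    have : IntegrableOn (fun x => φ x • w x) (tsupport φ) :=
      (hw.integrableOn_compact_subset h3 h2).continuousOn_smul h1.continuous.continuousOn h2
    refine (integrableOn_iff_integrable_of_support_subset ?_).1 this
    exact (Function.support_smul_subset_left _ _).trans (subset_tsupport φ)
  obtain ⟨θ, hθ1, hθ2, hθ3, hθ4⟩ : ∃ θ : ℝ → ℝ, ContDiff ℝ ∞ θ ∧ HasCompactSupport θ ∧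
      tsupport θ ⊆ U ∧ ∫ x, θ x = 1 := by
    obtain ⟨r, hr, hrU⟩ := Metric.isOpen_iff.1 hU x₀ hx₀
    let b : ContDiffBump x₀ := ⟨r / 4, r / 2, by linarith, by linarith⟩
    refine ⟨b.normed volume, b.contDiff_normed, b.hasCompactSupport_normed, ?_, b.integral_normed⟩
    rw [b.tsupport_normed_eq]
    exact (Metric.closedBall_subset_ball (by show r / 2 < r; linarith)).trans hrU
  refine ⟨∫ x, θ x • w x, ?_⟩
  have main : ∀ ψ : ℝ → ℝ, ContDiff ℝ ∞ ψ → HasCompactSupport ψ → tsupport ψ ⊆ U →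
      ∫ x, ψ x • w x = (∫ x, ψ x) • ∫ x, θ x • w x := by
    intro ψ h1 h2 h3
    -- Subtracting a multiple of `θ` gives mean zero, so the primitive `Z` of `ζ` has compact
    -- support and is an admissible test function with `deriv Z = ζ`.
    set ζ : ℝ → ℝ := fun x => ψ x - (∫ y, ψ y) * θ x with hζ
    have hζs : ContDiff ℝ ∞ ζ := h1.sub (contDiff_const.mul hθ1)
    have hψi : Integrable ψ := h1.continuous.integrable_of_hasCompactSupport h2
    have hθi : Integrable θ := hθ1.continuous.integrable_of_hasCompactSupport hθ2
    have hζi : Integrable ζ := hψi.sub (hθi.const_mul _)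
    have hζ0 : ∫ x, ζ x = 0 := by
      rw [integral_sub hψi (hθi.const_mul _), integral_const_mul, hθ4]; ring
    -- The support of `Z` may fill the gaps of `S`, so the whole interval `[p, q]` must lie in `U`;
    -- this is where order-connectedness enters. The point `x₀` only makes `S` nonempty.
    set S := tsupport ψ ∪ tsupport θ ∪ {x₀} with hS
    have hSc : IsCompact S := (h2.isCompact.union hθ2.isCompact).union isCompact_singleton
    have hSU : S ⊆ U := union_subset (union_subset h3 hθ3) (singleton_subset_iff.2 hx₀)
    have hSn : S.Nonempty := ⟨x₀, by simp [hS]⟩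
    set p := sInf S
    set q := sSup S
    have hpS : p ∈ S := hSc.sInf_mem hSn
    have hqS : q ∈ S := hSc.sSup_mem hSn
    have hpq : Icc p q ⊆ U := hconv.out (hSU hpS) (hSU hqS)
    have hSpq : ∀ x ∈ S, x ∈ Icc p q := fun x hx =>
      ⟨csInf_le hSc.bddBelow hx, le_csSup hSc.bddAbove hx⟩
    have hζout : ∀ x, x ∉ Icc p q → ζ x = 0 := fun x hx => by
      have h' : x ∉ S := fun h' => hx (hSpq x h')
      simp only [hS, mem_union, not_or] at h'
      simp [hζ, image_eq_zero_of_notMem_tsupport h'.1.1, image_eq_zero_of_notMem_tsupport h'.1.2]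
    set Z : ℝ → ℝ := fun x => ∫ s in p..x, ζ s with hZ
    have hZd : ∀ x, HasDerivAt Z (ζ x) x := fun x =>
      intervalIntegral.integral_hasDerivAt_right (hζs.continuous.intervalIntegrable _ _)
        (hζs.continuous.stronglyMeasurableAtFilter _ _) hζs.continuous.continuousAt
    have hZd' : deriv Z = ζ := funext fun x => (hZd x).deriv
    have hZs : ContDiff ℝ ∞ Z :=
      contDiff_infty_iff_deriv.2 ⟨fun x => (hZd x).differentiableAt, hZd' ▸ hζs⟩
    have hZout : ∀ x, x ∉ Icc p q → Z x = 0 := fun x hx => by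
      rcases lt_or_ge x p with hxp | hxp
      · simp only [hZ]
        rw [intervalIntegral.integral_symm, intervalIntegral.integral_of_le hxp.le,
          ← integral_Ico_eq_integral_Ioc, neg_eq_zero]
        exact setIntegral_eq_zero_of_forall_eq_zero fun s hs =>
          hζout s fun h => absurd h.1 (not_le.2 hs.2)
      · have hqx : q < x := not_le.1 fun h => hx ⟨hxp, h⟩
        simp only [hZ]
        rw [intervalIntegral.integral_of_le hxp, ← integral_Icc_eq_integral_Ioc, ← hζ0]
        refine setIntegral_eq_integral_of_forall_compl_eq_zero fun s hs => hζout s fun h => hs ?_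
        exact ⟨h.1, h.2.trans hqx.le⟩
    have hZsupp : tsupport Z ⊆ Icc p q :=
      closure_minimal (fun x hx => by_contra fun h => hx (hZout x h)) isClosed_Icc
    have := h Z hZs (HasCompactSupport.of_support_subset_isCompact isCompact_Icc
      ((subset_tsupport Z).trans hZsupp)) (hZsupp.trans hpq)
    rw [hZd'] at this
    simp only [hζ, sub_smul, mul_smul] at this
    rw [integral_sub (hsm ψ h1 h2 h3)
      (show Integrable fun x => (∫ y, ψ y) • θ x • w x from (hsm θ hθ1 hθ2 hθ3).smul _),
      integral_smul, sub_eq_zero] at this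
    exact this
  have := hU.ae_eq_zero_of_integral_contDiff_smul_eq_zero (μ := volume)
    (f := fun x => w x - ∫ x, θ x • w x)
    (hw.sub (locallyIntegrableOn_const _)) ?_
  · filter_upwards [this] with x hx hxU using sub_eq_zero.1 (hx hxU)
  · intro ψ h1 h2 h3
    simp only [smul_sub]
    rw [integral_sub (hsm ψ h1 h2 h3), main ψ h1 h2 h3, integral_smul_const, sub_self]
    exact ((h1.continuous.smul continuous_const).integrable_of_hasCompactSupport
      (h2.smul_right))

end

/-! ### One-dimensional weak derivatives, shears and translations in `L¹`. -/

section

variable {n : ℕ}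

/-- Subtract from `w` the primitive of `g` extended by zero. The difference has weak derivative
zero, so it is almost everywhere constant in the interior by du Bois-Reymond. Continuity removes the
exceptional set and carries the constant to the end points, because a convex set with interior lies
in the closure of its interior. -/
theorem HasWeakDeriv.sub_eq_integral {I : Set ℝ} (hI : Convex ℝ I) (hne : (interior I).Nonempty)
    {w g : ℝ → Vec n} (hw : ContinuousOn w I) (hg : IntegrableOn g I) (h : HasWeakDeriv I w g)
    {x y : ℝ} (hx : x ∈ I) (hy : y ∈ I) : w y - w x = ∫ s in x..y, g s := by
  have hIm : MeasurableSet I := hI.ordConnected.measurableSet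
  set g' : ℝ → Vec n := I.indicator g with hg'
  have hg'i : Integrable g' := (integrable_indicator_iff hIm).2 hg
  set G : ℝ → Vec n := fun y => ∫ s in x..y, g' s with hG
  have hGc : Continuous G := intervalIntegral.continuous_primitive (fun _ _ => hg'i.intervalIntegrable) _
  have hGg : ∀ z ∈ I, G z = ∫ s in x..z, g s := fun z hz => by
    refine intervalIntegral.integral_congr fun s hs => ?_
    exact indicator_of_mem (hI.ordConnected.uIcc_subset hx hz hs) _
  obtain ⟨c, hc⟩ := ae_eq_const_of_integral_deriv_smul_eq_zero (U := interior I) isOpen_interior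
    hI.interior.ordConnected (w := fun z => w z - G z)
    (((hw.mono interior_subset).sub hGc.continuousOn).locallyIntegrableOn
      isOpen_interior.measurableSet) (by
    intro φ h1 h2 h3
    have hd : tsupport (deriv φ) ⊆ interior I := (tsupport_deriv_subset).trans h3
    have hz : ∀ z, z ∉ I → φ z = 0 := fun z hz =>
      image_eq_zero_of_notMem_tsupport fun h' => hz (interior_subset (h3 h'))
    have hz' : ∀ z, z ∉ I → deriv φ z = 0 := fun z hz =>
      image_eq_zero_of_notMem_tsupport fun h' => hz (interior_subset (hd h'))
    have e1 : ∫ z, deriv φ z • w z = -∫ z, φ z • g' z := by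
      have := h φ h1 h2 h3
      rw [setIntegral_eq_integral_of_forall_compl_eq_zero (fun z hz => by rw [hz' z hz, zero_smul]),
        ← integral_indicator hIm] at this
      rw [this]
      congr 2
      ext1 z
      by_cases hzI : z ∈ I <;> simp [hg', hzI, hz z]
    have e2 : ∫ z, deriv φ z • G z = -∫ z, φ z • g' z :=
      integral_deriv_smul_primitive hg'i.locallyIntegrable (fun a b => by
        simp only [hG]
        rw [intervalIntegral.integral_interval_sub_left] <;> exact hg'i.intervalIntegrable)
        (h1.of_le (by norm_cast)) h2
    have hdc : Continuous (deriv φ) := (h1.of_le (m := 1) (by norm_cast)).continuous_deriv le_rfl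
    have i1 : Integrable fun z => deriv φ z • w z := by
      have : IntegrableOn (fun z => deriv φ z • w z) (tsupport (deriv φ)) :=
        (hdc.continuousOn.smul (hw.mono (hd.trans interior_subset))).integrableOn_compact h2.deriv
      refine (integrableOn_iff_integrable_of_support_subset ?_).1 this
      exact (Function.support_smul_subset_left (deriv φ) w).trans (subset_tsupport _)
    have i2 : Integrable fun z => deriv φ z • G z :=
      (hdc.smul hGc).integrable_of_hasCompactSupport h2.deriv.smul_right
    simp only [smul_sub]
    rw [integral_sub i1 i2, e1, e2, sub_self])
  have hc' : ∀ z ∈ interior I, w z - G z = c := by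
    have := Measure.eqOn_open_of_ae_eq (μ := volume) (f := fun z => w z - G z) (g := fun _ => c)
      ((ae_restrict_iff' isOpen_interior.measurableSet).2 hc) isOpen_interior
      ((hw.mono interior_subset).sub hGc.continuousOn) continuousOn_const
    exact this
  have hc'' : ∀ z ∈ I, w z - G z = c := by
    have hcl : I ⊆ closure (interior I) := by
      rw [hI.closure_interior_eq_closure_of_nonempty_interior hne]; exact subset_closure
    have := EqOn.of_subset_closure (f := fun z => w z - G z) (g := fun _ => c) hc'
      (hw.sub hGc.continuousOn) continuousOn_const interior_subset hcl
    exact this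
  have h1 := hc'' x hx
  have h2 := hc'' y hy
  rw [← hGg y hy, ← sub_eq_zero]
  have : G x = 0 := by simp [hG]
  rw [this, sub_zero] at h1
  rw [h1, ← h2]; abel

section Shear

/-- The shear `(t, x) ↦ (t, x + σ t)`. -/
def shear (σ : ℝ) (z : ℝ × ℝ) : ℝ × ℝ := (z.1, z.2 + σ * z.1)

theorem measurePreserving_shear (σ : ℝ) : MeasurePreserving (shear σ) := by
  refine MeasurePreserving.skew_product (g := fun t x => x + σ * t) (MeasurePreserving.id volume)
    (by fun_prop) (Eventually.of_forall fun t => ?_)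
  exact (measurePreserving_add_right volume (σ * t)).map_eq

theorem measurable_shear (σ : ℝ) : Measurable (shear σ) := (measurePreserving_shear σ).measurable

theorem lintegral_comp_add_two_mul {h : ℝ → ℝ≥0∞} (hh : Measurable h) (a : ℝ) :
    ∫⁻ t, h (a + 2 * t) = 2⁻¹ * ∫⁻ x, h x := by
  have h1 : ∫⁻ t, h (a + 2 * t) = ∫⁻ y, h (a + y) ∂(Measure.map (2 * ·) (volume : Measure ℝ)) :=
    (lintegral_map (f := fun y => h (a + y)) (by fun_prop) (by fun_prop)).symm
  rw [h1, Real.map_volume_mul_left two_ne_zero, lintegral_smul_measure, lintegral_add_left_eq_self,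
    smul_eq_mul, abs_of_pos (by norm_num), ENNReal.ofReal_inv_of_pos two_pos, ENNReal.ofReal_ofNat]

/-- Functions of different characteristic variables can be multiplied. -/
theorem lintegral_mul_characteristics {g h : ℝ → ℝ≥0∞} (hg : Measurable g) (hh : Measurable h) :
    ∫⁻ z : ℝ × ℝ, g (z.2 - z.1) * h (z.2 + z.1) = 2⁻¹ * ((∫⁻ x, g x) * ∫⁻ x, h x) := by
  -- The shear `x ↦ x - t` makes the argument of `g` a coordinate; the remaining variable enters as
  -- `x + 2 t`, which produces the factor `½`.
  have h1 : ∫⁻ z : ℝ × ℝ, g (z.2 - z.1) * h (z.2 + z.1)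
      = ∫⁻ z : ℝ × ℝ, g z.2 * h (z.2 + 2 * z.1) := by
    rw [← (measurePreserving_shear (-1)).lintegral_comp
      (f := fun z : ℝ × ℝ => g z.2 * h (z.2 + 2 * z.1)) (by fun_prop)]
    refine lintegral_congr fun z => ?_
    simp only [shear]
    ring_nf
  rw [h1, Measure.volume_eq_prod, lintegral_prod_symm _ (by fun_prop)]
  have h2 : ∀ y, ∫⁻ x, g y * h (y + 2 * x) = g y * (2⁻¹ * ∫⁻ x, h x) := fun y => by
    rw [lintegral_const_mul _ (by fun_prop), lintegral_comp_add_two_mul hh]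
  simp only [h2]
  rw [lintegral_mul_const _ hg]
  ring

/-- Translations act continuously on `L¹(ℝ)`; the proof unwinds this for a representative. -/
theorem tendsto_lintegral_translate {f : ℝ → Vec n} (hf : Integrable f) :
    Tendsto (fun h => ∫⁻ x, ‖f (x + h) - f x‖ₑ) (𝓝 0) (𝓝 0) := by
  have : Fact ((1 : ℝ≥0∞) ≤ 1) := ⟨le_rfl⟩
  have : Fact ((1 : ℝ≥0∞) ≠ ⊤) := ⟨ENNReal.one_ne_top⟩
  have hm : MemLp f 1 := memLp_one_iff_integrable.2 hf
  set F : Lp (Vec n) 1 (volume : Measure ℝ) := hm.toLp f with hF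
  have hcont : Continuous fun h : ℝ => (DomAddAct.mk h) +ᵥ F :=
    (DomAddAct.continuous_mk).vadd continuous_const
  have hlim : Tendsto (fun h : ℝ => edist ((DomAddAct.mk h) +ᵥ F) F) (𝓝 0) (𝓝 0) := by
    have : Tendsto (fun h : ℝ => edist ((DomAddAct.mk h) +ᵥ F) F) (𝓝 0)
      (𝓝 (edist ((DomAddAct.mk (0:ℝ)) +ᵥ F) F)) :=
      ((hcont.tendsto 0).edist tendsto_const_nhds)
    simpa using this
  refine hlim.congr fun h => ?_
  rw [Lp.edist_def, eLpNorm_one_eq_lintegral_enorm]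
  refine lintegral_congr_ae ?_
  have h1 : ∀ᵐ x, F x = f x := hm.coeFn_toLp
  have h2 : ∀ᵐ x, F (x + h) = f (x + h) :=
    (measurePreserving_add_right volume h).quasiMeasurePreserving.ae h1
  filter_upwards [h1, h2, DomAddAct.vadd_Lp_ae_eq (DomAddAct.mk h) F] with x hx1 hx2 hx3
  simp only [Pi.sub_apply, hx3, hx1]
  simp [add_comm h x, hx2]

end Shear

end

/-! ### Geometry of trapezoids. -/

section

namespace IsTrapezoid

variable {K : Set (ℝ × ℝ)}

/-- The triangle below `(t, x)` in coordinates: `(τ, y)` has barycentric weights `τ / t` and `((t -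
τ) ∓ (y - x)) / (2 t)`. Every later use of the triangle property goes through this form. -/
theorem mem_of_abs_sub_le (hK : IsTrapezoid K) {t x τ y : ℝ} (h : (t, x) ∈ K) (hτ : 0 ≤ τ) (hy : |y - x| ≤ t - τ) :
    (τ, y) ∈ K := by
  have hsub := hK.triangle_subset _ h
  have ht : 0 ≤ t := hK.time_nonneg _ h
  have hc := convex_convexHull ℝ ({((t, x) : ℝ × ℝ), ((0 : ℝ), x - t), ((0 : ℝ), x + t)} : Set (ℝ × ℝ))
  obtain ⟨hy1, hy2⟩ := abs_le.1 hy
  rcases ht.eq_or_lt with rfl | ht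
  · have h1 : τ = 0 := by linarith
    have h2 : y = x := by linarith
    rw [h1, h2]; exact h
  · apply hsub
    have h1 : ((t, x) : ℝ × ℝ) ∈ convexHull ℝ
      ({((t, x) : ℝ × ℝ), ((0 : ℝ), x - t), ((0 : ℝ), x + t)} : Set (ℝ × ℝ)) :=
      subset_convexHull _ _ (by simp)
    have h2 : (((0 : ℝ), x - t) : ℝ × ℝ) ∈ convexHull ℝ
      ({((t, x) : ℝ × ℝ), ((0 : ℝ), x - t), ((0 : ℝ), x + t)} : Set (ℝ × ℝ)) :=
      subset_convexHull _ _ (by simp)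
    have h3 : (((0 : ℝ), x + t) : ℝ × ℝ) ∈ convexHull ℝ
      ({((t, x) : ℝ × ℝ), ((0 : ℝ), x - t), ((0 : ℝ), x + t)} : Set (ℝ × ℝ)) :=
      subset_convexHull _ _ (by simp)
    have := hc.sum_mem (t := Finset.univ) (w := ![τ / t, ((t - τ) - (y - x)) / (2 * t),
      ((t - τ) + (y - x)) / (2 * t)]) (z := ![(t, x), (0, x - t), (0, x + t)]) ?_ ?_ ?_
    · simp only [Fin.sum_univ_three, Matrix.cons_val_zero, Matrix.cons_val_one,
        Matrix.cons_val, Prod.smul_mk, Prod.mk_add_mk, smul_eq_mul, mul_zero, add_zero] at this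
      convert this using 2
      · field_simp
      · field_simp; ring
    · intro i _
      fin_cases i
      · exact div_nonneg hτ ht.le
      · exact div_nonneg (by linarith) (by linarith)
      · exact div_nonneg (by linarith) (by linarith)
    · simp only [Fin.sum_univ_three, Matrix.cons_val_zero, Matrix.cons_val_one,
        Matrix.cons_val]
      field_simp; ring
    · intro i _
      fin_cases i
      · exact h1
      · exact h2
      · exact h3

theorem measurableSet (hK : IsTrapezoid K) : MeasurableSet K := hK.isClosed.measurableSet

theorem slice_subset_base (hK : IsTrapezoid K) (t : ℝ) : slice K t ⊆ base K := fun x hx =>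
  hK.mem_of_abs_sub_le hx le_rfl (by simpa using hK.time_nonneg _ hx)

theorem convex_slice (hK : IsTrapezoid K) (t : ℝ) : Convex ℝ (slice K t) :=
  hK.convex.affine_preimage (AffineMap.const ℝ ℝ t |>.prod (AffineMap.id ℝ ℝ))

theorem convex_timeSet (hK : IsTrapezoid K) : Convex ℝ (timeSet K) := by
  have : timeSet K = (LinearMap.fst ℝ ℝ ℝ) '' K := by
    ext t; simp [timeSet, slice, Set.Nonempty]
  rw [this]; exact hK.convex.linear_image _

theorem measurableSet_slice (hK : IsTrapezoid K) (t : ℝ) : MeasurableSet (slice K t) :=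
  measurable_prodMk_left hK.measurableSet

theorem nonneg_of_mem_timeSet (hK : IsTrapezoid K) {t : ℝ} (h : t ∈ timeSet K) : 0 ≤ t :=
  let ⟨_, hx⟩ := h
  hK.time_nonneg _ hx

/-- Positive measure prevents `K` from lying in the null line `t = 0`. This gives both the base and
the time interval nonempty interior. -/
theorem exists_pos_mem (hK : IsTrapezoid K) : ∃ t x : ℝ, 0 < t ∧ (t, x) ∈ K := by
  by_contra! h
  have hsub : K ⊆ {(0 : ℝ)} ×ˢ univ := fun z hz => by
    have h1 := hK.time_nonneg z hz
    rcases h1.eq_or_lt with h2 | h2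
    · simp [h2.symm, mem_prod]
    · exact absurd hz (h z.1 z.2 h2)
  have h0 : volume K ≤ 0 := (measure_mono hsub).trans (by
    rw [Measure.volume_eq_prod, Measure.prod_prod]; simp)
  exact absurd hK.volume_pos (not_lt.2 h0)

theorem nonempty_interior_base (hK : IsTrapezoid K) : (interior (base K)).Nonempty := by
  obtain ⟨t, x, ht, h⟩ := hK.exists_pos_mem
  refine ⟨x, mem_interior.2 ⟨Ioo (x - t) (x + t), fun y hy => ?_, isOpen_Ioo, by simp [ht]⟩⟩
  exact hK.mem_of_abs_sub_le h le_rfl (by rw [abs_le]; constructor <;> linarith [hy.1, hy.2])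

theorem nonempty_interior_timeSet (hK : IsTrapezoid K) : (interior (timeSet K)).Nonempty := by
  obtain ⟨t, x, ht, h⟩ := hK.exists_pos_mem
  refine ⟨t / 2, mem_interior.2 ⟨Ioo 0 t, fun s hs => ?_, isOpen_Ioo, by constructor <;> linarith⟩⟩
  exact ⟨x, hK.mem_of_abs_sub_le h hs.1.le (by simpa using hs.2.le)⟩

/-- Along characteristics the indicator function of `K` is continuous in time, except for the
characteristics through the end points of a slice. -/
theorem eventually_mem_iff_of_notMem_frontier (hK : IsTrapezoid K) {σ t y : ℝ} (hσ : |σ| = 1)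
    (hy : y - σ * t ∉ frontier (slice K t)) :
    ∀ᶠ s in 𝓝[timeSet K] t, ((s, y - σ * s) ∈ K ↔ (t, y - σ * t) ∈ K) := by
  by_cases hmem : (t, y - σ * t) ∈ K
  swap
  · have hc : Continuous fun s : ℝ => (s, y - σ * s) := by fun_prop
    have := (hc.tendsto t).eventually (hK.isClosed.isOpen_compl.mem_nhds hmem)
    filter_upwards [mem_nhdsWithin_of_mem_nhds this] with s hs
    exact iff_of_false hs hmem
  have hint : y - σ * t ∈ interior (slice K t) := by
    by_contra h
    exact hy ⟨subset_closure hmem, h⟩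
  have hle : ∀ s ∈ timeSet K, s ≤ t → (s, y - σ * s) ∈ K := fun s hs hst =>
    hK.mem_of_abs_sub_le hmem (hK.nonneg_of_mem_timeSet hs) (by
      rw [show y - σ * s - (y - σ * t) = σ * (t - s) by ring, abs_mul, hσ, one_mul,
        abs_of_nonneg (by linarith)])
  by_cases hmax : ∃ T ∈ timeSet K, t < T
  · obtain ⟨T, ⟨z, hz⟩, hT⟩ := hmax
    -- For later times, write `(s, y - σ s)` as a convex combination of a point `(T, z)` of a later
    -- slice and a point at height `t`. As `s → t`, the latter tends to `y - σ t`, which is interior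
    -- to the slice, and so stays in `K`.
    set lam : ℝ → ℝ := fun s => (s - t) / (T - t) with hlam
    have hlc : Continuous lam := by fun_prop
    have hlt : lam t = 0 := by simp [hlam]
    have hl1 : ∀ᶠ s in 𝓝 t, lam s < 1 := (hlc.tendsto t).eventually (by
      rw [hlt]; exact Iio_mem_nhds one_pos)
    have hw : ContinuousAt (fun s => (y - σ * s - lam s * z) / (1 - lam s)) t := by
      refine ContinuousAt.div (by fun_prop) (by fun_prop) (by simp [hlt])
    have hw' : ∀ᶠ s in 𝓝 t, (y - σ * s - lam s * z) / (1 - lam s) ∈ interior (slice K t) :=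
      hw.tendsto.eventually (isOpen_interior.mem_nhds (by simpa [hlt] using hint))
    filter_upwards [mem_nhdsWithin_of_mem_nhds hl1, mem_nhdsWithin_of_mem_nhds hw',
      self_mem_nhdsWithin] with s h1 h2 h3
    refine iff_of_true ?_ hmem
    rcases le_total s t with hst | hst
    · exact hle s h3 hst
    have h4 : 0 ≤ lam s := div_nonneg (by linarith) (by linarith)
    have h5 := hK.convex (show (t, (y - σ * s - lam s * z) / (1 - lam s)) ∈ K from
      (interior_subset h2 : _ ∈ slice K t)) hz (show 0 ≤ 1 - lam s by linarith) h4 (by ring)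
    convert h5 using 1
    have h6 : 1 - lam s ≠ 0 := by linarith
    have h7 : T - t ≠ 0 := by linarith
    ext
    · simp only [Prod.fst_add, Prod.smul_fst, smul_eq_mul, hlam]
      field_simp; ring
    · simp only [Prod.snd_add, Prod.smul_snd, smul_eq_mul]
      field_simp; ring
  · push Not at hmax
    filter_upwards [self_mem_nhdsWithin] with s hs
    exact iff_of_true (hle s hs (hmax s hs)) hmem

/-- The exceptional characteristics meet the slice in its frontier, which is null since the slice is
convex. -/
theorem ae_eventually_mem_iff (hK : IsTrapezoid K) {σ t : ℝ} (hσ : |σ| = 1) :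
    ∀ᵐ y, ∀ᶠ s in 𝓝[timeSet K] t, ((s, y - σ * s) ∈ K ↔ (t, y - σ * t) ∈ K) := by
  have h1 : ∀ᵐ x : ℝ, x ∉ frontier (slice K t) :=
    measure_eq_zero_iff_ae_notMem.1 ((hK.convex_slice t).addHaar_frontier volume)
  have h2 : ∀ᵐ y : ℝ, y - σ * t ∉ frontier (slice K t) :=
    (measurePreserving_sub_right volume (σ * t)).quasiMeasurePreserving.ae h1
  filter_upwards [h2] with y hy using hK.eventually_mem_iff_of_notMem_frontier hσ hy

theorem ae_mem_interior_of_mem (hK : IsTrapezoid K) : ∀ᵐ z : ℝ × ℝ, z ∈ K → z ∈ interior K := by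
  have h1 : ∀ᵐ z : ℝ × ℝ, z ∉ frontier K :=
    measure_eq_zero_iff_ae_notMem.1 (hK.convex.addHaar_frontier volume)
  filter_upwards [h1] with z hz hzK
  by_contra h
  exact hz ⟨subset_closure hzK, h⟩

end IsTrapezoid

end

/-! ### Derivatives along characteristics and their bounds. -/

section

section Measurability

variable {E : Type*} [NormedAddCommGroup E] [NormedSpace ℝ E]
  {α : Type*} [MeasurableSpace α]

theorem stronglyMeasurable_intervalIntegral {f : α → ℝ → E}
    (hf : StronglyMeasurable (Function.uncurry f)) {p q : α → ℝ} (hp : Measurable p)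
    (hq : Measurable q) : StronglyMeasurable fun a => ∫ y in (p a)..(q a), f a y := by
  have aux : ∀ {p q : α → ℝ}, Measurable p → Measurable q →
      StronglyMeasurable fun a => ∫ y in Ioc (p a) (q a), f a y := by
    intro p q hp hq
    have hS : MeasurableSet ({z : α × ℝ | p z.1 < z.2} ∩ {z : α × ℝ | z.2 ≤ q z.1}) :=
      (measurableSet_lt (hp.comp measurable_fst) measurable_snd).inter
        (measurableSet_le measurable_snd (hq.comp measurable_fst))
    convert (hf.indicator hS).integral_prod_right' (ν := volume) using 2 with a
    rw [← integral_indicator measurableSet_Ioc]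
    rfl
  simp only [intervalIntegral]
  exact (aux hp hq).sub (aux hq hp)

theorem integrable_intervalIntegral {μ : Measure α} [SFinite μ] {f : α × ℝ → E}
    (hf : StronglyMeasurable f)
    (hfi : Integrable f (μ.prod volume)) {p q : α → ℝ} (hp : Measurable p) (hq : Measurable q) :
    Integrable (fun a => ∫ y in (p a)..(q a), f (a, y)) μ := by
  refine Integrable.mono' hfi.norm.integral_prod_left
    (stronglyMeasurable_intervalIntegral (f := fun a y => f (a, y)) hf hp hq).aestronglyMeasurable ?_
  filter_upwards [hfi.prod_right_ae] with a ha
  exact (intervalIntegral.norm_integral_le_integral_norm_uIoc).trans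
    (setIntegral_le_integral ha.norm (Eventually.of_forall fun _ => norm_nonneg _))

end Measurability

/-- The set of points at which the characteristic with parameter `y` satisfies an almost sure
property has full measure. -/
theorem ae_prod_of_ae_characteristic (σ : ℝ) {p : ℝ → Prop} (h : ∀ᵐ y, p y) :
    ∀ᵐ z : ℝ × ℝ, p (z.2 + σ * z.1) := by
  have h1 : ∀ᵐ z : ℝ × ℝ, p z.2 := Measure.quasiMeasurePreserving_snd.ae h
  exact (measurePreserving_shear σ).quasiMeasurePreserving.ae h1

theorem ae_slice_of_ae_characteristic (σ t : ℝ) {p : ℝ → Prop} (h : ∀ᵐ y, p y) :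
    ∀ᵐ x : ℝ, p (x + σ * t) :=
  (measurePreserving_add_right volume (σ * t)).quasiMeasurePreserving.ae h

variable {n : ℕ}

/-- The derivative of a solution of the inhomogeneous wave equation with right-hand side `F` in a
characteristic direction: `χ` is transported with velocity `-σ`. -/
def charDeriv (σ : ℝ) (χ : ℝ → Vec n) (F : ℝ × ℝ → Vec n) (z : ℝ × ℝ) : Vec n :=
  χ (z.2 + σ * z.1) + (σ / 2) • ∫ τ in (0 : ℝ)..z.1, F (τ, z.2 + σ * z.1 - σ * τ)

/-- A bound for `charDeriv σ χ F` that depends on the characteristic variable only. -/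
def charBound (σ : ℝ) (χ : ℝ → Vec n) (F : ℝ × ℝ → Vec n) (y : ℝ) : ℝ≥0∞ :=
  ‖χ y‖ₑ + 2⁻¹ * ∫⁻ τ, ‖F (τ, y - σ * τ)‖ₑ

variable {σ : ℝ} {χ χ' : ℝ → Vec n} {F F' : ℝ × ℝ → Vec n}

theorem enorm_half_of_abs_eq_one (hσ : |σ| = 1) : ‖σ / 2‖ₑ = 2⁻¹ := by
  rw [Real.enorm_eq_ofReal_abs, abs_div, hσ, abs_two, one_div,
    ENNReal.ofReal_inv_of_pos two_pos, ENNReal.ofReal_ofNat]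

theorem measurable_charBound (hχ : StronglyMeasurable χ) (hF : StronglyMeasurable F) :
    Measurable (charBound σ χ F) := by
  have h1 : Measurable fun p : ℝ × ℝ => ‖F (p.2, p.1 - σ * p.2)‖ₑ :=
    (hF.comp_measurable (by fun_prop : Measurable fun p : ℝ × ℝ => (p.2, p.1 - σ * p.2))).enorm
  exact hχ.enorm.add (h1.lintegral_prod_right'.const_mul _)

/-- The coordinates `(τ, y)` with `y = x + σ τ` are a measure-preserving shear of the plane, so
integrating over all characteristics recovers the full integral of `‖F‖`. -/
theorem lintegral_charBound (hχ : StronglyMeasurable χ) (hF : StronglyMeasurable F) :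
    ∫⁻ y, charBound σ χ F y = (∫⁻ y, ‖χ y‖ₑ) + 2⁻¹ * ∫⁻ z, ‖F z‖ₑ := by
  have h1 : Measurable fun p : ℝ × ℝ => ‖F (p.2, p.1 - σ * p.2)‖ₑ :=
    (hF.comp_measurable (by fun_prop : Measurable fun p : ℝ × ℝ => (p.2, p.1 - σ * p.2))).enorm
  simp only [charBound]
  rw [lintegral_add_left hχ.enorm, lintegral_const_mul _ h1.lintegral_prod_right']
  congr 2
  rw [← (measurePreserving_shear (-σ)).lintegral_comp hF.enorm, Measure.volume_eq_prod,
    lintegral_prod_symm (fun z => ‖F (shear (-σ) z)‖ₑ)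
      (hF.comp_measurable (measurable_shear _)).enorm.aemeasurable]
  simp [shear, sub_eq_add_neg]

theorem lintegral_charBound_ne_top (hχ : StronglyMeasurable χ) (hF : StronglyMeasurable F)
    (hχi : Integrable χ) (hFi : Integrable F) : ∫⁻ y, charBound σ χ F y ≠ ⊤ := by
  rw [lintegral_charBound hχ hF]
  exact ENNReal.add_ne_top.2 ⟨hχi.2.ne, ENNReal.mul_ne_top (by simp) hFi.2.ne⟩

theorem enorm_charDeriv_le (hσ : |σ| = 1) (χ : ℝ → Vec n) (F : ℝ × ℝ → Vec n) (z : ℝ × ℝ) :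
    ‖charDeriv σ χ F z‖ₑ ≤ charBound σ χ F (z.2 + σ * z.1) := by
  refine (enorm_add_le _ _).trans (add_le_add le_rfl ?_)
  rw [enorm_smul, enorm_half_of_abs_eq_one hσ]
  gcongr
  rw [intervalIntegral.intervalIntegral_eq_integral_uIoc, enorm_smul]
  refine (mul_le_of_le_one_left zero_le ?_).trans
    ((enorm_integral_le_lintegral_enorm _).trans (setLIntegral_le_lintegral _ _))
  split_ifs <;> simp

theorem stronglyMeasurable_charDeriv (hχ : StronglyMeasurable χ) (hF : StronglyMeasurable F) :
    StronglyMeasurable (charDeriv σ χ F) := by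
  refine (hχ.comp_measurable (by fun_prop)).add (StronglyMeasurable.fun_const_smul ?_ _)
  exact stronglyMeasurable_intervalIntegral (f := fun (z : ℝ × ℝ) τ => F (τ, z.2 + σ * z.1 - σ * τ))
    (hF.comp_measurable (by fun_prop : Measurable fun p : (ℝ × ℝ) × ℝ =>
      (p.2, p.1.2 + σ * p.1.1 - σ * p.2))) measurable_const measurable_fst

theorem ae_integrable_characteristic (hFi : Integrable F) :
    ∀ᵐ y, Integrable fun τ => F (τ, y - σ * τ) := by
  have h1 : Integrable (F ∘ shear (-σ)) :=
    (measurePreserving_shear (-σ)).integrable_comp_of_integrable hFi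
  filter_upwards [h1.prod_left_ae] with y hy
  simpa [shear, sub_eq_add_neg] using hy

/-- `charDeriv` is additive in `(χ, F)` only on characteristics along which both sources are
integrable. The exceptional set consists of whole characteristics and does not depend on time, so
the bound passes to almost all points of every slice and of the plane. -/
theorem ae_enorm_charDeriv_sub_le (hσ : |σ| = 1) (hFi : Integrable F) (hFi' : Integrable F') :
    ∀ᵐ y, ∀ z : ℝ × ℝ, z.2 + σ * z.1 = y →
      ‖charDeriv σ χ F z - charDeriv σ χ' F' z‖ₑ ≤ charBound σ (χ - χ') (F - F') y := by
  filter_upwards [ae_integrable_characteristic (σ := σ) hFi,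
    ae_integrable_characteristic (σ := σ) hFi'] with y h1 h2 z hz
  have : charDeriv σ χ F z - charDeriv σ χ' F' z = charDeriv σ (χ - χ') (F - F') z := by
    simp only [charDeriv, hz, Pi.sub_apply]
    rw [intervalIntegral.integral_sub h1.intervalIntegrable h2.intervalIntegrable, smul_sub]
    abel
  rw [this, ← hz]
  exact enorm_charDeriv_le hσ _ _ z

theorem lintegral_slice_charBound (hχ : StronglyMeasurable χ) (hF : StronglyMeasurable F) (t : ℝ) :
    ∫⁻ x, charBound σ χ F (x + σ * t) = (∫⁻ y, ‖χ y‖ₑ) + 2⁻¹ * ∫⁻ z, ‖F z‖ₑ := by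
  rw [lintegral_add_right_eq_self (charBound σ χ F), lintegral_charBound hχ hF]

theorem integrable_charDeriv_slice (hσ : |σ| = 1) (hχ : StronglyMeasurable χ)
    (hF : StronglyMeasurable F) (hχi : Integrable χ) (hFi : Integrable F) (t : ℝ) :
    Integrable fun x => charDeriv σ χ F (t, x) := by
  refine ⟨((stronglyMeasurable_charDeriv hχ hF).comp_measurable
    measurable_prodMk_left).aestronglyMeasurable, ?_⟩
  refine (lintegral_mono fun x => enorm_charDeriv_le hσ χ F (t, x)).trans_lt ?_
  rw [lintegral_slice_charBound hχ hF, ← lintegral_charBound (σ := σ) hχ hF]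
  exact (lintegral_charBound_ne_top hχ hF hχi hFi).lt_top

theorem lintegral_comp_add_mul_of_abs_eq_one (hσ : |σ| = 1) {h : ℝ → ℝ≥0∞} (hh : Measurable h)
    (x : ℝ) : ∫⁻ t, h (x + σ * t) = ∫⁻ y, h y := by
  have h1 : ∫⁻ t, h (x + σ * t) = ∫⁻ y, h (x + y) ∂(Measure.map (σ * ·) (volume : Measure ℝ)) :=
    (lintegral_map (f := fun y => h (x + y)) (by fun_prop) (by fun_prop)).symm
  rw [h1, Real.map_volume_mul_left (by rintro rfl; simp at hσ), lintegral_smul_measure,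
    lintegral_add_left_eq_self, abs_inv, hσ]
  simp

theorem integrable_charDeriv_line (hσ : |σ| = 1) (hχ : StronglyMeasurable χ)
    (hF : StronglyMeasurable F) (hχi : Integrable χ) (hFi : Integrable F) (x : ℝ) :
    Integrable fun t => charDeriv σ χ F (t, x) := by
  refine ⟨((stronglyMeasurable_charDeriv hχ hF).comp_measurable
    (measurable_id.prodMk measurable_const)).aestronglyMeasurable, ?_⟩
  refine (lintegral_mono fun t => enorm_charDeriv_le hσ χ F (t, x)).trans_lt ?_
  rw [lintegral_comp_add_mul_of_abs_eq_one hσ (measurable_charBound hχ hF)]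
  exact (lintegral_charBound_ne_top hχ hF hχi hFi).lt_top

/-- The `L¹` norms of the slices are bounded uniformly in time, so the function is integrable over
strips of finite duration. -/
theorem locallyIntegrable_charDeriv (hσ : |σ| = 1) (hχ : StronglyMeasurable χ)
    (hF : StronglyMeasurable F) (hχi : Integrable χ) (hFi : Integrable F) :
    LocallyIntegrable (charDeriv σ χ F) := by
  intro z
  refine ⟨Ioo (z.1 - 1) (z.1 + 1) ×ˢ univ, (isOpen_Ioo.prod isOpen_univ).mem_nhds (by simp), ?_⟩
  refine ⟨(stronglyMeasurable_charDeriv hχ hF).aestronglyMeasurable, ?_⟩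
  refine (lintegral_mono fun z => enorm_charDeriv_le hσ χ F z).trans_lt ?_
  rw [Measure.volume_eq_prod, ← Measure.prod_restrict, Measure.restrict_univ,
    lintegral_prod (fun z : ℝ × ℝ => charBound σ χ F (z.2 + σ * z.1))
      ((measurable_charBound hχ hF).comp (by fun_prop)).aemeasurable]
  simp only [lintegral_slice_charBound hχ hF]
  rw [← lintegral_charBound (σ := σ) hχ hF, lintegral_const]
  exact ENNReal.mul_lt_top (lintegral_charBound_ne_top hχ hF hχi hFi).lt_top (by simp)

end

/-! ### D'Alembert's formula and its increments in space and time. -/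

section

variable {n : ℕ} {σ : ℝ} {χ φ ψ : ℝ → Vec n} {F : ℝ × ℝ → Vec n}

theorem measurePreserving_characteristic (σ c : ℝ) :
    MeasurePreserving fun p : ℝ × ℝ => (p.2, p.1 + c - σ * p.2) := by
  convert (measurePreserving_shear (-σ)).comp (((MeasurePreserving.id volume).prod
    (measurePreserving_add_right volume c)).comp Measure.measurePreserving_swap) using 2 with p
  · simp [shear, sub_eq_add_neg]
  · rfl

theorem measurePreserving_mul_left_of_abs_eq_one (hσ : |σ| = 1) :
    MeasurePreserving fun t : ℝ => σ * t := by
  refine ⟨by fun_prop, ?_⟩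
  rw [Real.map_volume_mul_left (by rintro rfl; simp at hσ), abs_inv, hσ]
  simp

theorem measurePreserving_line (hσ : |σ| = 1) (x : ℝ) :
    MeasurePreserving fun p : ℝ × ℝ => (p.2, x + σ * p.1 - σ * p.2) := by
  convert (measurePreserving_characteristic σ x).comp
    ((measurePreserving_mul_left_of_abs_eq_one hσ).prod (MeasurePreserving.id volume)) using 2 with p
  · simp [add_comm]
  · rfl

theorem integral_charDeriv_slice (hχi : Integrable χ) (hF : StronglyMeasurable F)
    (hFi : Integrable F) (t x₁ x₂ : ℝ) :
    ∫ x in x₁..x₂, charDeriv σ χ F (t, x) = (∫ y in (x₁ + σ * t)..(x₂ + σ * t), χ y)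
      + (σ / 2) • ∫ τ in (0 : ℝ)..t, ∫ y in (x₁ + σ * (t - τ))..(x₂ + σ * (t - τ)), F (τ, y) := by
  have hm := measurePreserving_characteristic σ (σ * t)
  have hi : Integrable fun p : ℝ × ℝ => F (p.2, p.1 + σ * t - σ * p.2) :=
    hm.integrable_comp_of_integrable hFi
  have hi' : Integrable fun x => (σ / 2) • ∫ τ in (0 : ℝ)..t, F (τ, x + σ * t - σ * τ) :=
    (integrable_intervalIntegral (f := fun p : ℝ × ℝ => F (p.2, p.1 + σ * t - σ * p.2))
      (hF.comp_measurable hm.measurable) hi measurable_const measurable_const).smul (σ / 2)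
  simp only [charDeriv]
  rw [intervalIntegral.integral_add (hχi.comp_add_right _).intervalIntegrable hi'.intervalIntegrable,
    intervalIntegral.integral_comp_add_right, intervalIntegral.integral_smul,
    intervalIntegral_intervalIntegral_swap (F := fun x τ => F (τ, x + σ * t - σ * τ))
      (hi.integrableOn)]
  congr 3
  ext1 τ
  rw [← intervalIntegral.integral_comp_add_right]
  congr 1
  ext1 x
  ring_nf

/-- Exchanging the order on the triangle `τ ≤ t` leaves, for fixed `τ`, an integral over `t` from
`τ` to `T`; the substitution `y = x + σ (t - τ)` gives the inner integral on the right. -/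
theorem smul_integral_charDeriv_line (hσ : |σ| = 1) (hχi : Integrable χ)
    (hF : StronglyMeasurable F) (hFi : Integrable F) {T : ℝ} (hT : 0 ≤ T) (x : ℝ) :
    σ • ∫ t in (0 : ℝ)..T, charDeriv σ χ F (t, x) = (∫ y in x..(x + σ * T), χ y)
      + (σ / 2) • ∫ τ in (0 : ℝ)..T, ∫ y in x..(x + σ * (T - τ)), F (τ, y) := by
  have hm := measurePreserving_line hσ x
  have hi : Integrable fun p : ℝ × ℝ => F (p.2, x + σ * p.1 - σ * p.2) :=
    hm.integrable_comp_of_integrable hFi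
  have hχ' : Integrable fun t => χ (x + σ * t) :=
    (measurePreserving_mul_left_of_abs_eq_one hσ).integrable_comp_of_integrable
      (hχi.comp_add_left x)
  have hi' : Integrable fun t => (σ / 2) • ∫ τ in (0 : ℝ)..t, F (τ, x + σ * t - σ * τ) :=
    (integrable_intervalIntegral (f := fun p : ℝ × ℝ => F (p.2, x + σ * p.1 - σ * p.2))
      (hF.comp_measurable hm.measurable) hi measurable_const measurable_id).smul (σ / 2)
  simp only [charDeriv]
  rw [intervalIntegral.integral_add hχ'.intervalIntegrable hi'.intervalIntegrable, smul_add,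
    intervalIntegral.smul_integral_comp_add_mul, intervalIntegral.integral_smul,
    intervalIntegral_triangle_swap (f := fun t τ => F (τ, x + σ * t - σ * τ)) hT hi, smul_comm,
    ← intervalIntegral.integral_smul]
  congr 1
  · simp
  congr 2
  ext1 τ
  have := intervalIntegral.smul_integral_comp_add_mul (a := τ) (b := T) (fun y => F (τ, y)) σ
    (x - σ * τ)
  convert this using 2
  · congr 1
    ext1 t
    ring_nf
  · ring
  · ring

theorem integral_integral_add_adjacent (hF : StronglyMeasurable F) (hFi : Integrable F)
    {a b c : ℝ → ℝ} (ha : Measurable a) (hb : Measurable b) (hc : Measurable c) (s t : ℝ) :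
    ∫ τ in s..t, ∫ y in (a τ)..(c τ), F (τ, y) = (∫ τ in s..t, ∫ y in (a τ)..(b τ), F (τ, y))
      + ∫ τ in s..t, ∫ y in (b τ)..(c τ), F (τ, y) := by
  rw [← intervalIntegral.integral_add (integrable_intervalIntegral hF hFi ha hb).intervalIntegrable
    (integrable_intervalIntegral hF hFi hb hc).intervalIntegrable]
  refine intervalIntegral.integral_congr_ae ?_
  filter_upwards [hFi.prod_right_ae] with τ hτ _
  rw [intervalIntegral.integral_add_adjacent_intervals] <;> exact hτ.intervalIntegrable

/-- D'Alembert's formula: the solution of `∂_t² u - ∂_x² u = F` with `u(0, c) = κ` and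
`∂_x u = φ + ψ`, `∂_t u = ψ - φ` at time `0`. -/
def dAlembert (c : ℝ) (κ : Vec n) (φ ψ : ℝ → Vec n) (F : ℝ × ℝ → Vec n) (z : ℝ × ℝ) : Vec n :=
  κ + (∫ y in c..(z.2 - z.1), φ y) + (∫ y in c..(z.2 + z.1), ψ y)
    + (1 / 2 : ℝ) • ∫ τ in (0 : ℝ)..z.1, ∫ y in (z.2 - z.1 + τ)..(z.2 + z.1 - τ), F (τ, y)

variable {c : ℝ} {κ : Vec n}

/-- The backward triangles of `(t, x₁)` and `(t, x₂)` differ by two strips between parallel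
characteristics. Splitting the inner interval at `x₁ - t + τ` and `x₁ + t - τ` isolates these
strips, which are the source terms of the two characteristic derivatives. -/
theorem dAlembert_sub_slice (hφi : Integrable φ) (hψi : Integrable ψ) (hF : StronglyMeasurable F)
    (hFi : Integrable F) (t x₁ x₂ : ℝ) :
    dAlembert c κ φ ψ F (t, x₂) - dAlembert c κ φ ψ F (t, x₁)
      = (∫ x in x₁..x₂, charDeriv (-1) φ F (t, x)) + ∫ x in x₁..x₂, charDeriv 1 ψ F (t, x) := by
  rw [integral_charDeriv_slice hφi hF hFi, integral_charDeriv_slice hψi hF hFi]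
  simp only [dAlembert]
  rw [integral_integral_add_adjacent hF hFi (a := fun τ => x₂ - t + τ) (b := fun τ => x₁ - t + τ)
      (c := fun τ => x₂ + t - τ) (by fun_prop) (by fun_prop) (by fun_prop),
    integral_integral_add_adjacent hF hFi (a := fun τ => x₁ - t + τ) (b := fun τ => x₁ + t - τ)
      (c := fun τ => x₂ + t - τ) (by fun_prop) (by fun_prop) (by fun_prop),
    ← intervalIntegral.integral_add_adjacent_intervals (a := c) (b := x₁ - t) (c := x₂ - t)
      hφi.intervalIntegrable hφi.intervalIntegrable,
    ← intervalIntegral.integral_add_adjacent_intervals (a := c) (b := x₁ + t) (c := x₂ + t)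
      hψi.intervalIntegrable hψi.intervalIntegrable]
  have e1 : ∫ τ in (0 : ℝ)..t, ∫ y in (x₁ + -1 * (t - τ))..(x₂ + -1 * (t - τ)), F (τ, y)
      = - ∫ τ in (0 : ℝ)..t, ∫ y in (x₂ - t + τ)..(x₁ - t + τ), F (τ, y) := by
    rw [← intervalIntegral.integral_neg]
    congr 1
    ext1 τ
    rw [intervalIntegral.integral_symm]
    ring_nf
  have e2 : ∫ τ in (0 : ℝ)..t, ∫ y in (x₁ + 1 * (t - τ))..(x₂ + 1 * (t - τ)), F (τ, y)
      = ∫ τ in (0 : ℝ)..t, ∫ y in (x₁ + t - τ)..(x₂ + t - τ), F (τ, y) := by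
    congr 1
    ext1 τ
    ring_nf
  rw [e1, e2, show x₁ + -1 * t = x₁ - t by ring, show x₂ + -1 * t = x₂ - t by ring, one_mul]
  module

theorem dAlembert_sub_line_zero (hφi : Integrable φ) (hψi : Integrable ψ)
    (hF : StronglyMeasurable F) (hFi : Integrable F) (hF0 : ∀ z : ℝ × ℝ, z.1 < 0 → F z = 0)
    (t x : ℝ) :
    dAlembert c κ φ ψ F (t, x) - dAlembert c κ φ ψ F (0, x)
      = (∫ s in (0 : ℝ)..t, charDeriv 1 ψ F (s, x)) - ∫ s in (0 : ℝ)..t, charDeriv (-1) φ F (s, x)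
      := by
  have hz : dAlembert c κ φ ψ F (t, x) - dAlembert c κ φ ψ F (0, x)
      = (∫ y in x..(x - t), φ y) + (∫ y in x..(x + t), ψ y)
        + (1 / 2 : ℝ) • ∫ τ in (0 : ℝ)..t, ∫ y in (x - t + τ)..(x + t - τ), F (τ, y) := by
    simp only [dAlembert]
    rw [← intervalIntegral.integral_add_adjacent_intervals (a := c) (b := x) (c := x - t)
      hφi.intervalIntegrable hφi.intervalIntegrable,
      ← intervalIntegral.integral_add_adjacent_intervals (a := c) (b := x) (c := x + t)
      hψi.intervalIntegrable hψi.intervalIntegrable]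
    simp only [intervalIntegral.integral_same, sub_zero, add_zero]
    module
  rw [hz]
  rcases le_total 0 t with ht | ht
  · have h1 := smul_integral_charDeriv_line (σ := -1) (by simp) hφi hF hFi ht x
    have h2 := smul_integral_charDeriv_line (σ := 1) (by simp) hψi hF hFi ht x
    rw [one_smul] at h2
    rw [neg_one_smul, neg_eq_iff_eq_neg] at h1
    rw [h2, h1,
      integral_integral_add_adjacent hF hFi (a := fun τ => x - t + τ) (b := fun τ => x)
      (c := fun τ => x + t - τ) (by fun_prop) (by fun_prop) (by fun_prop)]
    have e1 : ∫ τ in (0 : ℝ)..t, ∫ y in x..(x + -1 * (t - τ)), F (τ, y)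
        = - ∫ τ in (0 : ℝ)..t, ∫ y in (x - t + τ)..x, F (τ, y) := by
      rw [← intervalIntegral.integral_neg]
      congr 1
      ext1 τ
      rw [intervalIntegral.integral_symm]
      ring_nf
    have e2 : ∫ τ in (0 : ℝ)..t, ∫ y in x..(x + 1 * (t - τ)), F (τ, y)
        = ∫ τ in (0 : ℝ)..t, ∫ y in x..(x + t - τ), F (τ, y) := by
      congr 1
      ext1 τ
      ring_nf
    rw [e1, e2, show x + -1 * t = x - t by ring, one_mul]
    module
  -- For negative times the source vanishes, and only the substitution in the homogeneous part
  -- remains. Negative times are included because the partial integration in `t` runs over the whole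
  -- line.
  · have h0 : ∀ (s : ℝ), s ≤ 0 → ∀ f : ℝ → Vec n, (∀ τ, τ < 0 → f τ = 0) →
        ∫ τ in (0 : ℝ)..s, f τ = 0 := by
      intro s hs f hf
      rw [intervalIntegral.integral_symm, intervalIntegral.integral_of_le hs,
        ← integral_Ico_eq_integral_Ioc, neg_eq_zero]
      exact setIntegral_eq_zero_of_forall_eq_zero fun τ hτ => hf τ hτ.2
    have h1 : ∀ (σ : ℝ) (χ : ℝ → Vec n), ∫ s in (0 : ℝ)..t, charDeriv σ χ F (s, x)
        = ∫ s in (0 : ℝ)..t, χ (x + σ * s) := by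
      intro σ χ
      refine intervalIntegral.integral_congr fun s hs => ?_
      rw [uIcc_of_ge ht] at hs
      simp only [charDeriv]
      rw [h0 s hs.2 _ fun τ hτ => hF0 _ hτ, smul_zero, add_zero]
    rw [h1, h1, h0 t ht _ fun τ hτ => by simp [hF0 (τ, _) hτ], smul_zero, add_zero]
    have h2 := intervalIntegral.smul_integral_comp_add_mul (a := 0) (b := t) φ (-1) x
    have h3 := intervalIntegral.smul_integral_comp_add_mul (a := 0) (b := t) ψ 1 x
    rw [one_smul] at h3
    rw [neg_one_smul, neg_eq_iff_eq_neg] at h2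
    rw [h3, h2, sub_neg_eq_add, add_comm]
    congr 2 <;> ring

theorem dAlembert_sub_line (hφ : StronglyMeasurable φ) (hψ : StronglyMeasurable ψ)
    (hφi : Integrable φ) (hψi : Integrable ψ)
    (hF : StronglyMeasurable F) (hFi : Integrable F) (hF0 : ∀ z : ℝ × ℝ, z.1 < 0 → F z = 0)
    (t₁ t₂ x : ℝ) :
    dAlembert c κ φ ψ F (t₂, x) - dAlembert c κ φ ψ F (t₁, x)
      = (∫ s in t₁..t₂, charDeriv 1 ψ F (s, x)) - ∫ s in t₁..t₂, charDeriv (-1) φ F (s, x) := by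
  have hA := integrable_charDeriv_line (σ := -1) (by simp) hφ hF hφi hFi x
  have hB := integrable_charDeriv_line (σ := 1) (by simp) hψ hF hψi hFi x
  rw [← intervalIntegral.integral_interval_sub_left (a := 0) hA.intervalIntegrable
    hA.intervalIntegrable, ← intervalIntegral.integral_interval_sub_left (a := 0)
    hB.intervalIntegrable hB.intervalIntegrable]
  have h1 := dAlembert_sub_line_zero (c := c) (κ := κ) hφi hψi hF hFi hF0 t₁ x
  have h2 := dAlembert_sub_line_zero (c := c) (κ := κ) hφi hψi hF hFi hF0 t₂ x
  rw [← sub_sub_sub_cancel_right _ _ (dAlembert c κ φ ψ F (0, x)), h1, h2]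
  abel

end

/-! ### Continuity and weak derivatives of d'Alembert's solution. -/

section

variable {n : ℕ} {σ : ℝ} {χ φ ψ : ℝ → Vec n} {F : ℝ × ℝ → Vec n}

section Continuity

theorem norm_charDeriv_ae_le (hσ : |σ| = 1) (hχ : StronglyMeasurable χ)
    (hF : StronglyMeasurable F) (hχi : Integrable χ) (hFi : Integrable F) :
    ∀ᵐ y, ∀ z : ℝ × ℝ, z.2 + σ * z.1 = y →
      ‖charDeriv σ χ F z‖ ≤ (charBound σ χ F y).toReal := by
  filter_upwards [ae_lt_top (measurable_charBound (σ := σ) hχ hF)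
    (lintegral_charBound_ne_top hχ hF hχi hFi)] with y hy z hz
  rw [← toReal_enorm]
  exact ENNReal.toReal_mono hy.ne (hz ▸ enorm_charDeriv_le hσ χ F z)

theorem integrable_toReal_charBound (hχ : StronglyMeasurable χ)
    (hF : StronglyMeasurable F) (hχi : Integrable χ) (hFi : Integrable F) :
    Integrable fun y => (charBound σ χ F y).toReal :=
  integrable_toReal_of_lintegral_ne_top (measurable_charBound hχ hF).aemeasurable
    (lintegral_charBound_ne_top hχ hF hχi hFi)

theorem norm_integral_charDeriv_slice_le (hσ : |σ| = 1) (hχ : StronglyMeasurable χ)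
    (hF : StronglyMeasurable F) (hχi : Integrable χ) (hFi : Integrable F) (t x₁ x₂ : ℝ) :
    ‖∫ x in x₁..x₂, charDeriv σ χ F (t, x)‖
      ≤ |∫ y in (x₁ + σ * t)..(x₂ + σ * t), (charBound σ χ F y).toReal| := by
  rw [← intervalIntegral.integral_comp_add_right]
  refine intervalIntegral.norm_integral_le_abs_of_norm_le ?_
    ((integrable_toReal_charBound hχ hF hχi hFi).comp_add_right _).intervalIntegrable
  refine ae_restrict_of_ae ?_
  filter_upwards [ae_slice_of_ae_characteristic σ t (norm_charDeriv_ae_le hσ hχ hF hχi hFi)]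
    with x hx using hx (t, x) rfl

theorem norm_integral_charDeriv_line_le (hσ : |σ| = 1) (hχ : StronglyMeasurable χ)
    (hF : StronglyMeasurable F) (hχi : Integrable χ) (hFi : Integrable F) (x t₁ t₂ : ℝ) :
    ‖∫ t in t₁..t₂, charDeriv σ χ F (t, x)‖
      ≤ |∫ y in (x + σ * t₁)..(x + σ * t₂), (charBound σ χ F y).toReal| := by
  rw [← intervalIntegral.smul_integral_comp_add_mul, smul_eq_mul, abs_mul, hσ, one_mul]
  have hm := measurePreserving_mul_left_of_abs_eq_one hσ
  refine intervalIntegral.norm_integral_le_abs_of_norm_le ?_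
    (hm.integrable_comp_of_integrable
      ((integrable_toReal_charBound hχ hF hχi hFi).comp_add_left x)).intervalIntegrable
  refine ae_restrict_of_ae ?_
  have h1 := (measurePreserving_add_left volume x).quasiMeasurePreserving.ae
    (norm_charDeriv_ae_le hσ hχ hF hχi hFi)
  filter_upwards [hm.quasiMeasurePreserving.ae h1] with t ht using ht (t, x) rfl

/-- Since the derivatives are bounded by integrable functions of the characteristic variables,
increments of the solution are bounded by increments of the continuous primitives `HA` and `HB`. One
passes from `z₀` to `z` first in time at fixed `x`, then in space at fixed `t`. -/
theorem continuous_dAlembert {c : ℝ} {κ : Vec n} (hφ : StronglyMeasurable φ)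
    (hψ : StronglyMeasurable ψ) (hφi : Integrable φ) (hψi : Integrable ψ)
    (hF : StronglyMeasurable F) (hFi : Integrable F) (hF0 : ∀ z : ℝ × ℝ, z.1 < 0 → F z = 0) :
    Continuous (dAlembert c κ φ ψ F) := by
  have hgA := integrable_toReal_charBound (σ := -1) hφ hF hφi hFi
  have hgB := integrable_toReal_charBound (σ := 1) hψ hF hψi hFi
  set HA : ℝ → ℝ := fun y => ∫ s in (0 : ℝ)..y, (charBound (-1) φ F s).toReal
  set HB : ℝ → ℝ := fun y => ∫ s in (0 : ℝ)..y, (charBound 1 ψ F s).toReal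
  have hHA : Continuous HA := intervalIntegral.continuous_primitive (fun _ _ => hgA.intervalIntegrable) _
  have hHB : Continuous HB := intervalIntegral.continuous_primitive (fun _ _ => hgB.intervalIntegrable) _
  have eA : ∀ a b, ∫ s in a..b, (charBound (-1) φ F s).toReal = HA b - HA a := fun a b =>
    (intervalIntegral.integral_interval_sub_left hgA.intervalIntegrable hgA.intervalIntegrable).symm
  have eB : ∀ a b, ∫ s in a..b, (charBound 1 ψ F s).toReal = HB b - HB a := fun a b =>
    (intervalIntegral.integral_interval_sub_left hgB.intervalIntegrable hgB.intervalIntegrable).symm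
  refine continuous_iff_continuousAt.2 fun z₀ => ?_
  refine tendsto_iff_norm_sub_tendsto_zero.2 ?_
  set bd : ℝ × ℝ → ℝ := fun z =>
    |HA (z.2 + -1 * z.1) - HA (z₀.2 + -1 * z.1)| + |HB (z.2 + 1 * z.1) - HB (z₀.2 + 1 * z.1)|
    + (|HB (z₀.2 + 1 * z.1) - HB (z₀.2 + 1 * z₀.1)|
      + |HA (z₀.2 + -1 * z.1) - HA (z₀.2 + -1 * z₀.1)|) with hbd
  have hbdc : Continuous bd := by fun_prop
  have hbd0 : Tendsto bd (𝓝 z₀) (𝓝 0) := by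
    have := hbdc.tendsto z₀
    rwa [show bd z₀ = 0 by simp [hbd]] at this
  refine squeeze_zero (fun _ => norm_nonneg _) (fun z => ?_) hbd0
  have h1 := dAlembert_sub_slice (c := c) (κ := κ) hφi hψi hF hFi z.1 z₀.2 z.2
  have h2 := dAlembert_sub_line (c := c) (κ := κ) hφ hψ hφi hψi hF hFi hF0 z₀.1 z.1 z₀.2
  calc ‖dAlembert c κ φ ψ F z - dAlembert c κ φ ψ F z₀‖
      = ‖(dAlembert c κ φ ψ F (z.1, z.2) - dAlembert c κ φ ψ F (z.1, z₀.2))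
        + (dAlembert c κ φ ψ F (z.1, z₀.2) - dAlembert c κ φ ψ F (z₀.1, z₀.2))‖ := by
          congr 1; abel
    _ ≤ bd z := by
      rw [h1, h2]
      refine (norm_add_le _ _).trans (add_le_add ((norm_add_le _ _).trans (add_le_add ?_ ?_))
        ((norm_sub_le _ _).trans (add_le_add ?_ ?_)))
      · exact (norm_integral_charDeriv_slice_le (by simp) hφ hF hφi hFi _ _ _).trans_eq (by rw [eA])
      · exact (norm_integral_charDeriv_slice_le (by simp) hψ hF hψi hFi _ _ _).trans_eq (by rw [eB])
      · exact (norm_integral_charDeriv_line_le (by simp) hψ hF hψi hFi _ _ _).trans_eq (by rw [eB])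
      · exact (norm_integral_charDeriv_line_le (by simp) hφ hF hφi hFi _ _ _).trans_eq (by rw [eA])

end Continuity

section WeakPartials

theorem integrable_smul_of_hasCompactSupport {f : ℝ × ℝ → ℝ} {g : ℝ × ℝ → Vec n}
    (hf : Continuous f) (hc : HasCompactSupport f) (hg : LocallyIntegrableOn g (tsupport f)) :
    Integrable fun z => f z • g z := by
  have : IntegrableOn (fun z => f z • g z) (tsupport f) :=
    (hg.integrableOn_isCompact hc).continuousOn_smul hf.continuousOn hc
  refine (integrableOn_iff_integrable_of_support_subset ?_).1 this
  exact (Function.support_smul_subset_left f g).trans (subset_tsupport _)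

theorem hasCompactSupport_fderiv_apply {f : ℝ × ℝ → ℝ} (hc : HasCompactSupport f) (v : ℝ × ℝ) :
    HasCompactSupport fun z => fderiv ℝ f z v :=
  (hc.fderiv ℝ).comp_left (g := fun A : ℝ × ℝ →L[ℝ] ℝ => A v) rfl

theorem continuous_fderiv_apply {f : ℝ × ℝ → ℝ} (hf : ContDiff ℝ ∞ f) (v : ℝ × ℝ) :
    Continuous fun z => fderiv ℝ f z v :=
  (hf.continuous_fderiv (by simp)).clm_apply continuous_const

/-- On each line `t = const` the function is a primitive of `g`, so one-dimensional integration by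
parts applies; Fubini assembles the lines. -/
theorem integral_fderiv_snd_smul {u g : ℝ × ℝ → Vec n} (hu : Continuous u)
    (hg : LocallyIntegrable g) (hgs : ∀ t, Integrable fun x => g (t, x))
    (h : ∀ t x₁ x₂, u (t, x₂) - u (t, x₁) = ∫ x in x₁..x₂, g (t, x)) {f : ℝ × ℝ → ℝ}
    (hf : ContDiff ℝ ∞ f) (hc : HasCompactSupport f) :
    ∫ z, fderiv ℝ f z (0, 1) • u z = -∫ z, f z • g z := by
  rw [Measure.volume_eq_prod, integral_prod _ (integrable_smul_of_hasCompactSupport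
      (continuous_fderiv_apply hf _) (hasCompactSupport_fderiv_apply hc _)
      (hu.locallyIntegrable.locallyIntegrableOn _)),
    integral_prod _ (integrable_smul_of_hasCompactSupport hf.continuous hc
      (hg.locallyIntegrableOn _)), ← integral_neg]
  congr 1
  ext1 t
  have hf' : ContDiff ℝ 1 fun x => f (t, x) :=
    (hf.of_le (by norm_cast)).comp (contDiff_const.prodMk contDiff_id)
  rw [← integral_deriv_smul_primitive (hgs t).locallyIntegrable (fun x y => h t x y) hf'
    (hc.comp_isClosedEmbedding (Isometry.of_dist_eq fun x y => by simp [Prod.dist_eq] :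
      Isometry fun x : ℝ => (t, x)).isClosedEmbedding)]
  congr 1
  ext1 x
  congr 1
  have h1 : HasFDerivAt f (fderiv ℝ f (t, x)) (t, x) :=
    (hf.differentiable (by simp) _).hasFDerivAt
  have h2 : HasDerivAt (fun x : ℝ => (t, x)) ((0 : ℝ), (1 : ℝ)) x :=
    (hasDerivAt_const x t).prodMk (hasDerivAt_id x)
  exact (h1.comp_hasDerivAt x h2).deriv.symm

theorem integral_fderiv_fst_smul {u g : ℝ × ℝ → Vec n} (hu : Continuous u)
    (hg : LocallyIntegrable g) (hgs : ∀ x, Integrable fun t => g (t, x))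
    (h : ∀ x t₁ t₂, u (t₂, x) - u (t₁, x) = ∫ t in t₁..t₂, g (t, x)) {f : ℝ × ℝ → ℝ}
    (hf : ContDiff ℝ ∞ f) (hc : HasCompactSupport f) :
    ∫ z, fderiv ℝ f z (1, 0) • u z = -∫ z, f z • g z := by
  rw [Measure.volume_eq_prod, integral_prod_symm _ (integrable_smul_of_hasCompactSupport
      (continuous_fderiv_apply hf _) (hasCompactSupport_fderiv_apply hc _)
      (hu.locallyIntegrable.locallyIntegrableOn _)),
    integral_prod_symm _ (integrable_smul_of_hasCompactSupport hf.continuous hc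
      (hg.locallyIntegrableOn _)), ← integral_neg]
  congr 1
  ext1 x
  have hf' : ContDiff ℝ 1 fun t => f (t, x) :=
    (hf.of_le (by norm_cast)).comp (contDiff_id.prodMk contDiff_const)
  rw [← integral_deriv_smul_primitive (hgs x).locallyIntegrable (fun s t => h x s t) hf'
    (hc.comp_isClosedEmbedding (Isometry.of_dist_eq fun s t => by simp [Prod.dist_eq] :
      Isometry fun t : ℝ => (t, x)).isClosedEmbedding)]
  congr 1
  ext1 t
  congr 1
  have h1 : HasFDerivAt f (fderiv ℝ f (t, x)) (t, x) :=
    (hf.differentiable (by simp) _).hasFDerivAt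
  have h2 : HasDerivAt (fun t : ℝ => (t, x)) ((1 : ℝ), (0 : ℝ)) t :=
    (hasDerivAt_id t).prodMk (hasDerivAt_const t x)
  exact (h1.comp_hasDerivAt t h2).deriv.symm

theorem hasWeakPartials_dAlembert (K : Set (ℝ × ℝ)) {c : ℝ} {κ : Vec n}
    (hφ : StronglyMeasurable φ) (hψ : StronglyMeasurable ψ) (hφi : Integrable φ)
    (hψi : Integrable ψ) (hF : StronglyMeasurable F) (hFi : Integrable F)
    (hF0 : ∀ z : ℝ × ℝ, z.1 < 0 → F z = 0) :
    HasWeakPartials K (dAlembert c κ φ ψ F)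
      (fun z => charDeriv 1 ψ F z - charDeriv (-1) φ F z)
      (fun z => charDeriv (-1) φ F z + charDeriv 1 ψ F z) := by
  have hW := continuous_dAlembert (c := c) (κ := κ) hφ hψ hφi hψi hF hFi hF0
  have hA := locallyIntegrable_charDeriv (σ := -1) (by simp) hφ hF hφi hFi
  have hB := locallyIntegrable_charDeriv (σ := 1) (by simp) hψ hF hψi hFi
  have hA1 := integrable_charDeriv_slice (σ := -1) (by simp) hφ hF hφi hFi
  have hB1 := integrable_charDeriv_slice (σ := 1) (by simp) hψ hF hψi hFi
  have hA2 := integrable_charDeriv_line (σ := -1) (by simp) hφ hF hφi hFi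
  have hB2 := integrable_charDeriv_line (σ := 1) (by simp) hψ hF hψi hFi
  have hd : ∀ (f : ℝ × ℝ → ℝ) (v : ℝ × ℝ), tsupport f ⊆ interior K → ∀ z, z ∉ K →
      fderiv ℝ f z v = 0 := fun f v hf z hz => by
    rw [image_eq_zero_of_notMem_tsupport (f := fderiv ℝ f)
      fun h => hz (interior_subset (hf (tsupport_fderiv_subset ℝ h)))]
    rfl
  have hd' : ∀ (f : ℝ × ℝ → ℝ), tsupport f ⊆ interior K → ∀ z, z ∉ K → f z = 0 :=
    fun f hf z hz => image_eq_zero_of_notMem_tsupport fun h => hz (interior_subset (hf h))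
  refine ⟨(hB.sub hA).locallyIntegrableOn _, (hA.add hB).locallyIntegrableOn _, ?_, ?_⟩
  · intro f hf hc hs
    rw [setIntegral_eq_integral_of_forall_compl_eq_zero fun z hz => by rw [hd f _ hs z hz, zero_smul],
      setIntegral_eq_integral_of_forall_compl_eq_zero fun z hz => by rw [hd' f hs z hz, zero_smul]]
    refine integral_fderiv_fst_smul hW (hB.sub hA) (fun x => (hB2 x).sub (hA2 x)) ?_ hf hc
    intro x t₁ t₂
    simp only [Pi.sub_apply]
    rw [intervalIntegral.integral_sub (hB2 x).intervalIntegrable (hA2 x).intervalIntegrable]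
    exact dAlembert_sub_line hφ hψ hφi hψi hF hFi hF0 t₁ t₂ x
  · intro f hf hc hs
    rw [setIntegral_eq_integral_of_forall_compl_eq_zero fun z hz => by rw [hd f _ hs z hz, zero_smul],
      setIntegral_eq_integral_of_forall_compl_eq_zero fun z hz => by rw [hd' f hs z hz, zero_smul]]
    refine integral_fderiv_snd_smul hW (hA.add hB) (fun t => (hA1 t).add (hB1 t)) ?_ hf hc
    intro t x₁ x₂
    simp only [Pi.add_apply]
    rw [intervalIntegral.integral_add (hA1 t).intervalIntegrable (hB1 t).intervalIntegrable]
    exact dAlembert_sub_slice hφi hψi hF hFi t x₁ x₂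

/-- Test functions only see the interior; the boundary of a convex set is null, so the equality
holds almost everywhere on `K`. -/
theorem ae_eq_zero_of_setIntegral_smul_eq {K : Set (ℝ × ℝ)} (hK : IsTrapezoid K)
    {g g' : ℝ × ℝ → Vec n} (hg : LocallyIntegrableOn g K) (hg' : LocallyIntegrableOn g' K)
    (h : ∀ f : ℝ × ℝ → ℝ, ContDiff ℝ ∞ f → HasCompactSupport f → tsupport f ⊆ interior K →
      ∫ z in K, f z • g z = ∫ z in K, f z • g' z) : ∀ᵐ z, z ∈ K → g z = g' z := by
  have h1 := isOpen_interior.ae_eq_zero_of_integral_contDiff_smul_eq_zero (μ := volume)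
    (U := interior K) (f := fun z => g z - g' z)
    ((hg.mono_set interior_subset).sub (hg'.mono_set interior_subset)) (by
      intro f hf hc hs
      have hsK := hs.trans interior_subset
      have h0 : ∀ z, z ∉ K → f z = 0 := fun z hz =>
        image_eq_zero_of_notMem_tsupport fun h => hz (hsK h)
      have := h f hf hc hs
      rw [setIntegral_eq_integral_of_forall_compl_eq_zero fun z hz => by rw [h0 z hz, zero_smul],
        setIntegral_eq_integral_of_forall_compl_eq_zero
          fun z hz => by rw [h0 z hz, zero_smul]] at this
      simp only [smul_sub]
      rw [integral_sub (integrable_smul_of_hasCompactSupport hf.continuous hc (hg.mono_set hsK))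
        (integrable_smul_of_hasCompactSupport hf.continuous hc (hg'.mono_set hsK)), this, sub_self])
  filter_upwards [h1, hK.ae_mem_interior_of_mem] with z h2 h3 hz using sub_eq_zero.1 (h2 (h3 hz))

theorem HasWeakPartials.ae_eq {K : Set (ℝ × ℝ)} (hK : IsTrapezoid K)
    {u u' ut ut' ux ux' : ℝ × ℝ → Vec n} (h : HasWeakPartials K u ut ux)
    (h' : HasWeakPartials K u' ut' ux') (hu : EqOn u u' K) :
    (∀ᵐ z, z ∈ K → ut z = ut' z) ∧ ∀ᵐ z, z ∈ K → ux z = ux' z := by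
  constructor
  · refine ae_eq_zero_of_setIntegral_smul_eq hK h.locInt_t h'.locInt_t fun f hf hc hs => ?_
    rw [← neg_inj, ← h.weak_t f hf hc hs, ← h'.weak_t f hf hc hs]
    exact setIntegral_congr_fun hK.measurableSet fun z hz => by simp only [hu hz]
  · refine ae_eq_zero_of_setIntegral_smul_eq hK h.locInt_x h'.locInt_x fun f hf hc hs => ?_
    rw [← neg_inj, ← h.weak_x f hf hc hs, ← h'.weak_x f hf hc hs]
    exact setIntegral_congr_fun hK.measurableSet fun z hz => by simp only [hu hz]

end WeakPartials

end

/-! ### Time slices as continuous curves in `L¹`. -/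

section

variable {n : ℕ} {σ : ℝ} {χ φ ψ : ℝ → Vec n} {F : ℝ × ℝ → Vec n} {K : Set (ℝ × ℝ)}

theorem indicator_slice (K : Set (ℝ × ℝ)) (v : ℝ × ℝ → Vec n) (t : ℝ) :
    (fun x => K.indicator v (t, x)) = (slice K t).indicator fun x => v (t, x) := by
  ext1 x
  by_cases h : (t, x) ∈ K
  · rw [indicator_of_mem h, indicator_of_mem (show x ∈ slice K t from h)]
  · rw [indicator_of_notMem h, indicator_of_notMem (show x ∉ slice K t from h)]

theorem IsCbL1.integrable_indicator (hK : IsTrapezoid K) {v : ℝ × ℝ → Vec n} (hv : IsCbL1 K v)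
    {t : ℝ} (ht : t ∈ timeSet K) : Integrable fun x => K.indicator v (t, x) := by
  rw [indicator_slice, integrable_indicator_iff (hK.measurableSet_slice t)]
  exact hv.integrableOn_slice t ht

theorem IsCbL1.neg {v : ℝ × ℝ → Vec n} (hv : IsCbL1 K v) : IsCbL1 K fun z => -v z where
  aestronglyMeasurable := hv.aestronglyMeasurable.neg
  integrableOn_slice t ht := (hv.integrableOn_slice t ht).neg
  bounded := by simpa using hv.bounded
  continuous t ht := by
    refine (hv.continuous t ht).congr fun s => lintegral_congr fun x => ?_
    have : K.indicator (fun z => -v z) = -K.indicator v := Set.indicator_neg' K v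
    rw [this, Pi.neg_apply, Pi.neg_apply, ← neg_sub', enorm_neg]

theorem IsCbL1.add (hK : IsTrapezoid K) {v w : ℝ × ℝ → Vec n} (hv : IsCbL1 K v)
    (hw : IsCbL1 K w) : IsCbL1 K fun z => v z + w z where
  aestronglyMeasurable := hv.aestronglyMeasurable.add hw.aestronglyMeasurable
  integrableOn_slice t ht := (hv.integrableOn_slice t ht).add (hw.integrableOn_slice t ht)
  bounded := by
    obtain ⟨C, hC⟩ := hv.bounded
    obtain ⟨D, hD⟩ := hw.bounded
    refine ⟨C + D, fun t ht => ?_⟩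
    rw [ENNReal.coe_add]
    refine (lintegral_mono fun x => enorm_add_le _ _).trans ?_
    rw [lintegral_add_left' (hv.integrableOn_slice t ht).1.enorm]
    exact add_le_add (hC t ht) (hD t ht)
  continuous t ht := by
    have h0 := (hv.continuous t ht).add (hw.continuous t ht)
    rw [add_zero] at h0
    refine tendsto_of_tendsto_of_tendsto_of_le_of_le' tendsto_const_nhds h0
      (Eventually.of_forall fun _ => zero_le) ?_
    filter_upwards [self_mem_nhdsWithin] with s hs
    have hm : AEMeasurable (fun x => ‖K.indicator v (s, x) - K.indicator v (t, x)‖ₑ)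
        (volume.restrict (base K)) :=
      ((hv.integrable_indicator hK hs).sub (hv.integrable_indicator hK ht)).1.enorm.restrict
    rw [← lintegral_add_left' hm]
    refine lintegral_mono fun x => ?_
    have : K.indicator (fun z => v z + w z) = K.indicator v + K.indicator w := Set.indicator_add' K v w
    rw [this, Pi.add_apply, Pi.add_apply, add_sub_add_comm]
    exact enorm_add_le _ _

theorem continuous_charDeriv_characteristic {y : ℝ} (hy : Integrable fun τ => F (τ, y - σ * τ)) :
    Continuous fun s => charDeriv σ χ F (s, y - σ * s) := by
  have : (fun s => charDeriv σ χ F (s, y - σ * s))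
      = fun s => χ y + (σ / 2) • ∫ τ in (0 : ℝ)..s, F (τ, y - σ * τ) := by
    ext1 s
    simp [charDeriv]
  rw [this]
  exact continuous_const.add
    ((intervalIntegral.continuous_primitive (fun _ _ => hy.intervalIntegrable) _).fun_const_smul _)

/-- Follow the characteristic `x = y - σ s`. For almost every `y`, both the function and the
membership in `K` vary continuously with `s` there, and `charBound` dominates. Returning to fixed
`x` costs a translation, which is continuous in `L¹`. -/
theorem isCbL1_charDeriv (hK : IsTrapezoid K) (hσ : |σ| = 1) (hχ : StronglyMeasurable χ)
    (hF : StronglyMeasurable F) (hχi : Integrable χ) (hFi : Integrable F) :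
    IsCbL1 K (charDeriv σ χ F) where
  aestronglyMeasurable := (stronglyMeasurable_charDeriv hχ hF).aestronglyMeasurable
  integrableOn_slice t _ := (integrable_charDeriv_slice hσ hχ hF hχi hFi t).integrableOn
  bounded := by
    refine ⟨(∫⁻ y, charBound σ χ F y).toNNReal, fun t _ => ?_⟩
    rw [ENNReal.coe_toNNReal (lintegral_charBound_ne_top hχ hF hχi hFi), lintegral_charBound hχ hF,
      ← lintegral_slice_charBound (σ := σ) hχ hF t]
    exact (setLIntegral_le_lintegral _ _).trans
      (lintegral_mono fun x => enorm_charDeriv_le hσ χ F (t, x))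
  continuous t ht := by
    have hV := stronglyMeasurable_charDeriv (σ := σ) hχ hF
    set v := K.indicator (charDeriv σ χ F) with hv
    have hvm : StronglyMeasurable v := hV.indicator hK.measurableSet
    have hvb : ∀ z, ‖v z‖ₑ ≤ charBound σ χ F (z.2 + σ * z.1) := fun z =>
      (enorm_indicator_le_enorm_self _ _).trans (enorm_charDeriv_le hσ χ F z)
    set w : ℝ → ℝ → Vec n := fun s y => v (s, y - σ * s) with hw
    have hwm : ∀ s, StronglyMeasurable (w s) := fun s => hvm.comp_measurable (by fun_prop)
    have hwb : ∀ s y, ‖w s y‖ₑ ≤ charBound σ χ F y := fun s y => by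
      simpa [hw] using hvb (s, y - σ * s)
    have hGm := measurable_charBound (σ := σ) hχ hF
    have hGt := lintegral_charBound_ne_top (σ := σ) hχ hF hχi hFi
    have hwi : Integrable (w t) :=
      ⟨(hwm t).aestronglyMeasurable, (lintegral_mono (hwb t)).trans_lt hGt.lt_top⟩
    have h1 : Tendsto (fun s => ∫⁻ y, ‖w s y - w t y‖ₑ) (𝓝[timeSet K] t) (𝓝 0) := by
      have h := tendsto_lintegral_filter_of_dominated_convergence (μ := volume)
        (l := 𝓝[timeSet K] t) (F := fun s y => ‖w s y - w t y‖ₑ) (f := fun _ => 0)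
        (fun y => charBound σ χ F y + charBound σ χ F y)
        (Eventually.of_forall fun s => ((hwm s).sub (hwm t)).enorm)
        (Eventually.of_forall fun s => Eventually.of_forall fun y =>
          enorm_sub_le.trans (add_le_add (hwb s y) (hwb t y)))
        (by rw [lintegral_add_left hGm]; exact ENNReal.add_ne_top.2 ⟨hGt, hGt⟩) ?_
      · simpa using h
      · filter_upwards [ae_integrable_characteristic (σ := σ) hFi,
          hK.ae_eventually_mem_iff (σ := σ) (t := t) hσ] with y hy1 hy2
        have hc : Tendsto (fun s => ‖charDeriv σ χ F (s, y - σ * s)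
            - charDeriv σ χ F (t, y - σ * t)‖ₑ) (𝓝[timeSet K] t) (𝓝 0) := by
          have hc := (((continuous_charDeriv_characteristic (χ := χ) hy1).sub
            (continuous_const (y := charDeriv σ χ F (t, y - σ * t)))).enorm.tendsto t).mono_left
            (nhdsWithin_le_nhds (s := timeSet K))
          simpa using hc
        refine tendsto_of_tendsto_of_tendsto_of_le_of_le' tendsto_const_nhds hc
          (Eventually.of_forall fun _ => zero_le) ?_
        filter_upwards [hy2] with s hs
        by_cases hm : (t, y - σ * t) ∈ K
        · simp only [hw, hv, indicator_of_mem hm, indicator_of_mem (hs.2 hm)]; exact le_rfl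
        · have hm' : (s, y - σ * s) ∉ K := fun h => hm (hs.1 h)
          simp [hw, hv, indicator_of_notMem hm, indicator_of_notMem hm']
    -- The frozen profile at time `t`, compared at characteristic coordinates that differ by `σ (s -
    -- t)`.
    have h2 : Tendsto (fun s => ∫⁻ y, ‖w t (y + σ * (s - t)) - w t y‖ₑ) (𝓝[timeSet K] t) (𝓝 0) := by
      have hs : Tendsto (fun s => σ * (s - t)) (𝓝[timeSet K] t) (𝓝 0) := by
        have : Continuous fun s => σ * (s - t) := by fun_prop
        have := (this.tendsto t).mono_left (nhdsWithin_le_nhds (s := timeSet K))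
        simpa using this
      exact (tendsto_lintegral_translate hwi).comp hs
    have h3 := h1.add h2
    rw [add_zero] at h3
    refine tendsto_of_tendsto_of_tendsto_of_le_of_le tendsto_const_nhds h3
      (fun _ => zero_le) fun s => ?_
    calc ∫⁻ x in base K, ‖v (s, x) - v (t, x)‖ₑ
        ≤ ∫⁻ x, ‖v (s, x) - v (t, x)‖ₑ := setLIntegral_le_lintegral _ _
      _ ≤ ∫⁻ x, (‖w s (x + σ * s) - w t (x + σ * s)‖ₑ + ‖w t (x + σ * s) - w t (x + σ * t)‖ₑ) := by
        refine lintegral_mono fun x => ?_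
        have : v (s, x) - v (t, x) = (w s (x + σ * s) - w t (x + σ * s))
            + (w t (x + σ * s) - w t (x + σ * t)) := by
          simp [hw]
        rw [this]
        exact enorm_add_le _ _
      _ = (∫⁻ y, ‖w s y - w t y‖ₑ) + ∫⁻ y, ‖w t (y + σ * (s - t)) - w t y‖ₑ := by
        have hm : Measurable fun x => ‖w s (x + σ * s) - w t (x + σ * s)‖ₑ :=
          (((hwm s).sub (hwm t)).comp_measurable (by fun_prop : Measurable (· + σ * s))).enorm
        rw [lintegral_add_left hm,
          lintegral_add_right_eq_self (fun y => ‖w s y - w t y‖ₑ),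
          ← lintegral_add_right_eq_self (fun y => ‖w t (y + σ * (s - t)) - w t y‖ₑ) (σ * t)]
        congr 3
        ext1 x
        ring_nf

end

/-! ### Pointwise bounds for the null form. -/

section

section Pointwise

variable {n : ℕ}

/-- The nonlinearity as a function of the values of `u`, of the derivatives `a`, `b` in the two
characteristic directions and of the forcing. -/
def nonlin (Γ : Fin n → Fin n → Vec n → Vec n) (P : Vec n → Vec n →L[ℝ] Vec n)
    (u a b f : Vec n) : Vec n :=
  (∑ j, ∑ k, ((b - a) j * (b - a) k - (a + b) j * (a + b) k) • Γ j k u) + P u f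

variable {Γ : Fin n → Fin n → Vec n → Vec n} {P : Vec n → Vec n →L[ℝ] Vec n} {g L : ℝ≥0}

/-- The null structure is used here: each quadratic factor equals `-2 (a_j b_k + b_j a_k)`, so every
term of the bound pairs one left with one right derivative. -/
theorem norm_nonlin_sub_le (hΓ : ∀ j k y, ‖Γ j k y‖ ≤ g) (hP : ∀ y, ‖P y‖ ≤ g)
    (hΓL : ∀ j k, LipschitzWith L (Γ j k)) (hPL : LipschitzWith L P) (u a b f u' a' b' f' : Vec n) :
    ‖nonlin Γ P u a b f - nonlin Γ P u' a' b' f'‖ ≤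
      4 * g * (‖a - a'‖ * ‖b‖ + ‖a'‖ * ‖b - b'‖)
      + L * ‖u - u'‖ * (4 * (‖a'‖ * ‖b'‖) + ‖f'‖) + g * ‖f - f'‖ := by
  have key : ∀ j k, ‖((b - a) j * (b - a) k - (a + b) j * (a + b) k) • Γ j k u
      - ((b' - a') j * (b' - a') k - (a' + b') j * (a' + b') k) • Γ j k u'‖
      ≤ 2 * g * (|(a - a') j| * |b k| + |a' j| * |(b - b') k|
          + (|b j| * |(a - a') k| + |(b - b') j| * |a' k|))
        + L * ‖u - u'‖ * 2 * (|a' j| * |b' k| + |b' j| * |a' k|) := by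
    intro j k
    set q := (b - a) j * (b - a) k - (a + b) j * (a + b) k with hq
    set q' := (b' - a') j * (b' - a') k - (a' + b') j * (a' + b') k with hq'
    have e1 : q - q' = -2 * ((a - a') j * b k + a' j * (b - b') k
        + (b j * (a - a') k + (b - b') j * a' k)) := by
      simp only [hq, hq', PiLp.sub_apply, PiLp.add_apply]; ring
    have e2 : q' = -2 * (a' j * b' k + b' j * a' k) := by
      simp only [hq', PiLp.sub_apply, PiLp.add_apply]; ring
    have b1 : |q - q'| ≤ 2 * (|(a - a') j| * |b k| + |a' j| * |(b - b') k|
          + (|b j| * |(a - a') k| + |(b - b') j| * |a' k|)) := by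
      rw [e1, abs_mul, abs_neg, abs_two]
      simp only [← abs_mul]
      gcongr
      exact (abs_add_le _ _).trans (add_le_add (abs_add_le _ _) (abs_add_le _ _))
    have b2 : |q'| ≤ 2 * (|a' j| * |b' k| + |b' j| * |a' k|) := by
      rw [e2, abs_mul, abs_neg, abs_two]
      simp only [← abs_mul]
      gcongr
      exact abs_add_le _ _
    have e3 : q • Γ j k u - q' • Γ j k u' = (q - q') • Γ j k u + q' • (Γ j k u - Γ j k u') := by
      module
    rw [e3]
    refine (norm_add_le _ _).trans ?_
    rw [norm_smul, norm_smul, Real.norm_eq_abs, Real.norm_eq_abs]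
    have b3 : ‖Γ j k u - Γ j k u'‖ ≤ L * ‖u - u'‖ := (hΓL j k).norm_sub_le u u'
    calc |q - q'| * ‖Γ j k u‖ + |q'| * ‖Γ j k u - Γ j k u'‖
        ≤ (2 * (|(a - a') j| * |b k| + |a' j| * |(b - b') k|
          + (|b j| * |(a - a') k| + |(b - b') j| * |a' k|))) * g
          + (2 * (|a' j| * |b' k| + |b' j| * |a' k|)) * (L * ‖u - u'‖) := by
          gcongr
          exact hΓ j k u
      _ = _ := by ring
  have hsum : ‖(∑ j, ∑ k, ((b - a) j * (b - a) k - (a + b) j * (a + b) k) • Γ j k u)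
      - ∑ j, ∑ k, ((b' - a') j * (b' - a') k - (a' + b') j * (a' + b') k) • Γ j k u'‖
      ≤ 4 * g * (‖a - a'‖ * ‖b‖ + ‖a'‖ * ‖b - b'‖) + L * ‖u - u'‖ * (4 * (‖a'‖ * ‖b'‖)) := by
    simp only [← Finset.sum_sub_distrib]
    -- For the `ℓ¹` norm the double sum of `|a_j| |b_k|` is exactly `‖a‖ ‖b‖`, so the constants do
    -- not depend on `n`.
    refine (norm_sum_le_of_le _ fun j _ => norm_sum_le_of_le _ fun k _ => key j k).trans_eq ?_
    simp only [Finset.sum_add_distrib, ← Finset.mul_sum, ← Finset.sum_mul, PiLp.norm_eq_of_L1,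
      Real.norm_eq_abs]
    ring
  have hPd : ‖P u f - P u' f'‖ ≤ g * ‖f - f'‖ + L * ‖u - u'‖ * ‖f'‖ := by
    have e : P u f - P u' f' = P u (f - f') + (P u - P u') f' := by simp
    rw [e]
    refine (norm_add_le _ _).trans (add_le_add ?_ ?_)
    · exact ((P u).le_opNorm _).trans (by gcongr; exact hP u)
    · exact ((P u - P u').le_opNorm _).trans (by gcongr; exact hPL.norm_sub_le u u')
  have e : nonlin Γ P u a b f - nonlin Γ P u' a' b' f'
      = ((∑ j, ∑ k, ((b - a) j * (b - a) k - (a + b) j * (a + b) k) • Γ j k u)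
      - ∑ j, ∑ k, ((b' - a') j * (b' - a') k - (a' + b') j * (a' + b') k) • Γ j k u')
      + (P u f - P u' f') := by
    simp only [nonlin]; abel
  rw [e]
  refine ((norm_add_le _ _).trans (add_le_add hsum hPd)).trans_eq ?_
  ring

theorem enorm_nonlin_sub_le (hΓ : ∀ j k y, ‖Γ j k y‖ ≤ g) (hP : ∀ y, ‖P y‖ ≤ g)
    (hΓL : ∀ j k, LipschitzWith L (Γ j k)) (hPL : LipschitzWith L P) (u a b f u' a' b' f' : Vec n) :
    ‖nonlin Γ P u a b f - nonlin Γ P u' a' b' f'‖ₑ ≤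
      4 * g * (‖a - a'‖ₑ * ‖b‖ₑ + ‖a'‖ₑ * ‖b - b'‖ₑ)
      + L * ‖u - u'‖ₑ * (4 * (‖a'‖ₑ * ‖b'‖ₑ) + ‖f'‖ₑ) + g * ‖f - f'‖ₑ := by
  simp only [enorm_eq_nnnorm]
  norm_cast
  have := norm_nonlin_sub_le hΓ hP hΓL hPL u a b f u' a' b' f'
  rw [← NNReal.coe_le_coe]
  push_cast
  exact this

theorem enorm_nonlin_le (hΓ : ∀ j k y, ‖Γ j k y‖ ≤ g) (hP : ∀ y, ‖P y‖ ≤ g)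
    (hΓL : ∀ j k, LipschitzWith L (Γ j k)) (hPL : LipschitzWith L P) (u a b f : Vec n) :
    ‖nonlin Γ P u a b f‖ₑ ≤ 4 * g * (‖a‖ₑ * ‖b‖ₑ) + g * ‖f‖ₑ := by
  simpa [nonlin] using enorm_nonlin_sub_le hΓ hP hΓL hPL u a b f u 0 0 0

end Pointwise

end

/-! ### Profiles, and `L¹` bounds for the right-hand side. -/

section

variable {n : ℕ}

/-- The data from which a solution is built by d'Alembert's formula. -/
structure Profile (n : ℕ) where
  κ : Vec n
  φ : ℝ → Vec n
  ψ : ℝ → Vec n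
  F : ℝ × ℝ → Vec n

/-- Genuinely strongly measurable representatives are required so that restrictions to slices and
characteristics, which are null sets, remain measurable. Vanishing off `K` includes vanishing at
negative times. -/
structure Profile.Regular (K : Set (ℝ × ℝ)) (p : Profile n) : Prop where
  φ_meas : StronglyMeasurable p.φ
  ψ_meas : StronglyMeasurable p.ψ
  F_meas : StronglyMeasurable p.F
  φ_int : Integrable p.φ
  ψ_int : Integrable p.ψ
  F_int : Integrable p.F
  F_zero : ∀ z, z ∉ K → p.F z = 0

/-- The function given by d'Alembert's formula, with its derivatives. -/
def Profile.triple (c : ℝ) (p : Profile n) : Triple n where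
  u := dAlembert c p.κ p.φ p.ψ p.F
  ut z := charDeriv 1 p.ψ p.F z - charDeriv (-1) p.φ p.F z
  ux z := charDeriv (-1) p.φ p.F z + charDeriv 1 p.ψ p.F z

/-- A bound for the derivative with respect to `x - t`. -/
def Profile.sizeLeft (p : Profile n) : ℝ≥0∞ := (∫⁻ y, ‖p.φ y‖ₑ) + 2⁻¹ * ∫⁻ z, ‖p.F z‖ₑ

/-- A bound for the derivative with respect to `x + t`. -/
def Profile.sizeRight (p : Profile n) : ℝ≥0∞ := (∫⁻ y, ‖p.ψ y‖ₑ) + 2⁻¹ * ∫⁻ z, ‖p.F z‖ₑ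

/-- A bound for the function itself. -/
def Profile.size (p : Profile n) : ℝ≥0∞ :=
  ‖p.κ‖ₑ + (∫⁻ y, ‖p.φ y‖ₑ) + (∫⁻ y, ‖p.ψ y‖ₑ) + 2⁻¹ * ∫⁻ z, ‖p.F z‖ₑ

/-- D'Alembert's formula is linear in the profile, so differences of solutions are measured by the
sizes of `p - q`. -/
instance : Sub (Profile n) := ⟨fun p q => ⟨p.κ - q.κ, p.φ - q.φ, p.ψ - q.ψ, p.F - q.F⟩⟩

variable {K : Set (ℝ × ℝ)} {p q : Profile n} {c : ℝ}

theorem Profile.Regular.sub (hp : p.Regular K) (hq : q.Regular K) : (p - q).Regular K where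
  φ_meas := hp.φ_meas.sub hq.φ_meas
  ψ_meas := hp.ψ_meas.sub hq.ψ_meas
  F_meas := hp.F_meas.sub hq.F_meas
  φ_int := hp.φ_int.sub hq.φ_int
  ψ_int := hp.ψ_int.sub hq.ψ_int
  F_int := hp.F_int.sub hq.F_int
  F_zero z hz := by
    show p.F z - q.F z = 0
    rw [hp.F_zero z hz, hq.F_zero z hz, sub_zero]

theorem Profile.Regular.F_eq_zero_of_neg (hK : IsTrapezoid K) (hp : p.Regular K) (z : ℝ × ℝ)
    (hz : z.1 < 0) : p.F z = 0 :=
  hp.F_zero z fun h => absurd (hK.time_nonneg z h) (not_le.2 hz)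

theorem Profile.Regular.continuous (hK : IsTrapezoid K) (hp : p.Regular K) :
    Continuous (p.triple c).u :=
  continuous_dAlembert hp.φ_meas hp.ψ_meas hp.φ_int hp.ψ_int hp.F_meas hp.F_int
    (hp.F_eq_zero_of_neg hK)

theorem Profile.Regular.hasWeakPartials (hK : IsTrapezoid K) (hp : p.Regular K) :
    HasWeakPartials K (p.triple c).u (p.triple c).ut (p.triple c).ux :=
  hasWeakPartials_dAlembert K hp.φ_meas hp.ψ_meas hp.φ_int hp.ψ_int hp.F_meas hp.F_int
    (hp.F_eq_zero_of_neg hK)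

theorem enorm_intervalIntegral_le {E : Type*} [NormedAddCommGroup E] [NormedSpace ℝ E]
    (f : ℝ → E) (a b : ℝ) : ‖∫ y in a..b, f y‖ₑ ≤ ∫⁻ y, ‖f y‖ₑ := by
  rw [intervalIntegral.intervalIntegral_eq_integral_uIoc, enorm_smul]
  refine (mul_le_of_le_one_left zero_le ?_).trans
    ((enorm_integral_le_lintegral_enorm _).trans (setLIntegral_le_lintegral _ _))
  split_ifs <;> simp

theorem enorm_dAlembert_le (hp : StronglyMeasurable p.F) (z : ℝ × ℝ) :
    ‖(p.triple c).u z‖ₑ ≤ p.size := by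
  simp only [Profile.triple, dAlembert, Profile.size]
  refine (enorm_add_le _ _).trans (add_le_add ((enorm_add_le _ _).trans (add_le_add
    ((enorm_add_le _ _).trans (add_le_add le_rfl ?_)) ?_)) ?_)
  · exact enorm_intervalIntegral_le _ _ _
  · exact enorm_intervalIntegral_le _ _ _
  · rw [enorm_smul, Real.enorm_eq_ofReal_abs, abs_of_pos (by norm_num), one_div,
      ENNReal.ofReal_inv_of_pos two_pos, ENNReal.ofReal_ofNat]
    gcongr
    refine (enorm_intervalIntegral_le _ _ _).trans ?_
    rw [Measure.volume_eq_prod, lintegral_prod _ hp.enorm.aemeasurable]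
    exact lintegral_mono fun τ => enorm_intervalIntegral_le _ _ _

theorem dAlembert_sub (hp : p.Regular K) (hq : q.Regular K) (z : ℝ × ℝ) :
    (p.triple c).u z - (q.triple c).u z = ((p - q).triple c).u z := by
  have h1 : ∫ τ in (0 : ℝ)..z.1, ∫ y in (z.2 - z.1 + τ)..(z.2 + z.1 - τ), (p.F - q.F) (τ, y)
      = (∫ τ in (0 : ℝ)..z.1, ∫ y in (z.2 - z.1 + τ)..(z.2 + z.1 - τ), p.F (τ, y))
        - ∫ τ in (0 : ℝ)..z.1, ∫ y in (z.2 - z.1 + τ)..(z.2 + z.1 - τ), q.F (τ, y) := by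
    rw [← intervalIntegral.integral_sub
      (integrable_intervalIntegral hp.F_meas hp.F_int (by fun_prop) (by fun_prop)).intervalIntegrable
      (integrable_intervalIntegral hq.F_meas hq.F_int (by fun_prop) (by fun_prop)).intervalIntegrable]
    refine intervalIntegral.integral_congr_ae ?_
    filter_upwards [hp.F_int.prod_right_ae, hq.F_int.prod_right_ae] with τ h1 h2 _
    rw [← intervalIntegral.integral_sub h1.intervalIntegrable h2.intervalIntegrable]
    rfl
  show dAlembert c p.κ p.φ p.ψ p.F z - dAlembert c q.κ q.φ q.ψ q.F z
    = dAlembert c (p.κ - q.κ) (p.φ - q.φ) (p.ψ - q.ψ) (p.F - q.F) z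
  simp only [dAlembert]
  rw [h1]
  simp only [Pi.sub_apply]
  rw [intervalIntegral.integral_sub hp.φ_int.intervalIntegrable hq.φ_int.intervalIntegrable,
    intervalIntegral.integral_sub hp.ψ_int.intervalIntegrable hq.ψ_int.intervalIntegrable]
  module

theorem enorm_dAlembert_sub_le (hp : p.Regular K) (hq : q.Regular K) (z : ℝ × ℝ) :
    ‖(p.triple c).u z - (q.triple c).u z‖ₑ ≤ (p - q).size := by
  rw [dAlembert_sub hp hq]
  exact enorm_dAlembert_le (hp.sub hq).F_meas z

theorem lintegral_charBound_left (σ : ℝ) (hp : p.Regular K) :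
    ∫⁻ y, charBound σ p.φ p.F y = p.sizeLeft := lintegral_charBound hp.φ_meas hp.F_meas

theorem lintegral_charBound_right (σ : ℝ) (hp : p.Regular K) :
    ∫⁻ y, charBound σ p.ψ p.F y = p.sizeRight := lintegral_charBound hp.ψ_meas hp.F_meas

theorem lintegral_charBound_mul (hp : p.Regular K) (hq : q.Regular K) :
    ∫⁻ z : ℝ × ℝ, charBound (-1) p.φ p.F (z.2 + -1 * z.1) * charBound 1 q.ψ q.F (z.2 + 1 * z.1)
      = 2⁻¹ * (p.sizeLeft * q.sizeRight) := by
  rw [← lintegral_charBound_left (-1) hp, ← lintegral_charBound_right 1 hq,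
    ← lintegral_mul_characteristics (measurable_charBound hp.φ_meas hp.F_meas)
      (measurable_charBound hq.ψ_meas hq.F_meas)]
  simp [sub_eq_add_neg]

theorem measurable_charBound_mul (hp : p.Regular K) (hq : q.Regular K) :
    Measurable fun z : ℝ × ℝ =>
      charBound (-1) p.φ p.F (z.2 + -1 * z.1) * charBound 1 q.ψ q.F (z.2 + 1 * z.1) :=
  ((measurable_charBound hp.φ_meas hp.F_meas).comp (by fun_prop)).mul
    ((measurable_charBound hq.ψ_meas hq.F_meas).comp (by fun_prop))

variable {Γ : Fin n → Fin n → Vec n → Vec n} {P : Vec n → Vec n →L[ℝ] Vec n} {g L : ℝ≥0}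
  {f f' : ℝ × ℝ → Vec n}

/-- The constant `4` of the pointwise bound is halved by the Jacobian in the product estimate for
the two characteristic variables. -/
theorem lintegral_rhs_le (hΓ : ∀ j k y, ‖Γ j k y‖ ≤ g) (hP : ∀ y, ‖P y‖ ≤ g)
    (hΓL : ∀ j k, LipschitzWith L (Γ j k)) (hPL : LipschitzWith L P) (hp : p.Regular K) :
    ∫⁻ z in K, ‖rhs Γ P f (p.triple c) z‖ₑ
      ≤ 2 * g * (p.sizeLeft * p.sizeRight) + g * ∫⁻ z in K, ‖f z‖ₑ := by
  have hm := measurable_charBound_mul hp hp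
  calc ∫⁻ z in K, ‖rhs Γ P f (p.triple c) z‖ₑ
      ≤ ∫⁻ z in K, (4 * g * (charBound (-1) p.φ p.F (z.2 + -1 * z.1)
        * charBound 1 p.ψ p.F (z.2 + 1 * z.1)) + g * ‖f z‖ₑ) := by
        refine lintegral_mono fun z => (enorm_nonlin_le hΓ hP hΓL hPL _ _ _ _).trans ?_
        gcongr
        · exact enorm_charDeriv_le (by simp) _ _ z
        · exact enorm_charDeriv_le (by simp) _ _ z
    _ ≤ 4 * g * (2⁻¹ * (p.sizeLeft * p.sizeRight)) + g * ∫⁻ z in K, ‖f z‖ₑ := by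
        rw [lintegral_add_left (hm.const_mul _), lintegral_const_mul _ hm,
          lintegral_const_mul' _ _ (by simp), ← lintegral_charBound_mul hp hp]
        gcongr
        exact Measure.restrict_le_self
    _ = _ := by
        rw [show (4 : ℝ≥0∞) = 2 * 2 by norm_num]
        have : (2 : ℝ≥0∞) * 2⁻¹ = 1 := ENNReal.mul_inv_cancel two_ne_zero ENNReal.ofNat_ne_top
        calc _ = 2 * g * ((2 * 2⁻¹) * (p.sizeLeft * p.sizeRight)) + g * ∫⁻ z in K, ‖f z‖ₑ := by ring
          _ = _ := by rw [this, one_mul]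

/-- The difference of profiles enters the null form in one factor at a time, and the coefficients
through the uniform bound for the difference of the functions. Each product again pairs a left with
a right bound. -/
theorem lintegral_rhs_sub_le (hΓ : ∀ j k y, ‖Γ j k y‖ ≤ g) (hP : ∀ y, ‖P y‖ ≤ g)
    (hΓL : ∀ j k, LipschitzWith L (Γ j k)) (hPL : LipschitzWith L P) (hp : p.Regular K)
    (hq : q.Regular K) (hf' : AEStronglyMeasurable f' (volume.restrict K)) :
    ∫⁻ z in K, ‖rhs Γ P f (p.triple c) z - rhs Γ P f' (q.triple c) z‖ₑ
      ≤ 2 * g * ((p - q).sizeLeft * p.sizeRight + q.sizeLeft * (p - q).sizeRight)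
        + L * (p - q).size * (2 * (q.sizeLeft * q.sizeRight) + ∫⁻ z in K, ‖f' z‖ₑ)
        + g * ∫⁻ z in K, ‖f z - f' z‖ₑ := by
  have hpq := hp.sub hq
  have m1 := measurable_charBound_mul hpq hp
  have m2 := measurable_charBound_mul hq hpq
  have m3 := measurable_charBound_mul hq hq
  set G1 : ℝ × ℝ → ℝ≥0∞ := fun z => charBound (-1) (p - q).φ (p - q).F (z.2 + -1 * z.1)
        * charBound 1 p.ψ p.F (z.2 + 1 * z.1) with hG1
  set G2 : ℝ × ℝ → ℝ≥0∞ := fun z => charBound (-1) q.φ q.F (z.2 + -1 * z.1)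
        * charBound 1 (p - q).ψ (p - q).F (z.2 + 1 * z.1) with hG2
  set G3 : ℝ × ℝ → ℝ≥0∞ := fun z => charBound (-1) q.φ q.F (z.2 + -1 * z.1)
        * charBound 1 q.ψ q.F (z.2 + 1 * z.1) with hG3
  have hA := ae_prod_of_ae_characteristic (-1) (ae_enorm_charDeriv_sub_le (σ := -1) (χ := p.φ)
    (χ' := q.φ) (by simp) hp.F_int hq.F_int)
  have hB := ae_prod_of_ae_characteristic 1 (ae_enorm_charDeriv_sub_le (σ := 1) (χ := p.ψ)
    (χ' := q.ψ) (by simp) hp.F_int hq.F_int)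
  have two_mul_inv : (2 : ℝ≥0∞) * 2⁻¹ = 1 :=
    ENNReal.mul_inv_cancel two_ne_zero ENNReal.ofNat_ne_top
  calc ∫⁻ z in K, ‖rhs Γ P f (p.triple c) z - rhs Γ P f' (q.triple c) z‖ₑ
      ≤ ∫⁻ z in K, (4 * g * (G1 z + G2 z) + L * (p - q).size * (4 * G3 z + ‖f' z‖ₑ)
        + g * ‖f z - f' z‖ₑ) := by
        refine lintegral_mono_ae (ae_restrict_of_ae ?_)
        filter_upwards [hA, hB] with z hA hB
        refine (enorm_nonlin_sub_le hΓ hP hΓL hPL _ _ _ _ _ _ _ _).trans ?_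
        simp only [hG1, hG2, hG3]
        gcongr
        · exact hA z rfl
        · exact enorm_charDeriv_le (by simp) _ _ z
        · exact enorm_charDeriv_le (by simp) _ _ z
        · exact hB z rfl
        · exact enorm_dAlembert_sub_le hp hq z
        · exact enorm_charDeriv_le (by simp) _ _ z
        · exact enorm_charDeriv_le (by simp) _ _ z
    _ = 4 * g * ((∫⁻ z in K, G1 z) + ∫⁻ z in K, G2 z)
        + L * (p - q).size * (4 * (∫⁻ z in K, G3 z) + ∫⁻ z in K, ‖f' z‖ₑ)
        + g * ∫⁻ z in K, ‖f z - f' z‖ₑ := by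
        have a1 : AEMeasurable (fun z => 4 * G3 z + ‖f' z‖ₑ) (volume.restrict K) :=
          (m3.const_mul 4).aemeasurable.add hf'.enorm
        have m4 : Measurable fun z => G1 z + G2 z := m1.add m2
        have a2 : AEMeasurable (fun z => 4 * g * (G1 z + G2 z)
            + L * (p - q).size * (4 * G3 z + ‖f' z‖ₑ)) (volume.restrict K) :=
          (m4.const_mul _).aemeasurable.add (a1.const_mul _)
        rw [lintegral_add_left' a2, lintegral_add_left (m4.const_mul _), lintegral_const_mul _ m4,
          lintegral_add_left m1, lintegral_const_mul'' _ a1, lintegral_add_left (m3.const_mul _),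
          lintegral_const_mul _ m3, lintegral_const_mul' _ _ (by simp)]
    _ ≤ 4 * g * (2⁻¹ * ((p - q).sizeLeft * p.sizeRight)
          + 2⁻¹ * (q.sizeLeft * (p - q).sizeRight))
        + L * (p - q).size * (4 * (2⁻¹ * (q.sizeLeft * q.sizeRight)) + ∫⁻ z in K, ‖f' z‖ₑ)
        + g * ∫⁻ z in K, ‖f z - f' z‖ₑ := by
        rw [← lintegral_charBound_mul hpq hp, ← lintegral_charBound_mul hq hpq,
          ← lintegral_charBound_mul hq hq]
        gcongr <;> exact Measure.restrict_le_self
    _ = 2 * g * ((2 * 2⁻¹) * ((p - q).sizeLeft * p.sizeRight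
          + q.sizeLeft * (p - q).sizeRight))
        + L * (p - q).size * (2 * ((2 * 2⁻¹) * (q.sizeLeft * q.sizeRight)) + ∫⁻ z in K, ‖f' z‖ₑ)
        + g * ∫⁻ z in K, ‖f z - f' z‖ₑ := by
        rw [show (4 : ℝ≥0∞) = 2 * 2 by norm_num]; ring
    _ = _ := by rw [two_mul_inv, one_mul, one_mul]

/-- Each of `∂_x u` and `∂_t u` is a combination of both characteristic derivatives, hence the
factor `2`. -/
theorem lintegral_slice_triple_sub_le (hp : p.Regular K) (hq : q.Regular K) (t : ℝ) :
    ∫⁻ x, (‖(p.triple c).ux (t, x) - (q.triple c).ux (t, x)‖ₑ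
        + ‖(p.triple c).ut (t, x) - (q.triple c).ut (t, x)‖ₑ)
      ≤ 2 * ((p - q).sizeLeft + (p - q).sizeRight) := by
  have hpq := hp.sub hq
  have hA := ae_slice_of_ae_characteristic (-1) t (ae_enorm_charDeriv_sub_le (σ := -1) (χ := p.φ)
    (χ' := q.φ) (by simp) hp.F_int hq.F_int)
  have hB := ae_slice_of_ae_characteristic 1 t (ae_enorm_charDeriv_sub_le (σ := 1) (χ := p.ψ)
    (χ' := q.ψ) (by simp) hp.F_int hq.F_int)
  have mA : Measurable fun x => charBound (-1) (p - q).φ (p - q).F (x + -1 * t) :=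
    (measurable_charBound hpq.φ_meas hpq.F_meas).comp (by fun_prop)
  have mB : Measurable fun x => charBound 1 (p - q).ψ (p - q).F (x + 1 * t) :=
    (measurable_charBound hpq.ψ_meas hpq.F_meas).comp (by fun_prop)
  calc _ ≤ ∫⁻ x, 2 * (charBound (-1) (p - q).φ (p - q).F (x + -1 * t)
        + charBound 1 (p - q).ψ (p - q).F (x + 1 * t)) := by
        refine lintegral_mono_ae ?_
        filter_upwards [hA, hB] with x hA hB
        rw [two_mul]
        refine add_le_add ?_ ?_
        · simp only [Profile.triple]
          rw [add_sub_add_comm]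
          exact (enorm_add_le _ _).trans (add_le_add (hA (t, x) rfl) (hB (t, x) rfl))
        · simp only [Profile.triple]
          rw [sub_sub_sub_comm, add_comm (charBound _ _ _ _)]
          exact enorm_sub_le.trans (add_le_add (hB (t, x) rfl) (hA (t, x) rfl))
    _ = _ := by
        have m4 : Measurable fun x => charBound (-1) (p - q).φ (p - q).F (x + -1 * t)
          + charBound 1 (p - q).ψ (p - q).F (x + 1 * t) := mA.add mB
        rw [lintegral_const_mul _ m4, lintegral_add_left mA,
          lintegral_slice_charBound hpq.φ_meas hpq.F_meas,
          lintegral_slice_charBound hpq.ψ_meas hpq.F_meas]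
        rfl

end

/-! ### Profiles attached to initial data. -/

section

variable {n : ℕ} {K : Set (ℝ × ℝ)} {p q : Profile n} {c : ℝ} {d d' : Data n}

/-- The profile `p` has the initial values of `d`. -/
structure Profile.HasData (K : Set (ℝ × ℝ)) (c : ℝ) (p : Profile n) (d : Data n) : Prop where
  κ_eq : p.κ = d.u₀ c
  φ_eq : p.φ =ᵐ[volume] (base K).indicator fun y => (1 / 2 : ℝ) • (d.Du₀ y - d.v₀ y)
  ψ_eq : p.ψ =ᵐ[volume] (base K).indicator fun y => (1 / 2 : ℝ) • (d.Du₀ y + d.v₀ y)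

theorem IsTrapezoid.measurableSet_base (hK : IsTrapezoid K) : MeasurableSet (base K) :=
  hK.measurableSet_slice 0

/-- `φ` and `ψ` are chosen before the source `F`, so that all iterates of the fixed point map share
the same initial profile. -/
theorem Data.Admissible.exists_profile (hK : IsTrapezoid K) (hd : d.Admissible K) (c : ℝ) :
    ∃ φ ψ : ℝ → Vec n, ∀ F : ℝ × ℝ → Vec n, StronglyMeasurable F → Integrable F →
      (∀ z, z ∉ K → F z = 0) →
      (⟨d.u₀ c, φ, ψ, F⟩ : Profile n).Regular K ∧ (⟨d.u₀ c, φ, ψ, F⟩ : Profile n).HasData K c d := by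
  have h1 : Integrable ((base K).indicator fun y => (1 / 2 : ℝ) • (d.Du₀ y - d.v₀ y)) :=
    (integrable_indicator_iff hK.measurableSet_base).2
      ((hd.integrable_Du₀.sub hd.integrable_v₀).smul (1 / 2 : ℝ))
  have h2 : Integrable ((base K).indicator fun y => (1 / 2 : ℝ) • (d.Du₀ y + d.v₀ y)) :=
    (integrable_indicator_iff hK.measurableSet_base).2
      ((hd.integrable_Du₀.add hd.integrable_v₀).smul (1 / 2 : ℝ))
  refine ⟨h1.1.mk _, h2.1.mk _, fun F hF hFi hF0 => ⟨⟨h1.1.stronglyMeasurable_mk,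
    h2.1.stronglyMeasurable_mk, hF, h1.congr h1.1.ae_eq_mk, h2.congr h2.1.ae_eq_mk, hFi, hF0⟩,
    ⟨rfl, h1.1.ae_eq_mk.symm, h2.1.ae_eq_mk.symm⟩⟩⟩

theorem enorm_half_smul (v : Vec n) : ‖(1 / 2 : ℝ) • v‖ₑ = 2⁻¹ * ‖v‖ₑ := by
  rw [enorm_smul, Real.enorm_eq_ofReal_abs, abs_of_pos (by norm_num), one_div,
    ENNReal.ofReal_inv_of_pos two_pos, ENNReal.ofReal_ofNat]

theorem lintegral_eq_half_of_ae_eq_indicator (hK : IsTrapezoid K) {χ : ℝ → Vec n} {w : ℝ → Vec n}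
    (h : χ =ᵐ[volume] (base K).indicator fun y => (1 / 2 : ℝ) • w y) :
    ∫⁻ y, ‖χ y‖ₑ = 2⁻¹ * eLpNorm w 1 (volume.restrict (base K)) := by
  have : ∫⁻ y, ‖χ y‖ₑ = ∫⁻ y, (base K).indicator (fun y => 2⁻¹ * ‖w y‖ₑ) y := by
    refine lintegral_congr_ae ?_
    filter_upwards [h] with y hy
    rw [hy, enorm_indicator_eq_indicator_enorm]
    simp only [enorm_half_smul]
  rw [this, lintegral_indicator hK.measurableSet_base, lintegral_const_mul' _ _ (by simp),
    eLpNorm_one_eq_lintegral_enorm]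

theorem Profile.HasData.lintegral_φ (hK : IsTrapezoid K) (h : p.HasData K c d) :
    ∫⁻ y, ‖p.φ y‖ₑ = 2⁻¹ * eLpNorm (d.Du₀ - d.v₀) 1 (volume.restrict (base K)) :=
  lintegral_eq_half_of_ae_eq_indicator hK h.φ_eq

theorem Profile.HasData.lintegral_ψ (hK : IsTrapezoid K) (h : p.HasData K c d) :
    ∫⁻ y, ‖p.ψ y‖ₑ = 2⁻¹ * eLpNorm (d.Du₀ + d.v₀) 1 (volume.restrict (base K)) :=
  lintegral_eq_half_of_ae_eq_indicator hK h.ψ_eq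

theorem Profile.HasData.lintegral_φ_sub (hK : IsTrapezoid K) (h : p.HasData K c d)
    (h' : q.HasData K c d') :
    ∫⁻ y, ‖(p - q).φ y‖ₑ = 2⁻¹ * eLpNorm ((d.Du₀ - d'.Du₀) - (d.v₀ - d'.v₀)) 1
      (volume.restrict (base K)) := by
  refine lintegral_eq_half_of_ae_eq_indicator hK ?_
  filter_upwards [h.φ_eq, h'.φ_eq] with y h1 h2
  show p.φ y - q.φ y = _
  rw [h1, h2]
  by_cases hy : y ∈ base K
  · simp only [indicator_of_mem hy, Pi.sub_apply]; module
  · simp only [indicator_of_notMem hy, sub_zero]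

theorem Profile.HasData.lintegral_ψ_sub (hK : IsTrapezoid K) (h : p.HasData K c d)
    (h' : q.HasData K c d') :
    ∫⁻ y, ‖(p - q).ψ y‖ₑ = 2⁻¹ * eLpNorm ((d.Du₀ - d'.Du₀) + (d.v₀ - d'.v₀)) 1
      (volume.restrict (base K)) := by
  refine lintegral_eq_half_of_ae_eq_indicator hK ?_
  filter_upwards [h.ψ_eq, h'.ψ_eq] with y h1 h2
  show p.ψ y - q.ψ y = _
  rw [h1, h2]
  by_cases hy : y ∈ base K
  · simp only [indicator_of_mem hy, Pi.sub_apply, Pi.add_apply]; module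
  · simp only [indicator_of_notMem hy, sub_zero]

/-- At interior points the values of a continuous function are bounded by its essential
supremum. -/
theorem enorm_le_eLpNorm_top_of_mem_interior {I : Set ℝ} (hI : MeasurableSet I) {w : ℝ → Vec n}
    (hw : ContinuousOn w I) {c : ℝ} (hc : c ∈ interior I) :
    ‖w c‖ₑ ≤ eLpNorm w ⊤ (volume.restrict I) := by
  by_contra! hlt
  have hcont : ContinuousAt w c := hw.continuousAt (mem_interior_iff_mem_nhds.1 hc)
  have h1 : ∀ᶠ x in 𝓝 c, eLpNorm w ⊤ (volume.restrict I) < ‖w x‖ₑ :=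
    hcont.enorm.tendsto.eventually (lt_mem_nhds hlt)
  have h2 : ∀ᵐ x, x ∈ I → ‖w x‖ₑ ≤ eLpNorm w ⊤ (volume.restrict I) := by
    rw [eLpNorm_exponent_top]
    exact (ae_restrict_iff' hI).1 ae_le_eLpNormEssSup
  obtain ⟨x, hx, hx1, hx2⟩ := (Measure.dense_of_ae h2).inter_nhds_nonempty
    (h1.and (mem_interior_iff_mem_nhds.1 hc))
  exact absurd (hx hx2) (not_le.2 hx1)

theorem Profile.HasData.size_sub_le (hK : IsTrapezoid K) (hc : c ∈ interior (base K))
    (hd : d.Admissible K) (hd' : d'.Admissible K) (h : p.HasData K c d) (h' : q.HasData K c d') :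
    (p - q).size ≤ d.dist K d' + 2⁻¹ * ∫⁻ z, ‖(p - q).F z‖ₑ := by
  have i1 := (hd.integrable_Du₀.sub hd'.integrable_Du₀).aestronglyMeasurable
  have i2 := (hd.integrable_v₀.sub hd'.integrable_v₀).aestronglyMeasurable
  have e1 : ‖(p - q).κ‖ₑ ≤ eLpNorm (d.u₀ - d'.u₀) ⊤ (volume.restrict (base K)) := by
    show ‖p.κ - q.κ‖ₑ ≤ _
    rw [h.κ_eq, h'.κ_eq]
    exact enorm_le_eLpNorm_top_of_mem_interior hK.measurableSet_base
      (hd.continuousOn.sub hd'.continuousOn) hc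
  -- `φ` and `ψ` are half the difference and half the sum of `Du₀` and `v₀`; the two triangle
  -- inequalities, each with weight `½`, add up to constant one.
  have e2 : (∫⁻ y, ‖(p - q).φ y‖ₑ) + ∫⁻ y, ‖(p - q).ψ y‖ₑ
      ≤ eLpNorm (d.Du₀ - d'.Du₀) 1 (volume.restrict (base K))
        + eLpNorm (d.v₀ - d'.v₀) 1 (volume.restrict (base K)) := by
    rw [h.lintegral_φ_sub hK h', h.lintegral_ψ_sub hK h']
    have a1 := eLpNorm_sub_le i1 i2 le_rfl
    have a2 := eLpNorm_add_le i1 i2 le_rfl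
    refine (add_le_add (mul_le_mul_right a1 2⁻¹) (mul_le_mul_right a2 2⁻¹)).trans_eq ?_
    rw [← add_mul, ENNReal.inv_two_add_inv_two, one_mul]
  simp only [Profile.size, Data.dist]
  refine add_le_add ?_ le_rfl
  rw [add_assoc (‖(p - q).κ‖ₑ)]
  refine (add_le_add e1 e2).trans ?_
  rw [← add_assoc]
  exact le_self_add

theorem Profile.sizeLeft_le_size (p : Profile n) : p.sizeLeft ≤ p.size := by
  unfold Profile.sizeLeft Profile.size
  gcongr
  exact le_add_right le_add_self

theorem Profile.sizeRight_le_size (p : Profile n) : p.sizeRight ≤ p.size := by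
  unfold Profile.sizeRight Profile.size
  gcongr
  exact le_add_self

theorem integral_eq_of_ae_mem {I : Set ℝ} (hI : I.OrdConnected) {v w : ℝ → Vec n}
    (h : ∀ᵐ y, y ∈ I → v y = w y) {a b : ℝ} (ha : a ∈ I) (hb : b ∈ I) :
    ∫ y in a..b, v y = ∫ y in a..b, w y := by
  refine intervalIntegral.integral_congr_ae ?_
  filter_upwards [h] with y hy hy'
  exact hy (hI.uIcc_subset ha hb (uIoc_subset_uIcc hy'))

/-- The weak derivative of `u₀` integrates back to `u₀`, which makes the base point `c` cancel. `G`
need only agree with the source almost everywhere on `K`, because the backward triangle stays in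
`K`; it is applied to the right-hand side of the constructed function and to that of a given mild
solution. -/
theorem Profile.HasData.dAlembert_eq (hK : IsTrapezoid K) (hc : c ∈ base K) (hd : d.Admissible K)
    (h : p.HasData K c d) {G : ℝ × ℝ → Vec n} (hG : ∀ᵐ z, z ∈ K → p.F z = G z) {t x : ℝ}
    (hz : (t, x) ∈ K) :
    (p.triple c).u (t, x) = (1 / 2 : ℝ) • (d.u₀ (x + t) + d.u₀ (x - t))
      + (1 / 2 : ℝ) • (∫ y in (x - t)..(x + t), d.v₀ y)
      + (1 / 2 : ℝ) • (∫ τ in (0 : ℝ)..t, ∫ y in (x - t + τ)..(x + t - τ), G (τ, y)) := by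
  have ht : 0 ≤ t := hK.time_nonneg _ hz
  have hp : x + t ∈ base K := hK.mem_of_abs_sub_le hz le_rfl (by simp [abs_of_nonneg ht])
  have hm : x - t ∈ base K := hK.mem_of_abs_sub_le hz le_rfl (by simp [abs_of_nonneg ht])
  have hcv : Convex ℝ (base K) := hK.convex_slice 0
  have ho := hcv.ordConnected
  have hDi : ∀ {a b}, a ∈ base K → b ∈ base K → IntervalIntegrable d.Du₀ volume a b :=
    fun ha hb => (hd.integrable_Du₀.mono_set (ho.uIcc_subset ha hb)).intervalIntegrable
  have hvi : ∀ {a b}, a ∈ base K → b ∈ base K → IntervalIntegrable d.v₀ volume a b :=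
    fun ha hb => (hd.integrable_v₀.mono_set (ho.uIcc_subset ha hb)).intervalIntegrable
  have hu : ∀ {a b}, a ∈ base K → b ∈ base K → d.u₀ b - d.u₀ a = ∫ y in a..b, d.Du₀ y :=
    fun ha hb => hd.weakDeriv.sub_eq_integral hcv hK.nonempty_interior_base
      hd.continuousOn hd.integrable_Du₀ ha hb
  have e1 : ∫ y in c..(x - t), p.φ y
      = (1 / 2 : ℝ) • ((d.u₀ (x - t) - d.u₀ c) - ∫ y in c..(x - t), d.v₀ y) := by
    rw [hu hc hm, ← intervalIntegral.integral_sub (hDi hc hm) (hvi hc hm),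
      ← intervalIntegral.integral_smul]
    refine integral_eq_of_ae_mem ho ?_ hc hm
    filter_upwards [h.φ_eq] with y hy hy'
    rw [hy, indicator_of_mem hy']
  have e2 : ∫ y in c..(x + t), p.ψ y
      = (1 / 2 : ℝ) • ((d.u₀ (x + t) - d.u₀ c) + ∫ y in c..(x + t), d.v₀ y) := by
    rw [hu hc hp, ← intervalIntegral.integral_add (hDi hc hp) (hvi hc hp),
      ← intervalIntegral.integral_smul]
    refine integral_eq_of_ae_mem ho ?_ hc hp
    filter_upwards [h.ψ_eq] with y hy hy'
    rw [hy, indicator_of_mem hy']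
  have e3 : ∫ y in (x - t)..(x + t), d.v₀ y
      = (∫ y in c..(x + t), d.v₀ y) - ∫ y in c..(x - t), d.v₀ y :=
    (intervalIntegral.integral_interval_sub_left (hvi hc hp) (hvi hc hm)).symm
  have e4 : ∫ τ in (0 : ℝ)..t, ∫ y in (x - t + τ)..(x + t - τ), p.F (τ, y)
      = ∫ τ in (0 : ℝ)..t, ∫ y in (x - t + τ)..(x + t - τ), G (τ, y) := by
    refine intervalIntegral.integral_congr_ae ?_
    filter_upwards [Measure.ae_ae_of_ae_prod hG] with τ hτ hτ'
    rw [uIoc_of_le ht] at hτ'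
    refine intervalIntegral.integral_congr_ae ?_
    filter_upwards [hτ] with y hy hy'
    rw [uIoc_of_le (by linarith [hτ'.2])] at hy'
    refine hy (hK.mem_of_abs_sub_le hz hτ'.1.le ?_)
    rw [abs_le]
    constructor <;> linarith [hy'.1, hy'.2]
  simp only [Profile.triple, dAlembert]
  rw [e1, e2, e3, e4, h.κ_eq]
  module

end

/-! ### Comparison of two fixed points and of two solutions. -/

section

variable {n : ℕ} {K : Set (ℝ × ℝ)} {p q : Profile n} {c : ℝ} {d d' : Data n}
  {Γ : Fin n → Fin n → Vec n → Vec n} {P : Vec n → Vec n →L[ℝ] Vec n} {g L : ℝ≥0}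

/-- The right-hand side of the equation, evaluated at the function with profile `p`, is `p.F`. -/
def Profile.Solves (K : Set (ℝ × ℝ)) (c : ℝ) (Γ : Fin n → Fin n → Vec n → Vec n)
    (P : Vec n → Vec n →L[ℝ] Vec n) (p : Profile n) (f : ℝ × ℝ → Vec n) : Prop :=
  ∀ᵐ z, z ∈ K → p.F z = rhs Γ P f (p.triple c) z

/-- Smallness makes the Lipschitz constant with respect to `size` equal to one. This suffices,
because `size` counts only half the norm of the source: the gain `½` comes from d'Alembert's
formula. -/
theorem lintegral_rhs_sub_le_size (hΓ : ∀ j k y, ‖Γ j k y‖ ≤ g) (hP : ∀ y, ‖P y‖ ≤ g)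
    (hΓL : ∀ j k, LipschitzWith L (Γ j k)) (hPL : LipschitzWith L P) (hp : p.Regular K)
    (hq : q.Regular K) {f f' : ℝ × ℝ → Vec n} (hf' : AEStronglyMeasurable f' (volume.restrict K))
    {M η : ℝ≥0∞} (h1 : p.sizeRight ≤ M) (h2 : q.sizeLeft ≤ M) (h3 : q.sizeRight ≤ M)
    (h4 : ∫⁻ z in K, ‖f' z‖ₑ ≤ η) (hM : 4 * g * M + L * (2 * M ^ 2 + η) ≤ 1) :
    ∫⁻ z in K, ‖rhs Γ P f (p.triple c) z - rhs Γ P f' (q.triple c) z‖ₑ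
      ≤ (p - q).size + g * ∫⁻ z in K, ‖f z - f' z‖ₑ := by
  refine (lintegral_rhs_sub_le hΓ hP hΓL hPL hp hq hf').trans ?_
  gcongr
  calc _ ≤ 2 * g * ((p - q).size * M + M * (p - q).size)
        + L * (p - q).size * (2 * (M * M) + η) := by
        gcongr
        · exact (p - q).sizeLeft_le_size
        · exact (p - q).sizeRight_le_size
    _ = (4 * g * M + L * (2 * M ^ 2 + η)) * (p - q).size := by ring
    _ ≤ 1 * (p - q).size := by gcongr
    _ = _ := one_mul _

theorem Profile.Regular.lintegral_F (hK : IsTrapezoid K) (hp : p.Regular K) :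
    ∫⁻ z, ‖p.F z‖ₑ = ∫⁻ z in K, ‖p.F z‖ₑ := by
  rw [← lintegral_indicator hK.measurableSet]
  refine lintegral_congr fun z => ?_
  by_cases hz : z ∈ K
  · rw [indicator_of_mem hz]
  · rw [indicator_of_notMem hz, hp.F_zero z hz, enorm_zero]

theorem le_two_mul_of_le_add_half {x a : ℝ≥0∞} (hx : x ≠ ⊤) (h : x ≤ a + 2⁻¹ * x) :
    x ≤ 2 * a := by
  have h2 : 2⁻¹ * x ≠ ⊤ := ENNReal.mul_ne_top (by simp) hx
  have h3 : 2⁻¹ * x + 2⁻¹ * x = x := by rw [← add_mul, ENNReal.inv_two_add_inv_two, one_mul]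
  have h4 : 2⁻¹ * x ≤ a := by
    rw [← ENNReal.add_le_add_iff_right h2, h3]
    exact h
  calc x = 2⁻¹ * x + 2⁻¹ * x := h3.symm
    _ ≤ a + a := add_le_add h4 h4
    _ = 2 * a := (two_mul a).symm

/-- The source difference is at most `1 + g` times the data distance plus half of itself. The last
term is finite and can be absorbed, giving `2 (1 + g)`; together with the direct data term this is
`2 + g`. -/
theorem Profile.Solves.size_sub_le (hK : IsTrapezoid K) (hc : c ∈ interior (base K))
    (hΓ : ∀ j k y, ‖Γ j k y‖ ≤ g) (hP : ∀ y, ‖P y‖ ≤ g)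
    (hΓL : ∀ j k, LipschitzWith L (Γ j k)) (hPL : LipschitzWith L P) (hp : p.Regular K)
    (hq : q.Regular K) (hd : d.Admissible K) (hd' : d'.Admissible K) (hpd : p.HasData K c d)
    (hqd : q.HasData K c d') (hps : p.Solves K c Γ P d.f) (hqs : q.Solves K c Γ P d'.f)
    {M η : ℝ≥0∞} (h1 : p.sizeRight ≤ M) (h2 : q.sizeLeft ≤ M) (h3 : q.sizeRight ≤ M)
    (h4 : eLpNorm d'.f 1 (volume.restrict K) ≤ η) (hM : 4 * g * M + L * (2 * M ^ 2 + η) ≤ 1) :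
    (p - q).size ≤ (2 + g) * d.dist K d' := by
  have hs := hpd.size_sub_le hK hc hd hd' hqd
  have hpq := hp.sub hq
  have hf : ∫⁻ z in K, ‖d.f z - d'.f z‖ₑ ≤ d.dist K d' := by
    have : ∫⁻ z in K, ‖d.f z - d'.f z‖ₑ = eLpNorm (d.f - d'.f) 1 (volume.restrict K) :=
      eLpNorm_one_eq_lintegral_enorm.symm
    rw [this]
    exact le_add_self
  have hF : ∫⁻ z, ‖(p - q).F z‖ₑ
      ≤ ((1 + g) * d.dist K d') + 2⁻¹ * ∫⁻ z, ‖(p - q).F z‖ₑ := by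
    calc ∫⁻ z, ‖(p - q).F z‖ₑ = ∫⁻ z in K, ‖(p - q).F z‖ₑ := hpq.lintegral_F hK
      _ = ∫⁻ z in K, ‖rhs Γ P d.f (p.triple c) z - rhs Γ P d'.f (q.triple c) z‖ₑ := by
        refine setLIntegral_congr_fun_ae hK.measurableSet ?_
        filter_upwards [hps, hqs] with z hz1 hz2 hz
        rw [← hz1 hz, ← hz2 hz]
        rfl
      _ ≤ (p - q).size + g * ∫⁻ z in K, ‖d.f z - d'.f z‖ₑ :=
        lintegral_rhs_sub_le_size hΓ hP hΓL hPL hp hq hd'.integrable_f.aestronglyMeasurable h1 h2 h3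
          (by rwa [← eLpNorm_one_eq_lintegral_enorm]) hM
      _ ≤ (d.dist K d' + 2⁻¹ * ∫⁻ z, ‖(p - q).F z‖ₑ) + g * d.dist K d' := by gcongr
      _ = _ := by ring
  have hF' := le_two_mul_of_le_add_half hpq.F_int.2.ne hF
  calc (p - q).size ≤ d.dist K d' + 2⁻¹ * (2 * ((1 + g) * d.dist K d')) := hs.trans (by gcongr)
    _ = d.dist K d' + (1 + g) * d.dist K d' := by
      rw [← mul_assoc, ENNReal.inv_mul_cancel two_ne_zero ENNReal.ofNat_ne_top, one_mul]
    _ = _ := by rw [show (2 : ℝ≥0∞) = 1 + 1 by norm_num]; ring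

/-- A mild solution with integrable right-hand side is given by d'Alembert's formula. -/
theorem IsMildSolution.exists_profile (hK : IsTrapezoid K) (hc : c ∈ base K) (hd : d.Admissible K)
    {U : Triple n} (hU : IsMildSolution K Γ P d U)
    (hfin : eLpNorm (rhs Γ P d.f U) 1 (volume.restrict K) ≠ ⊤) :
    ∃ p : Profile n, p.Regular K ∧ p.HasData K c d ∧ p.Solves K c Γ P d.f ∧
      EqOn U.u (p.triple c).u K ∧ (∀ᵐ z, z ∈ K → U.ut z = (p.triple c).ut z) ∧
      (∀ᵐ z, z ∈ K → U.ux z = (p.triple c).ux z) ∧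
      ∫⁻ z, ‖p.F z‖ₑ = eLpNorm (rhs Γ P d.f U) 1 (volume.restrict K) := by
  have hm : AEStronglyMeasurable (rhs Γ P d.f U) (volume.restrict K) :=
    hU.locInt_rhs.aestronglyMeasurable
  have hi : IntegrableOn (rhs Γ P d.f U) K :=
    ⟨hm, by rw [HasFiniteIntegral, ← eLpNorm_one_eq_lintegral_enorm]; exact hfin.lt_top⟩
  obtain ⟨φ, ψ, h⟩ := hd.exists_profile hK c
  -- The source of the profile is the right-hand side of `U` itself, in a strongly measurable
  -- version extended by zero.
  obtain ⟨hp, hpd⟩ := h (K.indicator (hm.mk _))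
    (hm.stronglyMeasurable_mk.indicator hK.measurableSet)
    ((integrable_indicator_iff hK.measurableSet).2 (hi.congr hm.ae_eq_mk))
    (fun z hz => indicator_of_notMem hz _)
  set p : Profile n := ⟨d.u₀ c, φ, ψ, K.indicator (hm.mk _)⟩
  have hF : ∀ᵐ z, z ∈ K → p.F z = rhs Γ P d.f U z := by
    filter_upwards [(ae_restrict_iff' hK.measurableSet).1 hm.ae_eq_mk] with z hz hzK
    rw [hz hzK]
    exact indicator_of_mem hzK _
  have hu : EqOn U.u (p.triple c).u K := fun z hz => by
    rw [hU.eq_mild z.1 z.2 hz, hpd.dAlembert_eq hK hc hd hF hz]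
  -- The mild formula identifies only the functions; uniqueness of weak derivatives identifies the
  -- derivatives almost everywhere, so the source is also the right-hand side evaluated at the
  -- d'Alembert triple.
  obtain ⟨ht, hx⟩ := hU.weakPartials.ae_eq hK (hp.hasWeakPartials (c := c) hK) hu
  refine ⟨p, hp, hpd, ?_, hu, ht, hx, ?_⟩
  · filter_upwards [hF, ht, hx] with z h1 h2 h3 hz
    rw [h1 hz]
    simp only [rhs, h2 hz, h3 hz, hu hz]
  · rw [hp.lintegral_F hK, eLpNorm_one_eq_lintegral_enorm]
    refine setLIntegral_congr_fun_ae hK.measurableSet ?_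
    filter_upwards [hF] with z h1 hz
    rw [h1 hz]

theorem setLIntegral_slice_eq (hK : IsTrapezoid K) (v w : ℝ × ℝ → Vec n) (t : ℝ) :
    ∫⁻ x in slice K t, (‖v (t, x)‖ₑ + ‖w (t, x)‖ₑ)
      = ∫⁻ x in base K, (‖K.indicator v (t, x)‖ₑ + ‖K.indicator w (t, x)‖ₑ) := by
  have : ∀ x, ‖K.indicator v (t, x)‖ₑ + ‖K.indicator w (t, x)‖ₑ
      = (slice K t).indicator (fun x => ‖v (t, x)‖ₑ + ‖w (t, x)‖ₑ) x := fun x => by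
    by_cases hx : (t, x) ∈ K
    · rw [indicator_of_mem hx, indicator_of_mem hx, indicator_of_mem (show x ∈ slice K t from hx)]
    · rw [indicator_of_notMem hx, indicator_of_notMem hx,
        indicator_of_notMem (show x ∉ slice K t from hx)]
      simp
  simp only [this]
  rw [setLIntegral_indicator (hK.measurableSet_slice t),
    inter_eq_left.2 (hK.slice_subset_base t)]

/-- A bound for the slices that holds at almost all times holds at all times. -/
theorem IsCbL1.forall_le_of_ae_le (hK : IsTrapezoid K) {v w : ℝ × ℝ → Vec n} (hv : IsCbL1 K v)
    (hw : IsCbL1 K w) {C : ℝ≥0∞}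
    (h : ∀ᵐ t, t ∈ timeSet K → ∫⁻ x in slice K t, (‖v (t, x)‖ₑ + ‖w (t, x)‖ₑ) ≤ C) {t : ℝ}
    (ht : t ∈ timeSet K) : ∫⁻ x in slice K t, (‖v (t, x)‖ₑ + ‖w (t, x)‖ₑ) ≤ C := by
  have hlim := ((hv.continuous t ht).add (hw.continuous t ht)).const_add C
  rw [add_zero, add_zero] at hlim
  have hfreq : ∃ᶠ s in 𝓝[timeSet K] t, s ∈ timeSet K ∧
      ∫⁻ x in slice K s, (‖v (s, x)‖ₑ + ‖w (s, x)‖ₑ) ≤ C := by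
    rw [Filter.Frequently, eventually_nhdsWithin_iff]
    intro hev
    obtain ⟨V, hV, hVo, htV⟩ := eventually_nhds_iff.1 hev
    -- The good times are dense in the interior, and the interior is dense in the convex set
    -- `timeSet K`; so good times accumulate at `t` even if it is an end point.
    have hcl : t ∈ closure (interior (timeSet K)) := by
      rw [hK.convex_timeSet.closure_interior_eq_closure_of_nonempty_interior
        hK.nonempty_interior_timeSet]
      exact subset_closure ht
    obtain ⟨s, hsV, hsi⟩ := mem_closure_iff.1 hcl V hVo htV
    obtain ⟨r, hr, hr1, hr2⟩ := (Measure.dense_of_ae h).inter_nhds_nonempty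
      (Filter.inter_mem (hVo.mem_nhds hsV) (isOpen_interior.mem_nhds hsi))
    have hrT : r ∈ timeSet K := interior_subset hr2
    exact hV r hr1 hrT ⟨hrT, hr hrT⟩
  refine ge_of_tendsto_of_frequently hlim (hfreq.mono fun s hs => ?_)
  obtain ⟨hsT, hsC⟩ := hs
  rw [setLIntegral_slice_eq hK] at hsC ⊢
  have m1 : AEMeasurable (fun x => ‖K.indicator v (s, x) - K.indicator v (t, x)‖ₑ)
      (volume.restrict (base K)) :=
    ((hv.integrable_indicator hK hsT).sub (hv.integrable_indicator hK ht)).1.enorm.restrict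
  have m2 : AEMeasurable (fun x => ‖K.indicator v (s, x)‖ₑ + ‖K.indicator w (s, x)‖ₑ)
      (volume.restrict (base K)) :=
    ((hv.integrable_indicator hK hsT).1.enorm.add
      (hw.integrable_indicator hK hsT).1.enorm).restrict
  refine le_trans ?_ (add_le_add hsC le_rfl)
  rw [← lintegral_add_left' m1, ← lintegral_add_left' m2]
  refine lintegral_mono fun x => ?_
  have key : ∀ a b : Vec n, ‖a‖ₑ ≤ ‖b‖ₑ + ‖b - a‖ₑ := fun a b => by
    calc ‖a‖ₑ = ‖b - (b - a)‖ₑ := by rw [sub_sub_cancel]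
      _ ≤ _ := enorm_sub_le
  calc _ ≤ (‖K.indicator v (s, x)‖ₑ + ‖K.indicator v (s, x) - K.indicator v (t, x)‖ₑ)
      + (‖K.indicator w (s, x)‖ₑ + ‖K.indicator w (s, x) - K.indicator w (t, x)‖ₑ) :=
        add_le_add (key _ _) (key _ _)
    _ = _ := by ring

/-- The derivatives are known only almost everywhere in space-time, so their slices are controlled
at almost every time; continuity in `L¹` extends the bound to all times. The factor is `1` for the
functions plus `4` for the derivatives. -/
theorem distH_le_of_profile (hK : IsTrapezoid K) (hp : p.Regular K) (hq : q.Regular K)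
    {U U' : Triple n} (hU : MemH K U) (hU' : MemH K U') (hu : EqOn U.u (p.triple c).u K)
    (hu' : EqOn U'.u (q.triple c).u K)
    (ht : ∀ᵐ z, z ∈ K → U.ut z = (p.triple c).ut z)
    (hx : ∀ᵐ z, z ∈ K → U.ux z = (p.triple c).ux z)
    (ht' : ∀ᵐ z, z ∈ K → U'.ut z = (q.triple c).ut z)
    (hx' : ∀ᵐ z, z ∈ K → U'.ux z = (q.triple c).ux z) :
    distH K U U' ≤ 5 * (p - q).size := by
  have h1 : ⨆ z ∈ K, ‖U.u z - U'.u z‖ₑ ≤ (p - q).size := by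
    refine iSup₂_le fun z hz => ?_
    rw [hu hz, hu' hz]
    exact enorm_dAlembert_sub_le hp hq z
  have hae : ∀ᵐ t, t ∈ timeSet K → ∫⁻ x in slice K t, (‖U.ux (t, x) + -U'.ux (t, x)‖ₑ
      + ‖U.ut (t, x) + -U'.ut (t, x)‖ₑ) ≤ 4 * (p - q).size := by
    have hae : ∀ᵐ z, z ∈ K → U.ut z = (p.triple c).ut z ∧ U.ux z = (p.triple c).ux z ∧
        U'.ut z = (q.triple c).ut z ∧ U'.ux z = (q.triple c).ux z := by
      filter_upwards [ht, hx, ht', hx'] with z a1 a2 a3 a4 hz using ⟨a1 hz, a2 hz, a3 hz, a4 hz⟩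
    filter_upwards [Measure.ae_ae_of_ae_prod hae] with t ht _
    calc _ = ∫⁻ x in slice K t, (‖(p.triple c).ux (t, x) - (q.triple c).ux (t, x)‖ₑ
        + ‖(p.triple c).ut (t, x) - (q.triple c).ut (t, x)‖ₑ) := by
          refine setLIntegral_congr_fun_ae (hK.measurableSet_slice t) ?_
          filter_upwards [ht] with x hx hxs
          obtain ⟨a1, a2, a3, a4⟩ := hx hxs
          rw [a1, a2, a3, a4, sub_eq_add_neg, sub_eq_add_neg]
      _ ≤ 2 * ((p - q).sizeLeft + (p - q).sizeRight) :=
        (setLIntegral_le_lintegral _ _).trans (lintegral_slice_triple_sub_le hp hq t)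
      _ ≤ 2 * ((p - q).size + (p - q).size) := by
        gcongr
        · exact (p - q).sizeLeft_le_size
        · exact (p - q).sizeRight_le_size
      _ = _ := by ring
  have h2 : ⨆ t ∈ timeSet K, ∫⁻ x in slice K t,
      (‖U.ux (t, x) - U'.ux (t, x)‖ₑ + ‖U.ut (t, x) - U'.ut (t, x)‖ₑ) ≤ 4 * (p - q).size := by
    refine iSup₂_le fun t htT => ?_
    simp only [sub_eq_add_neg]
    exact IsCbL1.forall_le_of_ae_le hK (hU.ux_mem.add hK hU'.ux_mem.neg)
      (hU.ut_mem.add hK hU'.ut_mem.neg) hae htT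
  calc distH K U U' ≤ (p - q).size + 4 * (p - q).size := add_le_add h1 h2
    _ = _ := by ring

end

/-! ### The contraction, the solution map and the choice of constants. -/

section

variable {n : ℕ} {K : Set (ℝ × ℝ)} {p : Profile n} {c : ℝ} {d : Data n}
  {Γ : Fin n → Fin n → Vec n → Vec n} {P : Vec n → Vec n →L[ℝ] Vec n} {g L η R : ℝ≥0}

theorem aestronglyMeasurable_rhs {μ : Measure (ℝ × ℝ)} (hΓ : ∀ j k, Continuous (Γ j k))
    (hP : Continuous P) {f : ℝ × ℝ → Vec n} (hf : AEStronglyMeasurable f μ) {U : Triple n}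
    (hu : AEStronglyMeasurable U.u μ) (ht : AEStronglyMeasurable U.ut μ)
    (hx : AEStronglyMeasurable U.ux μ) : AEStronglyMeasurable (rhs Γ P f U) μ := by
  have hc : Continuous fun w : (Vec n × Vec n) × (Vec n × Vec n) =>
      (∑ j, ∑ k, (w.1.2 j * w.1.2 k - w.2.1 j * w.2.1 k) • Γ j k w.1.1) + P w.1.1 w.2.2 := by
    fun_prop
  exact hc.comp_aestronglyMeasurable (f := fun z => ((U.u z, U.ut z), (U.ux z, f z)))
    ((hu.prodMk ht).prodMk (hx.prodMk hf))

theorem Profile.Regular.aestronglyMeasurable_rhs (hK : IsTrapezoid K) (hp : p.Regular K)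
    (hΓ : ∀ j k, Continuous (Γ j k)) (hP : Continuous P) {f : ℝ × ℝ → Vec n}
    (hf : AEStronglyMeasurable f (volume.restrict K)) :
    AEStronglyMeasurable (rhs Γ P f (p.triple c)) (volume.restrict K) := by
  have hA := (stronglyMeasurable_charDeriv (σ := -1) hp.φ_meas hp.F_meas).aestronglyMeasurable
    (μ := volume.restrict K)
  have hB := (stronglyMeasurable_charDeriv (σ := 1) hp.ψ_meas hp.F_meas).aestronglyMeasurable
    (μ := volume.restrict K)
  exact WaveMap.aestronglyMeasurable_rhs hΓ hP hf (hp.continuous hK).aestronglyMeasurable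
    (hB.sub hA) (hA.add hB)

theorem Profile.Regular.size_ne_top (hp : p.Regular K) : p.size ≠ ⊤ := by
  simp only [Profile.size, ENNReal.add_ne_top]
  exact ⟨⟨⟨by simp, hp.φ_int.2.ne⟩, hp.ψ_int.2.ne⟩, ENNReal.mul_ne_top (by simp) hp.F_int.2.ne⟩

theorem Profile.HasData.sizeLeft_le (hK : IsTrapezoid K) (hd : d ∈ smallData K η)
    (hpd : p.HasData K c d) (hF : ∫⁻ z, ‖p.F z‖ₑ ≤ R) :
    p.sizeLeft ≤ ((η / 2 + R / 2 : ℝ≥0) : ℝ≥0∞) := by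
  have h1 := hd.2.2.1
  rw [ENNReal.ofReal_coe_nnreal] at h1
  simp only [Profile.sizeLeft, hpd.lintegral_φ hK]
  push_cast
  rw [div_eq_mul_inv, div_eq_mul_inv, mul_comm (η : ℝ≥0∞), mul_comm (R : ℝ≥0∞)]
  gcongr

theorem Profile.HasData.sizeRight_le (hK : IsTrapezoid K) (hd : d ∈ smallData K η)
    (hpd : p.HasData K c d) (hF : ∫⁻ z, ‖p.F z‖ₑ ≤ R) :
    p.sizeRight ≤ ((η / 2 + R / 2 : ℝ≥0) : ℝ≥0∞) := by
  have h1 := hd.2.1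
  rw [ENNReal.ofReal_coe_nnreal] at h1
  simp only [Profile.sizeRight, hpd.lintegral_ψ hK]
  push_cast
  rw [div_eq_mul_inv, div_eq_mul_inv, mul_comm (η : ℝ≥0∞), mul_comm (R : ℝ≥0∞)]
  gcongr

/-- This makes the ball of radius `R` invariant: both sizes are at most `η / 2 + R / 2`, and `hR`
closes the estimate. -/
theorem Profile.HasData.lintegral_rhs_le (hK : IsTrapezoid K) (hΓ : ∀ j k y, ‖Γ j k y‖ ≤ g)
    (hP : ∀ y, ‖P y‖ ≤ g) (hΓL : ∀ j k, LipschitzWith L (Γ j k)) (hPL : LipschitzWith L P)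
    (hR : 2 * g * (η / 2 + R / 2) ^ 2 + g * η ≤ R)
    (hd : d ∈ smallData K η) (hp : p.Regular K) (hpd : p.HasData K c d)
    (hF : ∫⁻ z, ‖p.F z‖ₑ ≤ R) : ∫⁻ z in K, ‖rhs Γ P d.f (p.triple c) z‖ₑ ≤ R := by
  have hf := hd.2.2.2
  rw [ENNReal.ofReal_coe_nnreal, eLpNorm_one_eq_lintegral_enorm] at hf
  calc _ ≤ 2 * g * (p.sizeLeft * p.sizeRight) + g * ∫⁻ z in K, ‖d.f z‖ₑ :=
        WaveMap.lintegral_rhs_le hΓ hP hΓL hPL hp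
    _ ≤ 2 * g * (((η / 2 + R / 2 : ℝ≥0) : ℝ≥0∞) * ((η / 2 + R / 2 : ℝ≥0) : ℝ≥0∞)) + g * η := by
        gcongr
        · exact hpd.sizeLeft_le hK hd hF
        · exact hpd.sizeRight_le hK hd hF
    _ = ((2 * g * (η / 2 + R / 2) ^ 2 + g * η : ℝ≥0) : ℝ≥0∞) := by
        rw [sq]
        simp only [ENNReal.coe_add, ENNReal.coe_mul, ENNReal.coe_ofNat]
    _ ≤ R := by exact_mod_cast hR

/-- The fixed point argument. -/
theorem exists_profile_solves (hK : IsTrapezoid K) (hΓ : ∀ j k y, ‖Γ j k y‖ ≤ g)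
    (hP : ∀ y, ‖P y‖ ≤ g) (hΓL : ∀ j k, LipschitzWith L (Γ j k)) (hPL : LipschitzWith L P)
    (hM : 4 * g * (η / 2 + R / 2) + L * (2 * (η / 2 + R / 2) ^ 2 + η) ≤ 1)
    (hR : 2 * g * (η / 2 + R / 2) ^ 2 + g * η ≤ R) (hd : d ∈ smallData K η) (c : ℝ) :
    ∃ p : Profile n, p.Regular K ∧ p.HasData K c d ∧ p.Solves K c Γ P d.f ∧
      ∫⁻ z, ‖p.F z‖ₑ ≤ R := by
  obtain ⟨φ, ψ, hφψ⟩ := hd.1.exists_profile hK c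
  set pr : Lp (Vec n) 1 (volume : Measure (ℝ × ℝ)) → Profile n :=
    fun F => ⟨d.u₀ c, φ, ψ, K.indicator F⟩ with hpr
  have hpr' : ∀ F, (pr F).Regular K ∧ (pr F).HasData K c d := fun F =>
    hφψ _ ((Lp.stronglyMeasurable F).indicator hK.measurableSet)
      ((memLp_one_iff_integrable.1 (Lp.memLp F)).indicator hK.measurableSet)
      fun z hz => indicator_of_notMem hz _
  have hprF : ∀ F G, ∫⁻ z, ‖(pr F - pr G).F z‖ₑ ≤ edist F G := fun F G => by
    rw [Lp.edist_def, eLpNorm_one_eq_lintegral_enorm]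
    refine lintegral_mono fun z => ?_
    show ‖K.indicator F z - K.indicator G z‖ₑ ≤ ‖F z - G z‖ₑ
    by_cases hz : z ∈ K
    · simp only [indicator_of_mem hz]; exact le_rfl
    · simp [indicator_of_notMem hz]
  have hprs : ∀ F ∈ Metric.closedBall (0 : Lp (Vec n) 1 (volume : Measure (ℝ × ℝ))) R,
      ∫⁻ z, ‖(pr F).F z‖ₑ ≤ R := fun F hF => by
    have h1 : eLpNorm F 1 volume ≤ R := by
      rw [← Lp.enorm_def]
      rw [mem_closedBall_zero_iff] at hF
      rw [enorm_eq_nnnorm]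
      exact_mod_cast hF
    refine le_trans ?_ h1
    rw [eLpNorm_one_eq_lintegral_enorm]
    exact lintegral_mono fun z => enorm_indicator_le_enorm_self _ _
  have hmeas : ∀ F, AEStronglyMeasurable (rhs Γ P d.f ((pr F).triple c)) (volume.restrict K) :=
    fun F => (hpr' F).1.aestronglyMeasurable_rhs hK (fun j k => (hΓL j k).continuous)
      hPL.continuous hd.1.integrable_f.aestronglyMeasurable
  have hmem : ∀ F, MemLp (K.indicator (rhs Γ P d.f ((pr F).triple c))) 1 volume := fun F => by
    rw [memLp_one_iff_integrable, integrable_indicator_iff hK.measurableSet]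
    refine ⟨hmeas F, (WaveMap.lintegral_rhs_le hΓ hP hΓL hPL (hpr' F).1).trans_lt ?_⟩
    have hs := (hpr' F).1.size_ne_top
    have hf : ∫⁻ z in K, ‖d.f z‖ₑ ≠ ⊤ := hd.1.integrable_f.2.ne
    exact (ENNReal.add_ne_top.2 ⟨ENNReal.mul_ne_top (by finiteness) (ENNReal.mul_ne_top
      (ne_top_of_le_ne_top hs (pr F).sizeLeft_le_size)
      (ne_top_of_le_ne_top hs (pr F).sizeRight_le_size)), ENNReal.mul_ne_top (by simp) hf⟩).lt_top
  set T : Lp (Vec n) 1 (volume : Measure (ℝ × ℝ)) → Lp (Vec n) 1 (volume : Measure (ℝ × ℝ)) :=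
    fun F => (hmem F).toLp with hT
  have hmaps : MapsTo T (Metric.closedBall 0 R) (Metric.closedBall 0 R) := fun F hF => by
    have h1 := (hpr' F).2.lintegral_rhs_le hK hΓ hP hΓL hPL hR hd (hpr' F).1 (hprs F hF)
    rw [mem_closedBall_zero_iff]
    have h2 : ‖T F‖ₑ ≤ R := by
      rw [hT, Lp.enorm_toLp, eLpNorm_one_eq_lintegral_enorm]
      simp only [enorm_indicator_eq_indicator_enorm]
      rwa [lintegral_indicator hK.measurableSet]
    rw [enorm_eq_nnnorm] at h2
    exact_mod_cast h2
  have hcontr : ContractingWith 2⁻¹ (hmaps.restrict T _ _) := by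
    refine ⟨by rw [← NNReal.coe_lt_coe]; norm_num, fun F G => ?_⟩
    have hF := (hpr' F).1
    have hG := (hpr' G).1
    have h1 := lintegral_rhs_sub_le_size (c := c) (f := d.f) hΓ hP hΓL hPL hF hG
      hd.1.integrable_f.aestronglyMeasurable
      ((hpr' F).2.sizeRight_le hK hd (hprs F F.2)) ((hpr' G).2.sizeLeft_le hK hd (hprs G G.2))
      ((hpr' G).2.sizeRight_le hK hd (hprs G G.2))
      (η := η) (by simpa [eLpNorm_one_eq_lintegral_enorm] using hd.2.2.2) (by exact_mod_cast hM)
    -- Both profiles share the forcing and the initial data, so the forcing term vanishes and `size`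
    -- reduces to half the distance of the sources: the contraction factor is `½`.
    simp only [sub_self, enorm_zero, lintegral_zero, mul_zero, add_zero] at h1
    have h2 : (pr F - pr G).size = 2⁻¹ * ∫⁻ z, ‖(pr F - pr G).F z‖ₑ := by
      have e1 : (pr F - pr G).κ = 0 := sub_self _
      have e2 : (pr F - pr G).φ = 0 := sub_self _
      have e3 : (pr F - pr G).ψ = 0 := sub_self _
      simp [Profile.size, e1, e2, e3]
    have h3 : edist (T F) (T G)
        = ∫⁻ z in K, ‖rhs Γ P d.f ((pr F).triple c) z - rhs Γ P d.f ((pr G).triple c) z‖ₑ := by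
      rw [hT, Lp.edist_toLp_toLp, eLpNorm_one_eq_lintegral_enorm, ← Set.indicator_sub']
      simp only [enorm_indicator_eq_indicator_enorm]
      rw [lintegral_indicator hK.measurableSet]
      rfl
    show edist (T F) (T G) ≤ _
    rw [h3]
    refine h1.trans ?_
    rw [h2, ENNReal.coe_inv two_ne_zero, ENNReal.coe_ofNat]
    gcongr
    exact hprF F G
  obtain ⟨F, hFs, hFix, -⟩ := ContractingWith.exists_fixedPoint'
    (Metric.isClosed_closedBall.isComplete) hmaps hcontr
    (x := 0) (Metric.mem_closedBall_self R.2) (edist_ne_top _ _)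
  refine ⟨pr F, (hpr' F).1, (hpr' F).2, ?_, hprs F hFs⟩
  have h1 : T F =ᵐ[volume] K.indicator (rhs Γ P d.f ((pr F).triple c)) := (hmem F).coeFn_toLp
  rw [hFix.eq] at h1
  filter_upwards [h1] with z hz hzK
  show K.indicator F z = _
  rw [indicator_of_mem hzK, hz, indicator_of_mem hzK]

theorem Profile.Regular.memH (hK : IsTrapezoid K) (hp : p.Regular K) : MemH K (p.triple c) where
  continuousOn := (hp.continuous hK).continuousOn
  bounded := by
    refine ⟨p.size.toReal, fun z _ => ?_⟩
    rw [← toReal_enorm]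
    exact ENNReal.toReal_mono hp.size_ne_top (enorm_dAlembert_le hp.F_meas z)
  weakPartials := hp.hasWeakPartials hK
  ut_mem := by
    have hA := isCbL1_charDeriv (σ := -1) hK (by simp) hp.φ_meas hp.F_meas hp.φ_int hp.F_int
    have hB := isCbL1_charDeriv (σ := 1) hK (by simp) hp.ψ_meas hp.F_meas hp.ψ_int hp.F_int
    simpa only [Profile.triple, sub_eq_add_neg] using hB.add hK hA.neg
  ux_mem := (isCbL1_charDeriv hK (by simp) hp.φ_meas hp.F_meas hp.φ_int hp.F_int).add hK
    (isCbL1_charDeriv hK (by simp) hp.ψ_meas hp.F_meas hp.ψ_int hp.F_int)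

theorem exists_isSmallSolution (hK : IsTrapezoid K) (hΓ : ∀ j k y, ‖Γ j k y‖ ≤ g)
    (hP : ∀ y, ‖P y‖ ≤ g) (hΓL : ∀ j k, LipschitzWith L (Γ j k)) (hPL : LipschitzWith L P)
    (hM : 4 * g * (η / 2 + R / 2) + L * (2 * (η / 2 + R / 2) ^ 2 + η) ≤ 1)
    (hR : 2 * g * (η / 2 + R / 2) ^ 2 + g * η ≤ R) (hd : d ∈ smallData K η) :
    ∃ U : Triple n, IsSmallSolution K Γ P R d U := by
  obtain ⟨c, hc⟩ := hK.nonempty_interior_base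
  obtain ⟨p, hp, hpd, hps, hpF⟩ := exists_profile_solves hK hΓ hP hΓL hPL hM hR hd c
  have hle := hpd.lintegral_rhs_le hK hΓ hP hΓL hPL hR hd hp hpF
  have hmeas : AEStronglyMeasurable (rhs Γ P d.f (p.triple c)) (volume.restrict K) :=
    hp.aestronglyMeasurable_rhs hK (fun j k => (hΓL j k).continuous)
      hPL.continuous hd.1.integrable_f.aestronglyMeasurable
  have hi : IntegrableOn (rhs Γ P d.f (p.triple c)) K :=
    ⟨hmeas, hle.trans_lt ENNReal.coe_lt_top⟩
  refine ⟨p.triple c, hp.memH hK, ⟨(hp.continuous hK).continuousOn, hp.hasWeakPartials hK,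
    hi.locallyIntegrableOn, fun t x hz => ?_⟩, ?_⟩
  · exact hpd.dAlembert_eq hK (interior_subset hc) hd.1 hps hz
  · rwa [eLpNorm_one_eq_lintegral_enorm, ENNReal.ofReal_coe_nnreal]

/-- The solution map is Lipschitz continuous. -/
theorem IsSmallSolution.distH_le (hK : IsTrapezoid K) (hΓ : ∀ j k y, ‖Γ j k y‖ ≤ g)
    (hP : ∀ y, ‖P y‖ ≤ g) (hΓL : ∀ j k, LipschitzWith L (Γ j k)) (hPL : LipschitzWith L P)
    (hM : 4 * g * (η / 2 + R / 2) + L * (2 * (η / 2 + R / 2) ^ 2 + η) ≤ 1) {d' : Data n}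
    (hd : d ∈ smallData K η) (hd' : d' ∈ smallData K η) {U U' : Triple n}
    (hU : IsSmallSolution K Γ P R d U) (hU' : IsSmallSolution K Γ P R d' U') :
    distH K U U' ≤ 5 * ((2 + g) * d.dist K d') := by
  -- The base point is taken in the interior, so that the essential supremum of the continuous
  -- difference of initial positions bounds its value there.
  obtain ⟨c, hc⟩ := hK.nonempty_interior_base
  have hr := hU.rhs_le
  have hr' := hU'.rhs_le
  rw [ENNReal.ofReal_coe_nnreal] at hr hr'
  obtain ⟨p, hp, hpd, hps, hu, ht, hx, hF⟩ := hU.mild.exists_profile hK (interior_subset hc) hd.1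
    (ne_top_of_le_ne_top ENNReal.coe_ne_top hr)
  obtain ⟨q, hq, hqd, hqs, hu', ht', hx', hF'⟩ := hU'.mild.exists_profile hK (interior_subset hc)
    hd'.1 (ne_top_of_le_ne_top ENNReal.coe_ne_top hr')
  have hpF := hF.trans_le hr
  have hqF := hF'.trans_le hr'
  refine (distH_le_of_profile hK hp hq hU.memH hU'.memH hu hu' ht hx ht' hx').trans ?_
  gcongr
  refine Profile.Solves.size_sub_le hK hc hΓ hP hΓL hPL hp hq hd.1 hd'.1 hpd hqd hps hqs
    (hpd.sizeRight_le hK hd hpF) (hqd.sizeLeft_le hK hd' hqF) (hqd.sizeRight_le hK hd' hqF)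
    (η := η) (by simpa using hd'.2.2.2) (by exact_mod_cast hM)

theorem mem_smallData_of_forall_dist_lt {η : ℝ} (hd : d.Admissible K)
    (h : ∀ ε : ℝ≥0∞, 0 < ε → ∃ d' ∈ smallData K η, d.dist K d' < ε) : d ∈ smallData K η := by
  have key : ∀ {α : Type} [MeasurableSpace α] {μ : Measure α} {w w' : α → Vec n},
      AEStronglyMeasurable w μ → AEStronglyMeasurable w' μ →
      eLpNorm w 1 μ ≤ eLpNorm w' 1 μ + eLpNorm (w - w') 1 μ := fun {_ _ μ w w'} hw hw' => by
    calc eLpNorm w 1 μ = eLpNorm (w' + (w - w')) 1 μ := by rw [add_sub_cancel]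
      _ ≤ _ := eLpNorm_add_le hw' (hw.sub hw') le_rfl
  have hb : ∀ d' : Data n,
      eLpNorm (d.Du₀ - d'.Du₀) 1 (volume.restrict (base K))
        + eLpNorm (d.v₀ - d'.v₀) 1 (volume.restrict (base K)) ≤ d.dist K d' := fun d' => by
    simp only [Data.dist]
    refine le_add_right ?_
    gcongr
    exact le_add_self
  refine ⟨hd, ENNReal.le_of_forall_pos_le_add fun ε hε _ => ?_,
    ENNReal.le_of_forall_pos_le_add fun ε hε _ => ?_,
    ENNReal.le_of_forall_pos_le_add fun ε hε _ => ?_⟩ <;>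
  obtain ⟨d', hd', hlt⟩ := h ε (by exact_mod_cast hε)
  · have m1 := hd.integrable_Du₀.aestronglyMeasurable
    have m2 := hd.integrable_v₀.aestronglyMeasurable
    have m1' := hd'.1.integrable_Du₀.aestronglyMeasurable
    have m2' := hd'.1.integrable_v₀.aestronglyMeasurable
    refine (key (m1.add m2) (m1'.add m2')).trans (add_le_add hd'.2.1 ?_)
    rw [add_sub_add_comm]
    exact ((eLpNorm_add_le (m1.sub m1') (m2.sub m2') le_rfl).trans (hb d')).trans hlt.le
  · have m1 := hd.integrable_Du₀.aestronglyMeasurable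
    have m2 := hd.integrable_v₀.aestronglyMeasurable
    have m1' := hd'.1.integrable_Du₀.aestronglyMeasurable
    have m2' := hd'.1.integrable_v₀.aestronglyMeasurable
    refine (key (m1.sub m2) (m1'.sub m2')).trans (add_le_add hd'.2.2.1 ?_)
    rw [sub_sub_sub_comm]
    exact ((eLpNorm_sub_le (m1.sub m1') (m2.sub m2') le_rfl).trans (hb d')).trans hlt.le
  · refine (key hd.integrable_f.aestronglyMeasurable
      hd'.1.integrable_f.aestronglyMeasurable).trans (add_le_add hd'.2.2.2 ?_)
    exact le_add_self.trans hlt.le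

theorem Data.dist_self (K : Set (ℝ × ℝ)) (d : Data n) : d.dist K d = 0 := by
  simp [Data.dist]

/-- With `R = (2 g + 1) η` the common bound `η / 2 + R / 2` is `η (g + 1)`. The choice `4 η (g + 1)²
(1 + L) = 1` makes the first inequality sharp enough and gives `2 g (η (g + 1))² ≤ g η / 2`, so the
second left-hand side is at most `3 g η / 2 ≤ R`. -/
theorem exists_constants (g L : ℝ≥0) : ∃ η R : ℝ≥0, 0 < η ∧ 0 < R ∧
    4 * g * (η / 2 + R / 2) + L * (2 * (η / 2 + R / 2) ^ 2 + η) ≤ 1 ∧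
    2 * g * (η / 2 + R / 2) ^ 2 + g * η ≤ R := by
  set s : ℝ≥0 := (g + 1) ^ 2 * (1 + L) with hs
  have hs1 : 1 ≤ s := one_le_mul_of_one_le_of_one_le (one_le_pow₀ le_add_self) le_self_add
  refine ⟨1 / (4 * s), 1 / (4 * s) * (2 * g + 1), by positivity, by positivity, ?_, ?_⟩
  all_goals
    set η : ℝ≥0 := 1 / (4 * s) with hη
    have hηs : 4 * η * s = 1 := by
      rw [hη]
      field_simp
    have e : η / 2 + η * (2 * g + 1) / 2 = η * (g + 1) := by
      ring
    rw [e]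
    rw [← NNReal.coe_le_coe]
    rw [← NNReal.coe_le_coe, hs] at hs1
    rw [← NNReal.coe_inj, hs] at hηs
    push_cast at *
    have hg : (0 : ℝ) ≤ g := g.2
    have hL : (0 : ℝ) ≤ L := L.2
    have h0 : (0 : ℝ) ≤ η := η.2
    generalize (g : ℝ) = g at *
    generalize (L : ℝ) = L at *
    generalize (η : ℝ) = η at *
    have hgL : 0 ≤ η * (g + 1) ^ 2 * L := by positivity
    have h4 : 4 * (η * (g + 1) ^ 2) ≤ 1 := by nlinarith
  · have h5 : η ≤ η * (g + 1) ^ 2 := by nlinarith [mul_nonneg h0 hg, mul_nonneg (mul_nonneg h0 hg) hg]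
    have h6 : η ≤ 1 := by nlinarith [mul_nonneg h0 hg, mul_nonneg (mul_nonneg h0 hg) hg]
    have h7 : 2 * (η * (g + 1)) ^ 2 ≤ η * (g + 1) ^ 2 := by nlinarith [sq_nonneg (g + 1)]
    have h8 : 4 * g * (η * (g + 1)) ≤ 4 * (η * (g + 1) ^ 2) := by
      nlinarith [mul_nonneg h0 hg]
    have h9 : L * (2 * (η * (g + 1)) ^ 2 + η) ≤ L * (2 * (η * (g + 1) ^ 2)) :=
      mul_le_mul_of_nonneg_left (by linarith) hL
    nlinarith
  · have h5 : 2 * g * (η * (g + 1)) ^ 2 = (2 * g * η) * (η * (g + 1) ^ 2) := by ring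
    have h6 : (2 * g * η) * (η * (g + 1) ^ 2) ≤ (2 * g * η) * (1 / 4) :=
      mul_le_mul_of_nonneg_left (by linarith) (by positivity)
    nlinarith [mul_nonneg h0 hg]

end

end WaveMap

end

/-! ### The theorem. -/

theorem mainTheorem7 (n : ℕ) (K : Set (ℝ × ℝ)) (hK : WaveMap.IsTrapezoid K)
    (Γ : Fin n → Fin n → Vec n → Vec n) (P : Vec n → Vec n →L[ℝ] Vec n)
    (γ : ℝ) (hΓ_bdd : ∀ j k y, ‖Γ j k y‖ ≤ γ) (hP_bdd : ∀ y, ‖P y‖ ≤ γ)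
    (L : ℝ≥0) (hΓ_lip : ∀ j k, LipschitzWith L (Γ j k)) (hP_lip : LipschitzWith L P) :
    ∃ η : ℝ, 0 < η ∧
      -- existence
      (∀ d ∈ WaveMap.smallData (n := n) K η, ∃ U : WaveMap.Triple n,
        WaveMap.MemH K U ∧ WaveMap.IsMildSolution K Γ P d U) ∧
      ∃ R : ℝ, 0 < R ∧
        -- existence and uniqueness among the solutions with right-hand side of norm at most `R`
        (∀ d ∈ WaveMap.smallData (n := n) K η, ∃ U : WaveMap.Triple n,
          WaveMap.IsSmallSolution K Γ P R d U ∧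
          ∀ U' : WaveMap.Triple n, WaveMap.IsSmallSolution K Γ P R d U' → EqOn U'.u U.u K) ∧
        -- the set of small data is closed
        (∀ d : WaveMap.Data n, d.Admissible K →
          (∀ ε : ℝ≥0∞, 0 < ε → ∃ d' ∈ WaveMap.smallData (n := n) K η, d.dist K d' < ε) →
          d ∈ WaveMap.smallData (n := n) K η) ∧
        -- the map from data in this set to the solution is continuous
        (∀ d ∈ WaveMap.smallData (n := n) K η, ∀ U : WaveMap.Triple n,
          WaveMap.IsSmallSolution K Γ P R d U →
          ∀ ε : ℝ≥0∞, 0 < ε → ∃ δ : ℝ≥0∞, 0 < δ ∧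
            ∀ d' ∈ WaveMap.smallData (n := n) K η, d.dist K d' < δ →
              ∀ U' : WaveMap.Triple n, WaveMap.IsSmallSolution K Γ P R d' U' →
                WaveMap.distH K U U' < ε) := by
  obtain ⟨η, R, hη, hR, hM, hRle⟩ := WaveMap.exists_constants γ.toNNReal L
  have hΓ : ∀ j k y, ‖Γ j k y‖ ≤ (γ.toNNReal : ℝ) := fun j k y =>
    (hΓ_bdd j k y).trans (Real.le_coe_toNNReal γ)
  have hP : ∀ y, ‖P y‖ ≤ (γ.toNNReal : ℝ) := fun y => (hP_bdd y).trans (Real.le_coe_toNNReal γ)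
  have hex := fun d (hd : d ∈ WaveMap.smallData (n := n) K η) =>
    WaveMap.exists_isSmallSolution hK hΓ hP hΓ_lip hP_lip hM hRle hd
  refine ⟨η, hη, fun d hd => ?_, R, hR, fun d hd => ?_, fun d hd h =>
    WaveMap.mem_smallData_of_forall_dist_lt hd h, fun d hd U hU ε hε => ?_⟩
  · obtain ⟨U, hU⟩ := hex d hd
    exact ⟨U, hU.memH, hU.mild⟩
  · obtain ⟨U, hU⟩ := hex d hd
    refine ⟨U, hU, fun U' hU' z hz => ?_⟩
    -- Uniqueness is the Lipschitz estimate with identical data: the distance of the two solutions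
    -- is zero.
    have h := hU'.distH_le hK hΓ hP hΓ_lip hP_lip hM hd hd hU
    rw [WaveMap.Data.dist_self, mul_zero, mul_zero] at h
    have h1 : ‖U'.u z - U.u z‖ₑ ≤ 0 :=
      ((le_iSup₂ (f := fun z (_ : z ∈ K) => ‖U'.u z - U.u z‖ₑ) z hz).trans le_self_add).trans h
    exact sub_eq_zero.1 (enorm_eq_zero.1 (nonpos_iff_eq_zero.1 h1))
  · refine ⟨ε / (5 * (2 + γ.toNNReal)), ENNReal.div_pos hε.ne' (by finiteness),
      fun d' hd' hlt U' hU' => ?_⟩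
    refine (hU.distH_le hK hΓ hP hΓ_lip hP_lip hM hd hd' hU').trans_lt ?_
    rw [← mul_assoc]
    exact ENNReal.mul_lt_of_lt_div' hlt
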